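/- Let $D>1$ be a positive fundamental discriminant, $E=\mathbb{Q}(\sqrt D)\subset\mathbb{R}$ with nontrivial automorphism $\sigma$, and $\mathrm{Cl}_D^+$ its narrow class group (fractional ideals modulo principal ideals with a totally positive generator). Let $J\in\mathrm{Cl}_D^+$ be the class of the different $\mathfrak{d}=(\sqrt D)$. Let $\Gamma=\mathrm{SL}_2(\mathbb{Z})$, acting on the upper half-plane $\mathbb{H}$ with area $d\mu=y^{-2}\,dx\,dy$; write $\mathrm{vol}$ for $\mu$ and for the induced measure on $\Gamma\backslash\mathbb{H}$. A continuity set is a set $B\subset\Gamma\backslash\mathbb{H}$ whose topological boundary has measure zero; $\Gamma B\subset\mathbb{H}$ denotes its full preimage. To each $A\in\mathrm{Cl}_D^+$ attach a hyperbolic orbifold (of level $q=1$) as follows. Choose $w\in E$ with $0<\sigma(w)<1<w$ such that $\mathbb{Z}w+\mathbb{Z}$ is a fractional ideal in the class $A$. Its minus continued fraction $$w=n_1-\cfrac{1}{n_2-\cfrac{1}{n_3-\cdots}},\qquad n_j\ge 2,$$ is purely periodic; let $(n_1,\dots,n_\ell)$ be its primitive period and put $c_k=n_1+\dots+n_k$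 for $0\le k\le \ell$. With $S=\begin{pmatrix}0&-1\\1&0\end{pmatrix}$ and $T=\begin{pmatrix}1&1\\0&1\end{pmatrix}$, let $\Gamma_A\subset\mathrm{PSL}_2(\mathbb{Z})$ be generated by $T^{c_\ell}$ and $T^{c_k}ST^{-c_k}$ for $1\le k\le\ell$, let $\mathcal{N}_A$ be the smallest nonempty $\Gamma_A$-invariant open (geodesically) convex subset of $\mathbb{H}$, and let $$\mathcal{F}_A=\{z\in\mathcal{N}_A : 0\le \mathrm{Re}(z)\le c_\ell,\ |z-c_k|\ge 1 \text{ for } 0\le k\le\ell\},$$ a fundamental domain for $\Gamma_A\backslash\mathcal{N}_A$. Let $H$ be a subgroup of $\mathrm{Cl}_D^+$ and let $C\in\mathrm{Cl}_D^+$ be such that $C^2J\in H$. Then for every continuity set $B\subset\Gamma\backslash\mathbb{H}$, $$\frac{\sum_{A\in CH}\mathrm{vol}(\mathcal{F}_A\cap\Gamma B)}{\sum_{A\in CH}\mathrm{vol}(\mathcal{F}_A)}=\frac{\mathrm{vol}(B)}{\mathrm{vol}(\Gamma\backslash\mathbb{H})}.$$ -/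

import Mathlib

open scoped UpperHalfPlane MatrixGroups Modular Pointwise NumberField nonZeroDivisors ENNReal

/-- `D` is the discriminant of a quadratic field (or `D = 1`). -/
def IsFundamentalDiscriminant (D : ℤ) : Prop :=
  (D % 4 = 1 ∧ Squarefree D) ∨
    ∃ m : ℤ, D = 4 * m ∧ (m % 4 = 2 ∨ m % 4 = 3) ∧ Squarefree m

/-! ### The narrow class group -/

/-- The totally positive elements of `Eˣ`: those that are positive in every real embedding. -/
def totallyPositiveUnits (E : Type*) [Field E] : Subgroup Eˣ where
  carrier := {x | ∀ φ : E →+* ℝ, 0 < φ x}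
  one_mem' := fun φ => by simp
  mul_mem' := fun {x y} hx hy φ => by
    simpa using mul_pos (hx φ) (hy φ)
  inv_mem' := fun {x} hx φ => by
    simpa using hx φ

/-- The principal fractional ideals with a totally positive generator. -/
noncomputable def narrowPrincipal (E : Type*) [Field E] [NumberField E] :
    Subgroup (FractionalIdeal (𝓞 E)⁰ E)ˣ :=
  (totallyPositiveUnits E).map (toPrincipalIdeal (𝓞 E) E)

/-- The narrow class group `Cl⁺` of `E`. -/
abbrev NarrowClassGroup (E : Type*) [Field E] [NumberField E] : Type _ :=
  (FractionalIdeal (𝓞 E)⁰ E)ˣ ⧸ narrowPrincipal E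

/-- The narrow class of an invertible fractional ideal. -/
noncomputable def narrowClass {E : Type*} [Field E] [NumberField E]
    (I : (FractionalIdeal (𝓞 E)⁰ E)ˣ) : NarrowClassGroup E :=
  QuotientGroup.mk I

/-- The narrow class of the principal fractional ideal generated by `x`. -/
noncomputable def narrowClassOfElement {E : Type*} [Field E] [NumberField E] (x : Eˣ) :
    NarrowClassGroup E :=
  narrowClass (toPrincipalIdeal (𝓞 E) E x)

/-- With `E` (real quadratic) regarded as a subfield of `ℝ` through `ι`: the number `w` is reduced,
that is `0 < w^σ < 1 < w`, and the lattice `ℤ w + ℤ` is a fractional ideal in the narrow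
class `A`. -/
def IsReducedRepresentative {E : Type*} [Field E] [NumberField E] (ι : E →+* ℝ)
    (A : NarrowClassGroup E) (w : E) : Prop :=
  1 < ι w ∧ (∀ φ : E →+* ℝ, φ ≠ ι → 0 < φ w ∧ φ w < 1) ∧
    ∃ I : (FractionalIdeal (𝓞 E)⁰ E)ˣ,
      (∀ x : E, x ∈ (I : FractionalIdeal (𝓞 E)⁰ E) ↔ ∃ m n : ℤ, x = m * w + n) ∧
      narrowClass I = A

/-- A reduced number representing the narrow class `A`. By the classical reduction theory every
narrow class of a real quadratic field has one; there are finitely many, and they have the same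
minus continued fraction up to a shift. -/
noncomputable def reducedRepresentative {E : Type*} [Field E] [NumberField E] (ι : E →+* ℝ)
    (A : NarrowClassGroup E) : E :=
  Classical.epsilon (IsReducedRepresentative ι A)

/-! ### The minus continued fraction `x = n₁ - 1/(n₂ - 1/(n₃ - ⋯))` -/

/-- One step of the algorithm: `x = ⌈x⌉ - 1 / minusStep x`. -/
noncomputable def minusStep (x : ℝ) : ℝ := (⌈x⌉ - x)⁻¹

/-- The length `ℓ` of the primitive cycle `(n₁, …, n_ℓ)` of a purely periodic expansion. -/
noncomputable def minusPeriod (x : ℝ) : ℕ := Function.minimalPeriod minusStep x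

/-- The partial sum `n₁ + ⋯ + n_k` of the digits `n_{j+1} = ⌈minusStep^[j] x⌉`. -/
noncomputable def minusDigitSum (x : ℝ) (k : ℕ) : ℤ :=
  ∑ j ∈ Finset.range k, ⌈minusStep^[j] x⌉

/-! ### The hyperbolic orbifold attached to a purely periodic expansion -/

/-- The (full preimage in `SL₂(ℤ)` of the) Fuchsian group generated by
`S_k = T^(n₁+⋯+n_k) S T^(-(n₁+⋯+n_k))` for `1 ≤ k ≤ ℓ`, and `T^(n₁+⋯+n_ℓ)`. -/
noncomputable def orbifoldGroup (x : ℝ) : Subgroup SL(2, ℤ) :=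
  Subgroup.closure
    (insert (ModularGroup.T ^ minusDigitSum x (minusPeriod x))
      {g | ∃ k ∈ Finset.Icc 1 (minusPeriod x),
        g = ModularGroup.T ^ minusDigitSum x k * ModularGroup.S *
          (ModularGroup.T ^ minusDigitSum x k)⁻¹})

/-- Convexity in the hyperbolic plane: the set contains, with any two points, the geodesic segment
between them. -/
def HyperbolicConvex (U : Set ℍ) : Prop :=
  ∀ z ∈ U, ∀ w ∈ U, ∀ p : ℍ, dist z p + dist p w = dist z w → p ∈ U

/-- The nonempty `G`-invariant open convex subsets of `ℍ`. -/
def invariantOpenConvex (G : Subgroup SL(2, ℤ)) : Set (Set ℍ) :=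
  {U | U.Nonempty ∧ IsOpen U ∧ HyperbolicConvex U ∧ ∀ g ∈ G, ∀ z ∈ U, g • z ∈ U}

/-- The Nielsen region of `G`: the smallest nonempty `G`-invariant open convex subset of `ℍ`
(for the groups used here there is a smallest one, so it is the intersection of all of them). -/
def nielsenRegion (G : Subgroup SL(2, ℤ)) : Set ℍ :=
  ⋂₀ invariantOpenConvex G

/-- The hyperbolic polygon that is a fundamental domain for `orbifoldGroup x` on `ℍ`:
the strip `0 ≤ Re z ≤ n₁ + ⋯ + n_ℓ` outside the unit discs centred at the partial
sums `n₁ + ⋯ + n_k`, `0 ≤ k ≤ ℓ`. -/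
def orbifoldPolygon (x : ℝ) : Set ℍ :=
  {z | 0 ≤ z.re ∧ z.re ≤ minusDigitSum x (minusPeriod x) ∧
    ∀ k ≤ minusPeriod x, 1 ≤ ‖(z : ℂ) - (minusDigitSum x k : ℂ)‖}

/-- The canonical fundamental domain `F_A` of `Γ_A \ N_A`. -/
noncomputable def orbifoldDomain {E : Type*} [Field E] [NumberField E] (ι : E →+* ℝ)
    (A : NarrowClassGroup E) : Set ℍ :=
  orbifoldPolygon (ι (reducedRepresentative ι A)) ∩
    nielsenRegion (orbifoldGroup (ι (reducedRepresentative ι A)))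

/-! ### The modular surface -/

/-- The modular surface `SL₂(ℤ) \ ℍ`, with the quotient topology. -/
abbrev ModularSurface : Type := MulAction.orbitRel.Quotient SL(2, ℤ) ℍ

/-- The full preimage in `ℍ` of a subset of the modular surface. -/
def modularPreimage (B : Set ModularSurface) : Set ℍ :=
  {z | (Quotient.mk _ z : ModularSurface) ∈ B}

/-- The hyperbolic area (for `dx dy / y²`) of a subset of the modular surface, computed in the
standard fundamental domain `𝒟`. -/
noncomputable def modularVolume (B : Set ModularSurface) : ℝ≥0∞ :=
  MeasureTheory.volume (modularPreimage B ∩ 𝒟)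

/-- A continuity set: its topological boundary has measure zero. -/
def IsContinuitySet (B : Set ModularSurface) : Prop :=
  modularVolume (frontier B) = 0

/-! Call `w` in E reduced if 0 < σ(w) < 1 < w. The reduced numbers with lattice ℤw + ℤ in the class
A form a single cycle under the continued fraction step w ↦ 1/(⌈w⌉ - w). Up to null sets, the strip
of F_A between c_k and c_(k+1) is the translate by c_k of the gap cell of the k-th number w of this
cycle: the points with 0 < Re z < n, n = ⌈w⌉, outside the unit discs about 0 and n and above the
geodesic from σ(w) to w. Hence the measure of F_A is a sum over the reduced numbers of A
(`RealQuadratic.measure_orbifoldDomain`). Two inclusions identify the Nielsen region there. The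
half-planes above all translates of one gap geodesic intersect in an invariant open convex set
(`ReducedChain.convexCore_mem`). Conversely, every invariant open convex set contains vertical
geodesics over cusps arbitrarily close to the ends of each gap geodesic, hence what lies above it
(`ReducedChain.mem_of_above`).

Integral vertical lines cut a gap cell into n pieces, which translations move into the Farey
triangle Δ with vertices 0, 1, ∞. Let V = TS : z ↦ 1 - 1/z be its rotation of order three. The first
piece lies above the geodesic of w and outside the disc about 0. The last piece is the image under V
of the part of Δ above the geodesic of the next number of the cycle and inside that disc. So first
and last pieces, summed over a cycle, give the parts of Δ above the geodesics of all w. A middle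
piece, 0 < j < n - 1, is everything in Δ above a geodesic with ends σ(w) - j < 0 and w - j > 1;
there V exchanges above and below and yields the part of Δ below the geodesic of 1 - 1/σ(w - j).
This number is reduced and of class J A⁻¹: conjugation inverts narrow classes, and division by an
element of negative norm multiplies by J.

Let S be a set of classes stable under A ↦ J A⁻¹. The pairs (w, j) then correspond bijectively to
the reduced numbers of S (`RealQuadratic.bijective_flip`), so above and below parts combine to one
full copy of Δ for each reduced number (`RealQuadratic.tsum_measure_orbifoldDomain`). The argument
works for every invariant measure that is absolutely continuous with respect to area. Apply it to
the area and to its restriction to ΓB: since Δ has three times the measure of the standard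
fundamental domain, the number of reduced numbers cancels in the quotient. The coset CH is stable
because C²J ∈ H and J² = 1. -/

/-! ### Circles and geodesics in the upper half-plane -/

/-- The squared Euclidean distance from `z` to the real point `m`. -/
noncomputable def sqDistReal (m : ℝ) (z : ℍ) : ℝ := (z.re - m) ^ 2 + z.im ^ 2

/-- The function that vanishes on the geodesic with end points `a`, `b` and is positive above it. -/
noncomputable def geodesicForm (a b : ℝ) (z : ℍ) : ℝ :=
  z.re ^ 2 + z.im ^ 2 - (a + b) * z.re + a * b

lemma sqDistReal_pos (m : ℝ) (z : ℍ) : 0 < sqDistReal m z := by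
  have := z.im_pos
  unfold sqDistReal
  positivity

lemma norm_sub_intCast_sq (z : ℍ) (m : ℤ) : ‖(z : ℂ) - (m : ℂ)‖ ^ 2 = sqDistReal m z := by
  rw [← Complex.normSq_eq_norm_sq, Complex.normSq_apply]
  simp [sqDistReal]
  ring

lemma one_le_norm_sub_intCast_iff (z : ℍ) (m : ℤ) :
    1 ≤ ‖(z : ℂ) - (m : ℂ)‖ ↔ 1 ≤ sqDistReal m z := by
  rw [← norm_sub_intCast_sq, one_le_sq_iff_one_le_abs, abs_norm]

lemma geodesicForm_eq (a b : ℝ) (z : ℍ) :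
    geodesicForm a b z = sqDistReal ((a + b) / 2) z - ((a - b) / 2) ^ 2 := by
  unfold geodesicForm sqDistReal
  ring

lemma geodesicForm_comm (a b : ℝ) (z : ℍ) : geodesicForm a b z = geodesicForm b a z := by
  unfold geodesicForm
  ring

lemma cosh_dist_re_im (z w : ℍ) : Real.cosh (dist z w) =
    1 + ((z.re - w.re) ^ 2 + (z.im - w.im) ^ 2) / (2 * z.im * w.im) := by
  rw [UpperHalfPlane.cosh_dist, Complex.dist_eq, ← Complex.normSq_eq_norm_sq,
    Complex.normSq_apply]
  simp
  ring

/-- Inversion in a circle centred on the real line moves an interior point closer to every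
exterior point. -/
lemma dist_inversion_lt (m t : ℝ) (z p : ℍ) (hz : t < sqDistReal m z) (hp : sqDistReal m p < t)
    (q : ℍ) (hqr : q.re = m + t * (p.re - m) / sqDistReal m p)
    (hqi : q.im = t * p.im / sqDistReal m p) : dist z q < dist z p := by
  have h0 := sqDistReal_pos m p
  have hzi := z.im_pos
  have hpi := p.im_pos
  have ht : 0 < t := h0.trans hp
  suffices h : Real.cosh (dist z q) < Real.cosh (dist z p) by
    rwa [Real.cosh_lt_cosh, abs_of_nonneg dist_nonneg, abs_of_nonneg dist_nonneg] at h
  rw [cosh_dist_re_im, cosh_dist_re_im, hqr, hqi]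
  have key : 0 < (sqDistReal m z - t) * (t - sqDistReal m p) :=
    mul_pos (by linarith) (by linarith)
  -- The difference of the two hyperbolic cosines factors exactly, and both factors are positive
  -- because `z` is outside and `p` inside the circle.
  have e1 : ((z.re - p.re) ^ 2 + (z.im - p.im) ^ 2) / (2 * z.im * p.im) -
      ((z.re - (m + t * (p.re - m) / sqDistReal m p)) ^ 2 +
        (z.im - t * p.im / sqDistReal m p) ^ 2) / (2 * z.im * (t * p.im / sqDistReal m p)) =
      (sqDistReal m z - t) * (t - sqDistReal m p) / (2 * z.im * p.im * t) := by
    have e2 : (p.re - m) ^ 2 = sqDistReal m p - p.im ^ 2 := by unfold sqDistReal; ring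
    have e3 : (z.re - m) ^ 2 = sqDistReal m z - z.im ^ 2 := by unfold sqDistReal; ring
    generalize sqDistReal m p = r at *
    generalize sqDistReal m z = s at *
    have e4 : z.re = (z.re - m) + m := by ring
    have e5 : p.re = (p.re - m) + m := by ring
    generalize z.re - m = X at *
    generalize p.re - m = Y at *
    rw [e4, e5]
    field_simp
    ring_nf
    rw [show X ^ 2 = s - z.im ^ 2 from e3, show Y ^ 2 = r - p.im ^ 2 from e2]
    ring
  have : 0 < (sqDistReal m z - t) * (t - sqDistReal m p) / (2 * z.im * p.im * t) := by positivity
  linarith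

/-- If `p` were inside a circle about `m` that has `z` and `w` outside, its inverse point would be
closer to both, contradicting the triangle inequality. This makes the exterior of a half-disc
convex. -/
lemma min_sqDistReal_le (m : ℝ) {z p w : ℍ} (h : dist z p + dist p w = dist z w) :
    min (sqDistReal m z) (sqDistReal m w) ≤ sqDistReal m p := by
  by_contra! hlt
  obtain ⟨t, h1, h2⟩ := exists_between hlt
  have h0 := sqDistReal_pos m p
  have him : 0 < t * p.im / sqDistReal m p := by have := p.im_pos; have := h0.trans h1; positivity
  let q : ℍ := ⟨⟨m + t * (p.re - m) / sqDistReal m p, t * p.im / sqDistReal m p⟩, him⟩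
  have hz := dist_inversion_lt m t z p (lt_min_iff.1 h2).1 h1 q rfl rfl
  have hw := dist_inversion_lt m t w p (lt_min_iff.1 h2).2 h1 q rfl rfl
  have := dist_triangle z q w
  rw [dist_comm w q, dist_comm w p] at hw
  linarith

lemma hyperbolicConvex_geodesicForm_pos (a b : ℝ) :
    HyperbolicConvex {z | 0 < geodesicForm a b z} := by
  intro z hz w hw p h
  have := min_sqDistReal_le ((a + b) / 2) h
  simp only [Set.mem_ofPred_eq, geodesicForm_eq] at *
  rcases min_le_iff.1 this with h | h <;> linarith

/-- The quantity `arsinh ((re - m) / im)` is arc length along a semicircle centred at `m`. Distances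
along such an arc are therefore additive, which shows that it is a geodesic. -/
lemma dist_eq_of_sqDistReal_eq (m : ℝ) {z w : ℍ} (h : sqDistReal m z = sqDistReal m w) :
    dist z w = |Real.arsinh ((z.re - m) / z.im) - Real.arsinh ((w.re - m) / w.im)| := by
  have hz := z.im_pos
  have hw := w.im_pos
  have h0 := sqDistReal_pos m w
  have aux : ∀ p : ℍ, sqDistReal m p = sqDistReal m w →
      Real.cosh (Real.arsinh ((p.re - m) / p.im)) = √(sqDistReal m w) / p.im := by
    intro p hp
    have := p.im_pos
    rw [Real.cosh_arsinh, ← hp, eq_div_iff this.ne', ← Real.sqrt_sq this.le,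
      ← Real.sqrt_mul (by positivity), Real.sqrt_sq this.le]
    congr 1
    unfold sqDistReal
    field_simp
    ring
  suffices hc : Real.cosh (dist z w) =
      Real.cosh (Real.arsinh ((z.re - m) / z.im) - Real.arsinh ((w.re - m) / w.im)) by
    have h1 := (Real.cosh_le_cosh.1 hc.le)
    have h2 := (Real.cosh_le_cosh.1 hc.ge)
    rw [abs_of_nonneg dist_nonneg] at h1 h2
    exact le_antisymm h1 h2
  rw [Real.cosh_sub, aux z h, aux w rfl, Real.sinh_arsinh, Real.sinh_arsinh, cosh_dist_re_im]
  have hs := Real.mul_self_sqrt h0.le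
  have e : √(sqDistReal m w) / z.im * (√(sqDistReal m w) / w.im) =
      sqDistReal m w / (z.im * w.im) := by
    rw [div_mul_div_comm, hs]
  rw [e]
  have e2 : sqDistReal m w = (sqDistReal m z + sqDistReal m w) / 2 := by rw [h]; ring
  rw [e2]
  unfold sqDistReal
  field_simp
  ring

lemma HyperbolicConvex.mem_of_sqDistReal_eq {U : Set ℍ} (hU : HyperbolicConvex U) (m : ℝ)
    {z p w : ℍ} (hz : z ∈ U) (hw : w ∈ U) (hzp : sqDistReal m z = sqDistReal m p)
    (hpw : sqDistReal m p = sqDistReal m w) (h1 : z.re ≤ p.re) (h2 : p.re ≤ w.re) : p ∈ U := by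
  have mono : ∀ x y : ℍ, sqDistReal m x = sqDistReal m y → x.re ≤ y.re →
      Real.arsinh ((x.re - m) / x.im) ≤ Real.arsinh ((y.re - m) / y.im) := by
    intro x y hxy hle
    have hx := x.im_pos
    have hy := y.im_pos
    rw [Real.arsinh_le_arsinh, div_le_div_iff₀ hx hy]
    unfold sqDistReal at hxy
    rcases le_total 0 (x.re - m) with h | h
    · have : y.im ≤ x.im := by nlinarith
      nlinarith
    · rcases le_total 0 (y.re - m) with h' | h'
      · nlinarith
      · have : x.im ≤ y.im := by nlinarith
        nlinarith
  refine hU z hz w hw p ?_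
  have m1 := mono z p hzp h1
  have m2 := mono p w hpw h2
  rw [dist_eq_of_sqDistReal_eq m hzp, dist_eq_of_sqDistReal_eq m hpw,
    dist_eq_of_sqDistReal_eq m (hzp.trans hpw), abs_of_nonpos (by linarith),
    abs_of_nonpos (by linarith), abs_of_nonpos (by linarith)]
  ring

lemma HyperbolicConvex.mem_of_re_eq {U : Set ℍ} (hU : HyperbolicConvex U)
    {z p w : ℍ} (hz : z ∈ U) (hw : w ∈ U) (hzp : z.re = p.re) (hpw : p.re = w.re)
    (h1 : z.im ≤ p.im) (h2 : p.im ≤ w.im) : p ∈ U := by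
  refine hU z hz w hw p ?_
  rw [UpperHalfPlane.dist_of_re_eq hzp, UpperHalfPlane.dist_of_re_eq hpw,
    UpperHalfPlane.dist_of_re_eq (hzp.trans hpw), Real.dist_eq, Real.dist_eq, Real.dist_eq]
  have m1 := Real.log_le_log z.im_pos h1
  have m2 := Real.log_le_log p.im_pos h2
  rw [abs_of_nonpos (by linarith), abs_of_nonpos (by linarith), abs_of_nonpos (by linarith)]
  ring

/-- If a convex set contains the vertical lines over `a` and `b`, then it contains all points
between them that lie above the geodesic from `a` to `b`. -/
lemma HyperbolicConvex.mem_of_vertical {U : Set ℍ} (hU : HyperbolicConvex U) {a b : ℝ}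
    (ha : ∀ z : ℍ, z.re = a → z ∈ U) (hb : ∀ z : ℍ, z.re = b → z ∈ U) {p : ℍ}
    (h1 : a ≤ p.re) (h2 : p.re ≤ b) (hp : 0 < geodesicForm a b p) : p ∈ U := by
  rw [geodesicForm_eq] at hp
  have hpos := Real.sqrt_pos.2 hp
  have hsq := Real.sq_sqrt hp.le
  -- The circle through `p` about the midpoint of `a` and `b` meets both verticals at this height;
  -- it is real exactly when `p` is not below the geodesic.
  set y := √(sqDistReal ((a + b) / 2) p - ((a - b) / 2) ^ 2)
  refine hU.mem_of_sqDistReal_eq ((a + b) / 2) (ha ⟨⟨a, y⟩, hpos⟩ rfl) (hb ⟨⟨b, y⟩, hpos⟩ rfl)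
    ?_ ?_ h1 h2
  · have : sqDistReal ((a + b) / 2) (⟨⟨a, y⟩, hpos⟩ : ℍ) = (a - (a + b) / 2) ^ 2 + y ^ 2 := rfl
    rw [this, hsq]
    ring
  · have : sqDistReal ((a + b) / 2) (⟨⟨b, y⟩, hpos⟩ : ℍ) = (b - (a + b) / 2) ^ 2 + y ^ 2 := rfl
    rw [this, hsq]
    ring

/-! ### Null sets -/

lemma continuous_sqDistReal (m : ℝ) : Continuous (sqDistReal m) := by
  unfold sqDistReal
  exact ((UpperHalfPlane.continuous_re.sub continuous_const).pow 2).add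
    (UpperHalfPlane.continuous_im.pow 2)

lemma continuous_geodesicForm (a b : ℝ) : Continuous (geodesicForm a b) := by
  have := continuous_sqDistReal ((a + b) / 2)
  have e : geodesicForm a b = fun z => sqDistReal ((a + b) / 2) z - ((a - b) / 2) ^ 2 :=
    funext (geodesicForm_eq a b)
  rw [e]
  fun_prop

lemma volume_eq_zero_of_image {s : Set ℍ} (t : Set ℂ) (ht : MeasureTheory.volume t = 0)
    (hst : ∀ z ∈ s, (z : ℂ) ∈ t) : MeasureTheory.volume s = 0 := by
  rw [UpperHalfPlane.volume_eq_lintegral]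
  refine MeasureTheory.setLIntegral_measure_zero _ _ (MeasureTheory.measure_mono_null ?_ ht)
  rintro _ ⟨z, hz, rfl⟩
  exact hst z hz

lemma volume_re_eq (t : ℝ) : MeasureTheory.volume {z : ℍ | z.re = t} = 0 := by
  refine volume_eq_zero_of_image {z : ℂ | z.re = t} ?_ (fun z hz => hz)
  have : {z : ℂ | z.re = t} = Complex.measurableEquivRealProd ⁻¹' ({t} ×ˢ Set.univ) := by
    ext z
    simp [Complex.measurableEquivRealProd_apply]
  rw [this, Complex.volume_preserving_equiv_real_prod.measure_preimage
    (measurableSet_singleton t |>.prod MeasurableSet.univ).nullMeasurableSet,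
    MeasureTheory.Measure.volume_eq_prod, MeasureTheory.Measure.prod_prod]
  simp

lemma volume_sqDistReal_eq (m t : ℝ) : MeasureTheory.volume {z : ℍ | sqDistReal m z = t} = 0 := by
  refine volume_eq_zero_of_image (Metric.sphere (m : ℂ) √t)
    (MeasureTheory.Measure.addHaar_sphere _ _ _) (fun z hz => ?_)
  have hz : sqDistReal m z = t := hz
  rw [mem_sphere_iff_norm, ← hz, ← Real.sqrt_sq (norm_nonneg _), ← Complex.normSq_eq_norm_sq,
    Complex.normSq_apply]
  congr 1
  simp [sqDistReal]
  ring

lemma volume_geodesicForm_eq_zero (a b : ℝ) :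
    MeasureTheory.volume {z : ℍ | geodesicForm a b z = 0} = 0 := by
  simp_rw [geodesicForm_eq, sub_eq_zero]
  exact volume_sqDistReal_eq _ _

/-! ### The action of the generators of the modular group -/

lemma re_S_smul (z : ℍ) : (ModularGroup.S • z).re = -z.re / sqDistReal 0 z := by
  rw [UpperHalfPlane.modular_S_smul, UpperHalfPlane.mk_re, Complex.inv_re, Complex.normSq_apply]
  simp [sqDistReal]
  ring

lemma im_S_smul (z : ℍ) : (ModularGroup.S • z).im = z.im / sqDistReal 0 z := by
  rw [UpperHalfPlane.modular_S_smul, UpperHalfPlane.mk_im, Complex.inv_im, Complex.normSq_apply]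
  simp [sqDistReal]
  ring

lemma sqDistReal_T_zpow_smul (m : ℝ) (n : ℤ) (z : ℍ) :
    sqDistReal m (ModularGroup.T ^ n • z) = sqDistReal (m - n) z := by
  unfold sqDistReal
  rw [ModularGroup.re_T_zpow_smul, ModularGroup.im_T_zpow_smul]
  ring

lemma geodesicForm_T_zpow_smul (a b : ℝ) (n : ℤ) (z : ℍ) :
    geodesicForm a b (ModularGroup.T ^ n • z) = geodesicForm (a - n) (b - n) z := by
  unfold geodesicForm
  rw [ModularGroup.re_T_zpow_smul, ModularGroup.im_T_zpow_smul]
  ring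

/-- The sign of `a * b` decides everything later: ends on the same side of the pole 0 keep above and
below, ends on opposite sides exchange them. -/
lemma geodesicForm_S_smul {a b : ℝ} (ha : a ≠ 0) (hb : b ≠ 0) (z : ℍ) :
    geodesicForm a b (ModularGroup.S • z) =
      a * b / sqDistReal 0 z * geodesicForm (-a⁻¹) (-b⁻¹) z := by
  have h := sqDistReal_pos 0 z
  have e' : z.re ^ 2 = sqDistReal 0 z - z.im ^ 2 := by unfold sqDistReal; ring
  unfold geodesicForm
  rw [re_S_smul, im_S_smul]
  generalize sqDistReal 0 z = r at *
  field_simp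
  rw [e']
  ring

lemma re_T_mul_S_smul (z : ℍ) :
    ((ModularGroup.T * ModularGroup.S) • z).re = 1 - z.re / sqDistReal 0 z := by
  rw [mul_smul, ModularGroup.re_T_smul, re_S_smul]
  ring

lemma im_T_mul_S_smul (z : ℍ) :
    ((ModularGroup.T * ModularGroup.S) • z).im = z.im / sqDistReal 0 z := by
  rw [mul_smul, ModularGroup.im_T_smul, im_S_smul]

lemma sqDistReal_zero_T_mul_S_smul (z : ℍ) :
    sqDistReal 0 ((ModularGroup.T * ModularGroup.S) • z) = sqDistReal 1 z / sqDistReal 0 z := by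
  have h := sqDistReal_pos 0 z
  have e1 : sqDistReal 1 z = sqDistReal 0 z - 2 * z.re + 1 := by unfold sqDistReal; ring
  have e' : z.re ^ 2 = sqDistReal 0 z - z.im ^ 2 := by unfold sqDistReal; ring
  have e0 : sqDistReal 0 ((ModularGroup.T * ModularGroup.S) • z) =
      (1 - z.re / sqDistReal 0 z) ^ 2 + (z.im / sqDistReal 0 z) ^ 2 := by
    rw [← re_T_mul_S_smul, ← im_T_mul_S_smul]; unfold sqDistReal; ring
  rw [e1, e0]
  generalize sqDistReal 0 z = r at *
  field_simp
  ring_nf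
  rw [e']
  ring

lemma sqDistReal_one_T_mul_S_smul (z : ℍ) :
    sqDistReal 1 ((ModularGroup.T * ModularGroup.S) • z) = 1 / sqDistReal 0 z := by
  have h := sqDistReal_pos 0 z
  have e' : z.re ^ 2 = sqDistReal 0 z - z.im ^ 2 := by unfold sqDistReal; ring
  have e0 : sqDistReal 1 ((ModularGroup.T * ModularGroup.S) • z) =
      (z.re / sqDistReal 0 z) ^ 2 + (z.im / sqDistReal 0 z) ^ 2 := by
    conv_lhs => unfold sqDistReal
    rw [re_T_mul_S_smul, im_T_mul_S_smul]
    ring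
  rw [e0]
  generalize sqDistReal 0 z = r at *
  field_simp
  rw [e']
  ring

lemma geodesicForm_T_mul_S_smul {a b : ℝ} (ha : a ≠ 0) (hb : b ≠ 0) (z : ℍ) :
    geodesicForm (1 - a⁻¹) (1 - b⁻¹) ((ModularGroup.T * ModularGroup.S) • z) =
      geodesicForm a b z / (a * b * sqDistReal 0 z) := by
  rw [mul_smul, ← zpow_one ModularGroup.T, geodesicForm_T_zpow_smul,
    show 1 - a⁻¹ - ((1 : ℤ) : ℝ) = -a⁻¹ by push_cast; ring,
    show 1 - b⁻¹ - ((1 : ℤ) : ℝ) = -b⁻¹ by push_cast; ring,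
    geodesicForm_S_smul (by simpa) (by simpa)]
  have h := sqDistReal_pos 0 z
  simp only [inv_neg, inv_inv, neg_neg]
  field_simp

/-! ### Invariance of the hyperbolic area. -/

instance : MeasureTheory.SMulInvariantMeasure SL(2, ℤ) ℍ MeasureTheory.volume :=
  ⟨fun g s _ => MeasureTheory.measure_preimage_smul
    (MeasureTheory.volume : MeasureTheory.Measure ℍ)
      (Matrix.SpecialLinearGroup.toGL (Matrix.SpecialLinearGroup.map (algebraMap ℤ ℝ) g)) s⟩

/-! ### The Farey triangle with vertices `0`, `1`, `∞` -/

/-- The open ideal triangle with vertices `0`, `1`, `∞`. -/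
def fareyTriangle : Set ℍ := {z | 0 < z.re ∧ z.re < 1 ∧ 0 < geodesicForm 0 1 z}

lemma T_mul_S_smul_mem_fareyTriangle (z : ℍ) :
    (ModularGroup.T * ModularGroup.S) • z ∈ fareyTriangle ↔ z ∈ fareyTriangle := by
  have h := sqDistReal_pos 0 z
  have e0 : ∀ w, geodesicForm 0 1 w = sqDistReal 0 w - w.re := by
    intro w; unfold geodesicForm sqDistReal; ring
  have e1 : geodesicForm 0 1 ((ModularGroup.T * ModularGroup.S) • z) =
      (1 - z.re) / sqDistReal 0 z := by
    rw [e0, sqDistReal_zero_T_mul_S_smul, re_T_mul_S_smul,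
      show sqDistReal 1 z = sqDistReal 0 z - 2 * z.re + 1 by unfold sqDistReal; ring]
    field_simp
    ring
  simp only [fareyTriangle, Set.mem_ofPred_eq]
  rw [e1, re_T_mul_S_smul, e0, sub_pos, div_lt_one h, sub_lt_self_iff, div_pos_iff_of_pos_right h,
    div_pos_iff_of_pos_right h, sub_pos, sub_pos]
  tauto

-- Only the cutting function has to be measurable; `s` is arbitrary, so Nielsen regions can be cut
-- without any discussion of their measurability.
open MeasureTheory in
lemma measure_eq_add_of_null {μ : Measure ℍ} {f : ℍ → ℝ} (hf : Continuous f) (t : ℝ)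
    (h : μ {z | f z = t} = 0) (s : Set ℍ) :
    μ s = μ (s ∩ {z | f z < t}) + μ (s ∩ {z | t < f z}) := by
  rw [← measure_inter_add_sdiff s (measurableSet_lt hf.measurable measurable_const :
    MeasurableSet {z | f z < t})]
  congr 1
  refine measure_congr ?_
  filter_upwards [measure_eq_zero_iff_ae_notMem.1 h] with z hz
  refine propext ⟨fun h => ⟨h.1, lt_of_le_of_ne (not_lt.1 h.2) (Ne.symm hz)⟩,
    fun h => ⟨h.1, fun h' => lt_asymm (show t < f z from h.2) (show f z < t from h')⟩⟩

open MeasureTheory in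
lemma measure_eq_of_smul_mem_iff {μ : Measure ℍ} [SMulInvariantMeasure SL(2, ℤ) ℍ μ]
    (g : SL(2, ℤ)) {s t : Set ℍ} (h : ∀ z, g • z ∈ s ↔ z ∈ t) : μ s = μ t := by
  have : (g • ·) ⁻¹' s = t := Set.ext h
  rw [← this, measure_preimage_smul]

-- The rotation V = TS turns the part of the triangle inside the unit disc about 0 into the part
-- outside the unit disc about 1, and moves the ends `a`, `b` to `1 - a⁻¹`, `1 - b⁻¹`. As both ends
-- are positive, above stays above.
open MeasureTheory in
lemma measure_fareyTriangle_above_add {μ : Measure ℍ} [SMulInvariantMeasure SL(2, ℤ) ℍ μ]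
    (hμ : μ ≪ volume) {a b : ℝ} (ha : 0 < a) (hb : 0 < b) :
    μ (fareyTriangle ∩ {z | 1 < sqDistReal 0 z} ∩ {z | 0 < geodesicForm a b z}) +
      μ (fareyTriangle ∩ {z | 1 < sqDistReal 1 z} ∩
        {z | 0 < geodesicForm (1 - a⁻¹) (1 - b⁻¹) z}) =
      μ (fareyTriangle ∩ {z | 0 < geodesicForm a b z}) := by
  rw [measure_eq_add_of_null (continuous_sqDistReal 0) 1 (hμ (volume_sqDistReal_eq 0 1))
    (fareyTriangle ∩ {z | 0 < geodesicForm a b z}), add_comm]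
  congr 1
  · refine measure_eq_of_smul_mem_iff (ModularGroup.T * ModularGroup.S) fun z => ?_
    have h := sqDistReal_pos 0 z
    simp only [Set.mem_inter_iff, T_mul_S_smul_mem_fareyTriangle, Set.mem_ofPred_eq]
    rw [sqDistReal_one_T_mul_S_smul, geodesicForm_T_mul_S_smul ha.ne' hb.ne', one_lt_div h,
      div_pos_iff_of_pos_right (by positivity)]
    tauto
  · rw [Set.inter_right_comm]

-- The pole 0 of V separates the ends, so V exchanges the two sides of the geodesic while preserving
-- the triangle.
open MeasureTheory in
lemma measure_fareyTriangle_above_eq_below {μ : Measure ℍ} [SMulInvariantMeasure SL(2, ℤ) ℍ μ]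
    {a b : ℝ} (ha : 0 < a) (hb : b < 0) :
    μ (fareyTriangle ∩ {z | 0 < geodesicForm a b z}) =
      μ (fareyTriangle ∩ {z | geodesicForm (1 - b⁻¹) (1 - a⁻¹) z < 0}) := by
  refine (measure_eq_of_smul_mem_iff (ModularGroup.T * ModularGroup.S) fun z => ?_).symm
  have h := sqDistReal_pos 0 z
  simp only [Set.mem_inter_iff, T_mul_S_smul_mem_fareyTriangle, Set.mem_ofPred_eq]
  rw [geodesicForm_comm, geodesicForm_T_mul_S_smul ha.ne' hb.ne]
  have : a * b * sqDistReal 0 z < 0 := mul_neg_of_neg_of_pos (mul_neg_of_pos_of_neg ha hb) h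
  rw [div_neg_iff]
  constructor
  · rintro ⟨h1, h2 | h2⟩
    · exact ⟨h1, h2.1⟩
    · linarith [h2.2]
  · exact fun h1 => ⟨h1.1, Or.inl ⟨h1.2, this⟩⟩

open MeasureTheory in
lemma measure_fareyTriangle_above_add_below {μ : Measure ℍ} (hμ : μ ≪ volume) (a b : ℝ) :
    μ (fareyTriangle ∩ {z | 0 < geodesicForm a b z}) +
      μ (fareyTriangle ∩ {z | geodesicForm a b z < 0}) = μ fareyTriangle := by
  rw [measure_eq_add_of_null (continuous_geodesicForm a b) 0
    (hμ (volume_geodesicForm_eq_zero a b)) fareyTriangle, add_comm]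

-- V permutes the vertices ∞, 1, 0 cyclically, and with them the three regions of the triangle
-- nearest to each vertex. The region at ∞ is the part outside both unit discs.
open MeasureTheory in
lemma measure_fareyTriangle_eq {μ : Measure ℍ} [SMulInvariantMeasure SL(2, ℤ) ℍ μ]
    (hμ : μ ≪ volume) :
    μ fareyTriangle = 3 * μ (fareyTriangle ∩ {z | 1 < sqDistReal 0 z ∧ 1 < sqDistReal 1 z}) := by
  set K := fareyTriangle ∩ {z | 1 < sqDistReal 0 z ∧ 1 < sqDistReal 1 z} with hK
  have hV : ∀ z, (ModularGroup.T * ModularGroup.S) • z ∈ K ↔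
      z ∈ fareyTriangle ∩ {z | sqDistReal 0 z < sqDistReal 1 z ∧ sqDistReal 0 z < 1} := by
    intro z
    have h := sqDistReal_pos 0 z
    simp only [hK, Set.mem_inter_iff, T_mul_S_smul_mem_fareyTriangle, Set.mem_ofPred_eq,
      sqDistReal_one_T_mul_S_smul, sqDistReal_zero_T_mul_S_smul]
    rw [one_lt_div h, one_lt_div h]
  have hV2 : ∀ z, (ModularGroup.T * ModularGroup.S) • z ∈
      fareyTriangle ∩ {z | sqDistReal 0 z < sqDistReal 1 z ∧ sqDistReal 0 z < 1} ↔
      z ∈ fareyTriangle ∩ {z | sqDistReal 1 z < 1 ∧ sqDistReal 1 z < sqDistReal 0 z} := by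
    intro z
    have h := sqDistReal_pos 0 z
    simp only [Set.mem_inter_iff, T_mul_S_smul_mem_fareyTriangle, Set.mem_ofPred_eq,
      sqDistReal_one_T_mul_S_smul, sqDistReal_zero_T_mul_S_smul]
    rw [div_lt_div_iff_of_pos_right h, div_lt_one h]
  have e1 := measure_eq_of_smul_mem_iff (μ := μ) _ hV
  have e2 := measure_eq_of_smul_mem_iff (μ := μ) _ hV2
  have n0 := hμ (volume_sqDistReal_eq 0 1)
  have n1 := hμ (volume_sqDistReal_eq 1 1)
  have n2 := hμ (volume_re_eq (1 / 2))
  have hM : ∀ z : ℍ, sqDistReal 1 z - sqDistReal 0 z = 1 - 2 * z.re := by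
    intro z; unfold sqDistReal; ring
  rw [measure_eq_add_of_null (continuous_sqDistReal 0) 1 n0 fareyTriangle,
    measure_eq_add_of_null (UpperHalfPlane.continuous_re) (1 / 2) n2 (_ ∩ {z | sqDistReal 0 z < 1}),
    measure_eq_add_of_null (continuous_sqDistReal 1) 1 n1 (_ ∩ {z | 1 < sqDistReal 0 z})]
  have s1 : fareyTriangle ∩ {z | sqDistReal 0 z < 1} ∩ {z | z.re < 1 / 2} =
      fareyTriangle ∩ {z | sqDistReal 0 z < sqDistReal 1 z ∧ sqDistReal 0 z < 1} := by
    ext z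
    have := hM z
    simp only [Set.mem_inter_iff, Set.mem_ofPred_eq, and_assoc]
    refine and_congr_right fun _ => ⟨fun h => ⟨by linarith, h.1⟩, fun h => ⟨h.2, by linarith⟩⟩
  have s2 : fareyTriangle ∩ {z | 1 < sqDistReal 0 z} ∩ {z | 1 < sqDistReal 1 z} = K := by
    ext z
    simp only [hK, Set.mem_inter_iff, Set.mem_ofPred_eq, and_assoc]
  rw [s1, s2, ← e1]
  have s3 : μ (fareyTriangle ∩ {z | sqDistReal 0 z < 1} ∩ {z | 1 / 2 < z.re}) +
      μ (fareyTriangle ∩ {z | 1 < sqDistReal 0 z} ∩ {z | sqDistReal 1 z < 1}) = μ K := by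
    rw [e1, e2, measure_eq_add_of_null (continuous_sqDistReal 0) 1 n0
      (fareyTriangle ∩ {z | sqDistReal 1 z < 1 ∧ sqDistReal 1 z < sqDistReal 0 z})]
    congr 2
    · ext z
      have := hM z
      simp only [Set.mem_inter_iff, Set.mem_ofPred_eq, and_assoc]
      refine and_congr_right fun _ => ⟨fun h => ⟨by linarith, by linarith, h.1⟩,
        fun h => ⟨h.2.2, by linarith⟩⟩
    · ext z
      simp only [Set.mem_inter_iff, Set.mem_ofPred_eq, and_assoc]
      refine and_congr_right fun _ => ⟨fun h => ⟨h.2, by linarith, h.1⟩, fun h => ⟨h.2.2, h.1⟩⟩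
  rw [add_assoc, ← add_assoc (μ (_ ∩ {z | 1 / 2 < z.re})), s3]
  ring

-- Translation by 1 moves the left half of `𝒟` to the part of the triangle with real part above 1/2;
-- the right half already lies in the triangle.
open MeasureTheory in
lemma measure_fd_eq {μ : Measure ℍ} [SMulInvariantMeasure SL(2, ℤ) ℍ μ] (hμ : μ ≪ volume) :
    μ 𝒟 = μ (fareyTriangle ∩ {z | 1 < sqDistReal 0 z ∧ 1 < sqDistReal 1 z}) := by
  have hfd : ∀ z : ℍ, z ∈ 𝒟 ↔ 1 ≤ sqDistReal 0 z ∧ |z.re| ≤ 1 / 2 := by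
    intro z
    change 1 ≤ Complex.normSq (z : ℂ) ∧ _ ↔ _
    rw [Complex.normSq_apply]
    unfold sqDistReal
    simp only [UpperHalfPlane.coe_re, UpperHalfPlane.coe_im, sub_zero, sq]
  have hM : ∀ z : ℍ, sqDistReal 1 z - sqDistReal 0 z = 1 - 2 * z.re := by
    intro z; unfold sqDistReal; ring
  have hG : ∀ z : ℍ, geodesicForm 0 1 z = sqDistReal 0 z - z.re := by
    intro z; unfold geodesicForm sqDistReal; ring
  have n0 := hμ (volume_sqDistReal_eq 0 1)
  have nr := fun t => hμ (volume_re_eq t)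
  rw [measure_eq_add_of_null (UpperHalfPlane.continuous_re) 0 (nr 0) 𝒟,
    measure_eq_add_of_null (UpperHalfPlane.continuous_re) (1 / 2) (nr _) (fareyTriangle ∩ _),
    add_comm]
  congr 1
  · refine measure_congr ?_
    filter_upwards [measure_eq_zero_iff_ae_notMem.1 n0,
      measure_eq_zero_iff_ae_notMem.1 (nr (1 / 2))] with z h0 h1
    refine propext ?_
    change (z ∈ 𝒟 ∧ 0 < z.re) ↔ (_ ∧ _ ∧ _) ∧ z.re < 1 / 2
    have := hM z
    have hg := hG z
    rw [hfd, abs_le]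
    simp only [fareyTriangle, Set.mem_ofPred_eq] at *
    constructor
    · rintro ⟨⟨h2, h3, h4⟩, h5⟩
      have h6 := lt_of_le_of_ne h2 (Ne.symm h0)
      have h7 := lt_of_le_of_ne h4 h1
      exact ⟨⟨⟨h5, by linarith, by linarith⟩, h6, by linarith⟩, h7⟩
    · rintro ⟨⟨⟨h1, h2, h3⟩, h4, h5⟩, h6⟩
      exact ⟨⟨h4.le, by linarith, by linarith⟩, h1⟩
  · refine Eq.trans (measure_eq_of_smul_mem_iff (ModularGroup.T ^ (-1 : ℤ))
      (t := {z | 1 ≤ sqDistReal 1 z ∧ 1 / 2 ≤ z.re ∧ z.re < 1}) fun z => ?_) ?_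
    · simp only [Set.mem_inter_iff, hfd, Set.mem_ofPred_eq, sqDistReal_T_zpow_smul,
        ModularGroup.re_T_zpow_smul, abs_le]
      push_cast
      norm_num
      constructor
      · rintro ⟨⟨h1, h2, h3⟩, h4⟩
        exact ⟨h1, by linarith, by linarith⟩
      · rintro ⟨h1, h2, h3⟩
        exact ⟨⟨h1, by linarith, by linarith⟩, by linarith⟩
    · refine measure_congr ?_
      filter_upwards [measure_eq_zero_iff_ae_notMem.1 (hμ (volume_sqDistReal_eq 1 1)),
        measure_eq_zero_iff_ae_notMem.1 (nr (1 / 2))] with z h0 h1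
      refine propext ?_
      change (_ ∧ _ ∧ _) ↔ (_ ∧ _ ∧ _) ∧ 1 / 2 < z.re
      have := hM z
      have hg := hG z
      simp only [fareyTriangle, Set.mem_ofPred_eq] at *
      constructor
      · rintro ⟨h2, h3, h4⟩
        have h6 := lt_of_le_of_ne h2 (Ne.symm h0)
        have h7 := lt_of_le_of_ne h3 (Ne.symm h1)
        exact ⟨⟨⟨by linarith, by linarith, by linarith⟩, by linarith, h6⟩, h7⟩
      · rintro ⟨⟨⟨h1, h2, h3⟩, h4, h5⟩, h6⟩
        exact ⟨h5.le, h6.le, h2⟩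

/-! ### Periodic chains of geodesics -/

/-- A bi-infinite minus continued fraction of period `ℓ`: the complete quotients `W k` and their
conjugates `W' k`, the digits `N k` and their partial sums `c k`; every `W k` is a root of an
integral quadratic form of discriminant `Δ`. -/
structure ReducedChain where
  N : ℤ → ℤ
  c : ℤ → ℤ
  W : ℤ → ℝ
  W' : ℤ → ℝ
  ℓ : ℕ
  Δ : ℤ
  ℓ_pos : 0 < ℓ
  c_zero : c 0 = 0
  c_succ : ∀ k, c (k + 1) = c k + N k
  W_eq : ∀ k, W k = N k - (W (k + 1))⁻¹
  W'_eq : ∀ k, W' k = N k - (W' (k + 1))⁻¹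
  one_lt_W : ∀ k, 1 < W k
  W'_pos : ∀ k, 0 < W' k
  W'_lt_one : ∀ k, W' k < 1
  W_add : ∀ k, W (k + ℓ) = W k
  W'_add : ∀ k, W' (k + ℓ) = W' k
  N_add : ∀ k, N (k + ℓ) = N k
  form : ∀ k, ∃ P Q R : ℤ, 0 < P ∧ Q ^ 2 - 4 * P * R = Δ ∧ P * (W k + W' k) = -Q ∧
    P * (W k * W' k) = R

namespace ReducedChain

variable (X : ReducedChain)

lemma W_lt_N (k : ℤ) : X.W k < X.N k := by
  have := inv_pos.2 (zero_lt_one.trans (X.one_lt_W (k + 1)))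
  linarith [X.W_eq k]

lemma N_sub_one_lt_W (k : ℤ) : X.N k - 1 < X.W k := by
  have := inv_lt_one_of_one_lt₀ (X.one_lt_W (k + 1))
  linarith [X.W_eq k]

lemma two_le_N (k : ℤ) : 2 ≤ X.N k := by
  have h1 := X.W_lt_N k
  have h2 := X.one_lt_W k
  have : (1 : ℝ) < X.N k := h2.trans h1
  have : 1 < X.N k := by exact_mod_cast this
  omega

lemma c_mono {j k : ℤ} (h : j ≤ k) : X.c j ≤ X.c k := by
  induction k, h using Int.leInduction with
  | base => rfl
  | succ k _ ih => rw [X.c_succ]; linarith [X.two_le_N k]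

lemma c_add_W_lt {j k : ℤ} (h : j < k) : X.c j + X.W j < X.c k := by
  have h1 := X.c_mono (Int.add_one_le_of_lt h)
  rw [X.c_succ] at h1
  have h2 : (X.c j + X.N j : ℝ) ≤ X.c k := by exact_mod_cast h1
  linarith [X.W_lt_N j]

lemma c_succ_real (k : ℤ) : (X.c (k + 1) : ℝ) = X.c k + X.N k := by
  rw [X.c_succ]; push_cast; rfl

lemma c_pred_real (k : ℤ) : (X.c k : ℝ) = X.c (k - 1) + X.N (k - 1) := by
  rw [← X.c_succ_real, sub_add_cancel]

lemma c_add (k : ℤ) : X.c (k + X.ℓ) = X.c k + X.c X.ℓ := by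
  induction k using Int.induction_on with
  | zero => simp [X.c_zero]
  | succ i ih =>
    rw [show (i : ℤ) + 1 + X.ℓ = i + X.ℓ + 1 by ring, X.c_succ, ih, X.c_succ, X.N_add]
    ring
  | pred i ih =>
    have h1 := X.c_succ (-(i : ℤ) - 1 + X.ℓ)
    have h2 := X.c_succ (-(i : ℤ) - 1)
    rw [show -(i : ℤ) - 1 + X.ℓ + 1 = -(i : ℤ) + X.ℓ by ring, ih, X.N_add] at h1
    rw [sub_add_cancel] at h2
    linarith

lemma c_add_mul (k q : ℤ) : X.c (k + q * X.ℓ) = X.c k + q * X.c X.ℓ := by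
  induction q using Int.induction_on with
  | zero => simp
  | succ i ih =>
    rw [show k + ((i : ℤ) + 1) * X.ℓ = k + i * X.ℓ + X.ℓ by ring, X.c_add, ih]
    ring
  | pred i ih =>
    have := X.c_add (k + (-(i : ℤ) - 1) * X.ℓ)
    rw [show k + (-(i : ℤ) - 1) * X.ℓ + X.ℓ = k + -(i : ℤ) * X.ℓ by ring, ih] at this
    linarith

/-! #### The group -/

/-- The involution with fixed point `c k + i`. -/
def involution (k : ℤ) : SL(2, ℤ) :=
  ModularGroup.T ^ X.c k * ModularGroup.S * (ModularGroup.T ^ X.c k)⁻¹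

/-- The group generated by a period of the chain. -/
def group : Subgroup SL(2, ℤ) :=
  Subgroup.closure (insert (ModularGroup.T ^ X.c X.ℓ)
    {g | ∃ k ∈ Finset.Icc 1 X.ℓ, g = X.involution k})

lemma T_zpow_mem_group : ModularGroup.T ^ X.c X.ℓ ∈ X.group :=
  Subgroup.subset_closure (Set.mem_insert _ _)

lemma involution_mem_group (k : ℤ) : X.involution k ∈ X.group := by
  have hℓ : (0 : ℤ) < X.ℓ := by exact_mod_cast X.ℓ_pos
  obtain ⟨r, hr⟩ : ∃ r : ℕ, ((k - 1) % X.ℓ) = r := Int.eq_ofNat_of_zero_le (Int.emod_nonneg _ hℓ.ne')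
  have hr2 : r < X.ℓ := by have := Int.emod_lt_of_pos (k - 1) hℓ; omega
  have hk : k = ((r + 1 : ℕ) : ℤ) + (k - 1) / X.ℓ * X.ℓ := by
    have := Int.emod_add_mul_ediv (k - 1) X.ℓ
    rw [hr] at this
    push_cast
    linarith
  have h0 : X.involution ((r + 1 : ℕ) : ℤ) ∈ X.group :=
    Subgroup.subset_closure (Set.mem_insert_of_mem _ ⟨r + 1, by simp; omega, rfl⟩)
  have h1 := X.group.zpow_mem X.T_zpow_mem_group ((k - 1) / X.ℓ)
  have : X.involution k = (ModularGroup.T ^ X.c X.ℓ) ^ ((k - 1) / X.ℓ) *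
      X.involution ((r + 1 : ℕ) : ℤ) * ((ModularGroup.T ^ X.c X.ℓ) ^ ((k - 1) / X.ℓ))⁻¹ := by
    unfold involution
    have e : X.c k = X.c ((r + 1 : ℕ) : ℤ) + (k - 1) / X.ℓ * X.c X.ℓ := by
      conv_lhs => rw [hk]
      exact X.c_add_mul _ _
    rw [e, zpow_add, ← zpow_mul, mul_comm (X.c X.ℓ)]
    group
  rw [this]
  exact X.group.mul_mem (X.group.mul_mem h1 h0) (X.group.inv_mem h1)

lemma involution_smul_involution_smul (k : ℤ) (z : ℍ) :
    X.involution k • X.involution k • z = z := by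
  rw [← mul_smul]
  have : X.involution k * X.involution k = -1 := by
    unfold involution
    have hS : ModularGroup.S * ModularGroup.S = -1 := by
      refine Subtype.ext ?_
      rw [Matrix.SpecialLinearGroup.coe_mul, ModularGroup.coe_S]
      ext i j
      fin_cases i <;> fin_cases j <;> simp
    calc _ = ModularGroup.T ^ X.c k * (ModularGroup.S * ModularGroup.S) *
        (ModularGroup.T ^ X.c k)⁻¹ := by group
      _ = -1 := by rw [hS]; simp
  rw [this]
  simp

/-- The action of `X.involution k` on the real line. -/
noncomputable def reflect (k : ℤ) (x : ℝ) : ℝ := X.c k - (x - X.c k)⁻¹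

lemma reflect_reflect (k : ℤ) (x : ℝ) : X.reflect k (X.reflect k x) = x := by
  unfold reflect
  simp

lemma geodesicForm_involution_pos {a b : ℝ} (k : ℤ) (h : 0 < (a - X.c k) * (b - X.c k)) (z : ℍ) :
    0 < geodesicForm a b (X.involution k • z) ↔
      0 < geodesicForm (X.reflect k a) (X.reflect k b) z := by
  have ha : a - X.c k ≠ 0 := left_ne_zero_of_mul h.ne'
  have hb : b - X.c k ≠ 0 := right_ne_zero_of_mul h.ne'
  unfold involution reflect
  rw [mul_smul, mul_smul, geodesicForm_T_zpow_smul, geodesicForm_S_smul ha hb, ← zpow_neg,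
    geodesicForm_T_zpow_smul, mul_pos_iff_of_pos_left (div_pos h (sqDistReal_pos _ _))]
  push_cast
  rw [sub_neg_eq_add, sub_neg_eq_add, neg_add_eq_sub, neg_add_eq_sub]

lemma reflect_W (k : ℤ) : X.reflect k (X.c k + X.W k) = X.c (k - 1) + X.W (k - 1) := by
  have := X.W_eq (k - 1)
  rw [sub_add_cancel] at this
  unfold reflect
  rw [this, X.c_pred_real k]
  ring

lemma reflect_W' (k : ℤ) : X.reflect k (X.c k + X.W' k) = X.c (k - 1) + X.W' (k - 1) := by
  have := X.W'_eq (k - 1)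
  rw [sub_add_cancel] at this
  unfold reflect
  rw [this, X.c_pred_real k]
  ring

/-! #### The orbit of the gap geodesics -/

/-- The geodesics obtained from the gap geodesics by reduced words in the involutions. -/
inductive OrbitGeodesic : ℝ → ℝ → Prop
  | gap (k : ℤ) : OrbitGeodesic (X.c k + X.W' k) (X.c k + X.W k)
  -- The bounds confine the image to the interval about `c k` between the gaps `k - 1` and `k`, as
  -- `c k - (W k)⁻¹ = c (k - 1) + W (k - 1)`. This is the ping-pong condition.
  | reflect (k : ℤ) (a b : ℝ) : OrbitGeodesic a b →
      X.c k - (X.W k)⁻¹ ≤ X.reflect k a → X.reflect k a < X.reflect k b →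
      X.reflect k b ≤ X.c k + X.W' k → OrbitGeodesic (X.reflect k a) (X.reflect k b)

variable {X}

lemma OrbitGeodesic.of_ge {a b : ℝ} (h : X.OrbitGeodesic a b) (hab : a < b) {j : ℤ}
    (hj : X.c j + X.W j ≤ a) :
    0 < (a - X.c j) * (b - X.c j) ∧ X.OrbitGeodesic (X.reflect j a) (X.reflect j b) := by
  have hW := X.one_lt_W j
  have ha : X.W j ≤ a - X.c j := by linarith
  have h0 : 0 < a - X.c j := by linarith
  have h1 : 0 < b - X.c j := by linarith
  refine ⟨mul_pos h0 h1, .reflect j a b h ?_ ?_ ?_⟩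
  · have := inv_anti₀ (by linarith) ha
    unfold ReducedChain.reflect
    linarith
  · have := (inv_lt_inv₀ h1 h0).2 (by linarith)
    unfold ReducedChain.reflect
    linarith
  · have := inv_pos.2 h1
    have := X.W'_pos j
    unfold ReducedChain.reflect
    linarith

lemma OrbitGeodesic.of_le {a b : ℝ} (h : X.OrbitGeodesic a b) (hab : a < b) {j : ℤ}
    (hj : b ≤ X.c (j - 1) + X.W' (j - 1)) :
    0 < (a - X.c j) * (b - X.c j) ∧ X.OrbitGeodesic (X.reflect j a) (X.reflect j b) := by
  have hW := X.W'_pos j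
  have hr := X.reflect_W' j
  unfold ReducedChain.reflect at hr
  rw [add_sub_cancel_left] at hr
  have hi := inv_pos.2 hW
  have hb : (X.W' j)⁻¹ ≤ X.c j - b := by linarith
  have h0 : 0 < X.c j - b := by linarith
  have h1 : 0 < X.c j - a := by linarith
  refine ⟨by nlinarith, .reflect j a b h ?_ ?_ ?_⟩
  · have := inv_pos.2 h1
    have := inv_pos.2 (zero_lt_one.trans (X.one_lt_W j))
    unfold ReducedChain.reflect
    rw [← neg_sub (X.c j : ℝ) a, inv_neg]
    linarith
  · have := (inv_lt_inv₀ h1 h0).2 (by linarith)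
    unfold ReducedChain.reflect
    rw [← neg_sub (X.c j : ℝ) a, ← neg_sub (X.c j : ℝ) b, inv_neg, inv_neg]
    linarith
  · have := inv_anti₀ hi hb
    rw [inv_inv] at this
    unfold ReducedChain.reflect
    rw [← neg_sub (X.c j : ℝ) b, inv_neg]
    linarith

/-- Ping-pong. The involution at `c j` permutes the gaps `j - 1` and `j`, sends everything beyond
them between them, and undoes itself on a geodesic it has just produced. Positivity of the product
means that the pole `c j` never lies between the ends, so the half-plane above is always carried to
a half-plane above. -/
lemma OrbitGeodesic.key {a b : ℝ} (h : X.OrbitGeodesic a b) :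
    a < b ∧ ∀ j, 0 < (a - X.c j) * (b - X.c j) ∧
      X.OrbitGeodesic (X.reflect j a) (X.reflect j b) := by
  induction h with
  | gap k =>
    have hab : X.c k + X.W' k < X.c k + X.W k := by linarith [X.W'_lt_one k, X.one_lt_W k]
    refine ⟨hab, fun j => ?_⟩
    have hW := X.one_lt_W k
    have hW' := X.W'_pos k
    rcases lt_trichotomy j k with hjk | rfl | hjk
    · exact (OrbitGeodesic.gap k).of_ge hab (by linarith [X.c_add_W_lt hjk])
    · refine ⟨?_, ?_⟩
      · rw [add_sub_cancel_left, add_sub_cancel_left]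
        exact mul_pos hW' (zero_lt_one.trans hW)
      · rw [X.reflect_W, X.reflect_W']
        exact .gap _
    · rcases (Int.add_one_le_of_lt hjk).eq_or_lt with rfl | hjk'
      · have e1 := X.reflect_W (k + 1)
        have e2 := X.reflect_W' (k + 1)
        rw [add_sub_cancel_right] at e1 e2
        refine ⟨?_, ?_⟩
        · have := X.W_lt_N k
          rw [X.c_succ_real]
          nlinarith
        · rw [← e1, ← e2, X.reflect_reflect, X.reflect_reflect]
          exact .gap _
      · refine (OrbitGeodesic.gap k).of_le hab ?_
        have := X.c_add_W_lt (show k < j - 1 by omega)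
        linarith [X.W'_pos (j - 1)]
  | reflect k a b h h1 h2 h3 ih =>
    refine ⟨h2, fun j => ?_⟩
    have hg := OrbitGeodesic.reflect k a b h h1 h2 h3
    rcases lt_trichotomy j k with hjk | rfl | hjk
    · refine hg.of_ge h2 (le_trans ?_ h1)
      have e := X.reflect_W k
      unfold ReducedChain.reflect at e
      rw [add_sub_cancel_left] at e
      rw [e]
      rcases (Int.le_sub_one_of_lt hjk).eq_or_lt with rfl | hjk'
      · rfl
      · linarith [X.c_add_W_lt hjk', X.one_lt_W (k - 1)]
    · refine ⟨?_, ?_⟩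
      · have e : ∀ x, X.reflect j x - X.c j = -(x - X.c j)⁻¹ := by
          intro x; unfold ReducedChain.reflect; ring
        rw [e, e, neg_mul_neg, ← mul_inv]
        exact inv_pos.2 (ih.2 j).1
      · rw [X.reflect_reflect, X.reflect_reflect]
        exact h
    · refine hg.of_le h2 (h3.trans ?_)
      rcases (Int.le_sub_one_of_lt hjk).eq_or_lt with hjk' | hjk'
      · rw [hjk']
      · linarith [X.c_add_W_lt hjk', X.one_lt_W k, X.W'_lt_one k, X.W'_pos (j - 1)]

lemma OrbitGeodesic.add_mul {a b : ℝ} (h : X.OrbitGeodesic a b) (s : ℤ)  :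
    X.OrbitGeodesic (a + s * X.c X.ℓ) (b + s * X.c X.ℓ) := by
  have hW : ∀ k q : ℤ, X.W (k + q * X.ℓ) = X.W k ∧ X.W' (k + q * X.ℓ) = X.W' k := by
    intro k q
    induction q using Int.induction_on with
    | zero => simp
    | succ i ih =>
      rw [show k + ((i : ℤ) + 1) * X.ℓ = k + i * X.ℓ + X.ℓ by ring, X.W_add, X.W'_add]
      exact ih
    | pred i ih =>
      rw [← X.W_add, ← X.W'_add,
        show k + (-(i : ℤ) - 1) * X.ℓ + X.ℓ = k + -(i : ℤ) * X.ℓ by ring]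
      exact ih
  have hc : ∀ k : ℤ, (X.c (k + s * X.ℓ) : ℝ) = X.c k + s * X.c X.ℓ := by
    intro k; rw [X.c_add_mul]; push_cast; rfl
  induction h with
  | gap k =>
    have := OrbitGeodesic.gap (X := X) (k + s * X.ℓ)
    rw [(hW k s).1, (hW k s).2, hc] at this
    convert this using 1 <;> ring
  | reflect k a b h h1 h2 h3 ih =>
    have hr : ∀ x, X.reflect (k + s * X.ℓ) (x + s * X.c X.ℓ) = X.reflect k x + s * X.c X.ℓ := by
      intro x
      unfold ReducedChain.reflect
      rw [hc, add_sub_add_right_eq_sub]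
      ring
    rw [← hr, ← hr]
    refine .reflect _ _ _ ih ?_ ?_ ?_
    · rw [hr, hc, (hW k s).1]; linarith
    · rw [hr, hr]; linarith
    · rw [hr, hc, (hW k s).2]; linarith

/-- Translations and inversions preserve the discriminant of the form with roots `a`, `b`. After
centring at `c k`, inversion turns (P, Q, R) into (R, -Q, P), and R > 0 because the centred roots
have the same sign. -/
lemma OrbitGeodesic.exists_form {a b : ℝ} (h : X.OrbitGeodesic a b) :
    ∃ P Q R : ℤ, 0 < P ∧ Q ^ 2 - 4 * P * R = X.Δ ∧ P * (a + b) = -Q ∧ P * (a * b) = R := by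
  have shift : ∀ (a b : ℝ) (n : ℤ),
      (∃ P Q R : ℤ, 0 < P ∧ Q ^ 2 - 4 * P * R = X.Δ ∧ P * (a + b) = -Q ∧ P * (a * b) = R) →
      ∃ P Q R : ℤ, 0 < P ∧ Q ^ 2 - 4 * P * R = X.Δ ∧ P * ((n + a) + (n + b)) = -Q ∧
        P * ((n + a) * (n + b)) = R := by
    rintro a b n ⟨P, Q, R, hP, hD, h1, h2⟩
    refine ⟨P, Q - 2 * P * n, R - Q * n + P * n ^ 2, hP, by rw [← hD]; ring, ?_, ?_⟩
    · push_cast; linear_combination h1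
    · push_cast; linear_combination h2 + n * h1
  induction h with
  | gap k =>
    obtain ⟨P, Q, R, hP, hD, h1, h2⟩ := X.form k
    exact shift _ _ _ ⟨P, Q, R, hP, hD, by rw [add_comm, h1], by rw [mul_comm (X.W' k), h2]⟩
  | reflect k a b h h1 h2 h3 ih =>
    have hpos := (h.key.2 k).1
    obtain ⟨P, Q, R, hP, hD, e1, e2⟩ := shift _ _ (-X.c k) ih
    push_cast at e1 e2
    rw [neg_add_eq_sub, neg_add_eq_sub] at e1 e2
    have hR : (0 : ℝ) < R := by rw [← e2]; have : (0 : ℝ) < P := by exact_mod_cast hP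
                                positivity
    have ha : a - X.c k ≠ 0 := left_ne_zero_of_mul hpos.ne'
    have hb : b - X.c k ≠ 0 := right_ne_zero_of_mul hpos.ne'
    refine shift (-(a - X.c k)⁻¹) (-(b - X.c k)⁻¹) (X.c k)
      ⟨R, -Q, P, by exact_mod_cast hR, by rw [← hD]; ring, ?_, ?_⟩
    · rw [← e2]
      push_cast
      rw [neg_neg]
      have : (Q : ℝ) = -(P * (a - X.c k + (b - X.c k))) := by rw [e1]; ring
      rw [this]
      field_simp
      ring
    · rw [← e2]
      field_simp

variable (X)

lemma exists_orbitGeodesic {g : SL(2, ℤ)} (hg : g ∈ X.group) :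
    ∃ a b, X.OrbitGeodesic a b ∧ ∀ z, 0 < geodesicForm (X.W' 0) (X.W 0) (g • z) ↔
      0 < geodesicForm a b z := by
  have hS : ∀ (g : SL(2, ℤ)) (k : ℤ), (∃ a b, X.OrbitGeodesic a b ∧
      ∀ z, 0 < geodesicForm (X.W' 0) (X.W 0) (g • z) ↔ 0 < geodesicForm a b z) →
      ∃ a b, X.OrbitGeodesic a b ∧ ∀ z, 0 < geodesicForm (X.W' 0) (X.W 0)
        (g • X.involution k • z) ↔ 0 < geodesicForm a b z := by
    rintro g k ⟨a, b, h1, h2⟩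
    refine ⟨_, _, (h1.key.2 k).2, fun z => ?_⟩
    rw [h2, X.geodesicForm_involution_pos k (h1.key.2 k).1]
  have hT : ∀ (g : SL(2, ℤ)) (s : ℤ), (∃ a b, X.OrbitGeodesic a b ∧
      ∀ z, 0 < geodesicForm (X.W' 0) (X.W 0) (g • z) ↔ 0 < geodesicForm a b z) →
      ∃ a b, X.OrbitGeodesic a b ∧ ∀ z, 0 < geodesicForm (X.W' 0) (X.W 0)
        (g • (ModularGroup.T ^ X.c X.ℓ) ^ s • z) ↔ 0 < geodesicForm a b z := by
    rintro g s ⟨a, b, h1, h2⟩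
    refine ⟨_, _, h1.add_mul (-s), fun z => ?_⟩
    rw [h2, ← zpow_mul, geodesicForm_T_zpow_smul]
    push_cast
    rw [neg_mul, ← sub_eq_add_neg, ← sub_eq_add_neg, mul_comm]
  unfold group at hg
  induction hg using Subgroup.closure_induction_right with
  | one =>
    refine ⟨_, _, .gap 0, fun z => ?_⟩
    rw [one_smul, X.c_zero]
    simp
  | mul_right g hg y hy ih =>
    simp only [mul_smul]
    rcases hy with rfl | ⟨k, -, rfl⟩
    · simpa using hT g 1 ih
    · exact hS g k ih
  | mul_inv_cancel g hg y hy ih =>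
    simp only [mul_smul]
    rcases hy with rfl | ⟨k, -, rfl⟩
    · simpa using hT g (-1) ih
    · have : ∀ z : ℍ, (X.involution k)⁻¹ • z = X.involution k • z := by
        intro z
        rw [inv_smul_eq_iff, X.involution_smul_involution_smul]
      simp only [this]
      exact hS g k ih

end ReducedChain

namespace ReducedChain

variable (X : ReducedChain)

/-! #### An invariant open convex set below the gap geodesics -/

/-- The intersection of the half-planes above the translates of the gap geodesics. -/
def convexCore : Set ℍ := {z | ∀ g ∈ X.group, 0 < geodesicForm (X.W' 0) (X.W 0) (g • z)}

lemma exists_form_geodesicForm {g : SL(2, ℤ)} (hg : g ∈ X.group) :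
    ∃ P Q : ℤ, 0 < P ∧ ∀ z, 0 < geodesicForm (X.W' 0) (X.W 0) (g • z) ↔
      X.Δ < (2 * P * z.re + Q) ^ 2 + (2 * P * z.im) ^ 2 := by
  obtain ⟨a, b, h1, h2⟩ := X.exists_orbitGeodesic hg
  obtain ⟨P, Q, R, hP, hD, e1, e2⟩ := h1.exists_form
  refine ⟨P, Q, hP, fun z => ?_⟩
  have hP' : (0 : ℝ) < P := by exact_mod_cast hP
  have hD' : (Q : ℝ) ^ 2 - 4 * P * R = X.Δ := by exact_mod_cast hD
  have : (2 * P * z.re + Q) ^ 2 + (2 * P * z.im) ^ 2 - X.Δ = 4 * P ^ 2 * geodesicForm a b z := by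
    unfold geodesicForm
    linear_combination hD' - 4 * P * e2 + 4 * P * z.re * e1
  rw [h2, ← sub_pos, iff_comm, ← sub_pos, sub_zero, this,
    mul_pos_iff_of_pos_left (by positivity)]

/-- An infinite intersection of open half-planes is open here by local finiteness: near `z`, a
failing inequality bounds P through the imaginary part and then Q through the real part, since all
forms share the discriminant Δ. `B` and `B'` are these bounds, so only finitely many half-planes
matter. -/
lemma isOpen_convexCore : IsOpen X.convexCore := by
  rw [isOpen_iff_mem_nhds]
  intro z hz
  have hy := z.im_pos
  obtain ⟨B, hB⟩ := exists_nat_gt (X.Δ / z.im ^ 2)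
  have hB0 : (0 : ℝ) ≤ B := Nat.cast_nonneg B
  obtain ⟨B', hB'⟩ := exists_nat_gt (2 * B * (|z.re| + 1) + X.Δ + 1)
  let F : ℤ → ℤ → Set ℍ := fun P Q => {w | X.Δ < (2 * P * w.re + Q) ^ 2 + (2 * P * w.im) ^ 2}
  have hF : ∀ P Q, IsOpen (F P Q) := fun P Q => by
    have h1 := UpperHalfPlane.continuous_re
    have h2 := UpperHalfPlane.continuous_im
    exact isOpen_lt (by fun_prop) (by fun_prop)
  let I : Set (ℤ × ℤ) := {x | x ∈ Set.Icc (-B : ℤ) B ×ˢ Set.Icc (-B' : ℤ) B' ∧ z ∈ F x.1 x.2}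
  have hI : I.Finite := ((Set.finite_Icc _ _).prod (Set.finite_Icc _ _)).subset fun x hx => hx.1
  have hO : IsOpen (⋂ x ∈ I, F x.1 x.2) := hI.isOpen_biInter fun x _ => hF _ _
  have hN : ∀ᶠ w : ℍ in nhds z, z.im / 2 < w.im ∧ |w.re| < |z.re| + 1 :=
    ((UpperHalfPlane.continuous_im.continuousAt (x := z)).eventually
      (lt_mem_nhds (half_lt_self hy))).and
      ((UpperHalfPlane.continuous_re.abs.continuousAt (x := z)).eventually
        (gt_mem_nhds (lt_add_one _)))
  filter_upwards [hO.mem_nhds (Set.mem_iInter₂.2 fun x hx => hx.2), hN] with w hw ⟨hw1, hw2⟩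
  intro g hg
  obtain ⟨P, Q, hP, hPQ⟩ := X.exists_form_geodesicForm hg
  rw [hPQ]
  have hP1 : (1 : ℝ) ≤ P := by exact_mod_cast hP
  by_cases hmem : (P, Q) ∈ Set.Icc (-B : ℤ) B ×ˢ Set.Icc (-B' : ℤ) B'
  · exact Set.mem_iInter₂.1 hw (P, Q) ⟨hmem, (hPQ z).1 (hz g hg)⟩
  by_contra! hle
  apply hmem
  have h1 : (2 * P * w.im) ^ 2 ≤ X.Δ := by nlinarith [sq_nonneg (2 * P * w.re + Q)]
  have h2 : (2 * P * w.re + Q) ^ 2 ≤ X.Δ := by nlinarith [sq_nonneg (2 * P * w.im)]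
  have hPB : (P : ℝ) ≤ B := by
    have h3 : P * z.im ≤ 2 * P * w.im := by nlinarith
    have h4 : (P * z.im) ^ 2 ≤ X.Δ := (pow_le_pow_left₀ (by positivity) h3 2).trans h1
    have h5 : (P : ℝ) ^ 2 ≤ X.Δ / z.im ^ 2 := by
      rw [le_div_iff₀ (by positivity), ← mul_pow]
      exact h4
    nlinarith
  have hQB : |(Q : ℝ)| ≤ B' := by
    have h0 : (0 : ℝ) ≤ X.Δ := (sq_nonneg _).trans h2
    have h3 : |2 * P * w.re + Q| ≤ X.Δ + 1 := by
      refine abs_le_of_sq_le_sq (h2.trans ?_) (by linarith)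
      nlinarith
    have h4 : |2 * P * w.re| ≤ 2 * B * (|z.re| + 1) := by
      rw [abs_mul, abs_of_pos (by positivity : (0 : ℝ) < 2 * P)]
      have := abs_nonneg w.re
      gcongr
    have h5 : |(Q : ℝ)| ≤ |2 * P * w.re + Q| + |2 * P * w.re| := by
      have := abs_sub (2 * P * w.re + Q) (2 * P * w.re)
      rwa [add_sub_cancel_left] at this
    linarith
  rw [abs_le] at hQB
  refine ⟨⟨?_, ?_⟩, ?_, ?_⟩
  · have : (0 : ℤ) ≤ B := Int.natCast_nonneg B
    simp only
    omega
  · exact_mod_cast hPB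
  · exact_mod_cast hQB.1
  · exact_mod_cast hQB.2

lemma convexCore_mem : X.convexCore ∈ invariantOpenConvex X.group := by
  refine ⟨?_, X.isOpen_convexCore, ?_, ?_⟩
  · refine ⟨⟨⟨0, |(X.Δ : ℝ)| + 1⟩, by positivity⟩, fun g hg => ?_⟩
    obtain ⟨P, Q, hP, hPQ⟩ := X.exists_form_geodesicForm hg
    rw [hPQ]
    have hP1 : (1 : ℝ) ≤ P := by exact_mod_cast hP
    change (X.Δ : ℝ) < (2 * P * 0 + Q) ^ 2 + (2 * P * (|(X.Δ : ℝ)| + 1)) ^ 2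
    have h1 := le_abs_self (X.Δ : ℝ)
    have h2 := abs_nonneg (X.Δ : ℝ)
    have h3 : |(X.Δ : ℝ)| + 1 ≤ 2 * P * (|(X.Δ : ℝ)| + 1) := by nlinarith
    nlinarith [sq_nonneg (2 * P * 0 + Q : ℝ)]
  · intro z hz w hw p hp g hg
    refine hyperbolicConvex_geodesicForm_pos _ _ (g • z) (hz g hg) (g • w) (hw g hg) (g • p) ?_
    have hd : ∀ x y : ℍ, dist (g • x) (g • y) = dist x y := fun x y =>
      dist_smul (Matrix.SpecialLinearGroup.map (algebraMap ℤ ℝ) g) x y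
    rw [hd, hd, hd, hp]
  · intro g hg z hz h hh
    rw [← mul_smul]
    exact hz _ (X.group.mul_mem hh hg)

/-- The involution at `c (k + 1)` exchanges the gaps `k` and `k + 1`, so all gap geodesics are
translates of the one at 0, and the single orbit in `convexCore` bounds every strip. -/
lemma exists_mem_group_geodesicForm (k : ℕ) : ∃ g ∈ X.group, ∀ z,
    0 < geodesicForm (X.W' 0) (X.W 0) (g • z) ↔
      0 < geodesicForm (X.c k + X.W' k) (X.c k + X.W k) z := by
  induction k with
  | zero => exact ⟨1, X.group.one_mem, fun z => by simp [X.c_zero]⟩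
  | succ k ih =>
    obtain ⟨g, hg, h⟩ := ih
    refine ⟨g * X.involution (k + 1), X.group.mul_mem hg (X.involution_mem_group _), fun z => ?_⟩
    have e1 := X.reflect_W (k + 1)
    have e2 := X.reflect_W' (k + 1)
    rw [add_sub_cancel_right] at e1 e2
    have hp := ((OrbitGeodesic.gap (X := X) k).key.2 (k + 1)).1
    rw [mul_smul, h, X.geodesicForm_involution_pos _ hp, ← e1, ← e2, X.reflect_reflect,
      X.reflect_reflect]
    push_cast
    rfl

lemma geodesicForm_pos_of_mem_nielsenRegion {z : ℍ} (hz : z ∈ nielsenRegion X.group) (k : ℕ) :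
    0 < geodesicForm (X.c k + X.W' k) (X.c k + X.W k) z := by
  obtain ⟨g, hg, h⟩ := X.exists_mem_group_geodesicForm k
  exact (h z).1 (hz _ X.convexCore_mem g hg)

end ReducedChain

/-! #### Matrices acting on real numbers -/

/-- The matrix `g` maps the vector `(x, 1)` to `l • (y, 1)`. -/
def SendsTo (g : SL(2, ℤ)) (x y l : ℝ) : Prop :=
  g 0 0 * x + g 0 1 = l * y ∧ g 1 0 * x + g 1 1 = l

lemma SendsTo.one (x : ℝ) : SendsTo 1 x x 1 := by simp [SendsTo]

lemma SendsTo.mul {g h : SL(2, ℤ)} {x y z l m : ℝ} (hg : SendsTo g y z l) (hh : SendsTo h x y m) :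
    SendsTo (g * h) x z (l * m) := by
  obtain ⟨a1, a2⟩ := hg
  obtain ⟨b1, b2⟩ := hh
  refine ⟨?_, ?_⟩
  · simp only [Matrix.SpecialLinearGroup.coe_mul, Matrix.mul_apply, Fin.sum_univ_two]
    push_cast
    linear_combination (g 0 0 : ℝ) * b1 + (g 0 1 : ℝ) * b2 + m * a1
  · simp only [Matrix.SpecialLinearGroup.coe_mul, Matrix.mul_apply, Fin.sum_univ_two]
    push_cast
    linear_combination (g 1 0 : ℝ) * b1 + (g 1 1 : ℝ) * b2 + m * a2

lemma SendsTo.inv {g : SL(2, ℤ)} {x y l : ℝ} (hg : SendsTo g x y l) (hl : l ≠ 0) :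
    SendsTo g⁻¹ y x l⁻¹ := by
  obtain ⟨a1, a2⟩ := hg
  have hd : (g 0 0 * g 1 1 - g 0 1 * g 1 0 : ℝ) = 1 := by
    have := g.det_coe
    rw [Matrix.det_fin_two] at this
    exact_mod_cast this
  have e1 : (g 1 1 * y - g 0 1) * l = x := by linear_combination -(g 1 1 : ℝ) * a1 + (g 0 1 : ℝ) * a2 + x * hd
  have e2 : (-g 1 0 * y + g 0 0) * l = 1 := by linear_combination (g 1 0 : ℝ) * a1 - (g 0 0 : ℝ) * a2 + hd
  rw [Matrix.SpecialLinearGroup.SL2_inv_expl]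
  refine ⟨?_, ?_⟩
  · simp
    field_simp
    linear_combination e1
  · simp
    field_simp
    linear_combination e2

lemma SendsTo.T_zpow (n : ℤ) (x : ℝ) : SendsTo (ModularGroup.T ^ n) x (x + n) 1 := by
  simp [SendsTo, ModularGroup.coe_T_zpow]

lemma SendsTo.S {x : ℝ} (hx : x ≠ 0) : SendsTo ModularGroup.S x (-x⁻¹) x := by
  simp [SendsTo, ModularGroup.S, hx]

lemma SendsTo.pow {g : SL(2, ℤ)} {x l : ℝ} (hg : SendsTo g x x l) (j : ℕ) :
    SendsTo (g ^ j) x x (l ^ j) := by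
  induction j with
  | zero => simpa using SendsTo.one x
  | succ j ih => rw [pow_succ, pow_succ]; exact ih.mul hg

/-- This computes the cusp g(∞) of a matrix from its two real fixed points and eigenvalues. -/
lemma SendsTo.div_eq {g : SL(2, ℤ)} {x x' l l' : ℝ} (h : SendsTo g x x l) (h' : SendsTo g x' x' l')
    (hx : x ≠ x') (hl : l ≠ l') :
    g 1 0 ≠ 0 ∧ (g 0 0 / g 1 0 : ℝ) = (l * x - l' * x') / (l - l') := by
  obtain ⟨a1, a2⟩ := h
  obtain ⟨b1, b2⟩ := h'
  have hx' := sub_ne_zero.2 hx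
  have hl' := sub_ne_zero.2 hl
  have e1 : (g 0 0 : ℝ) * (x - x') = l * x - l' * x' := by linear_combination a1 - b1
  have e2 : (g 1 0 : ℝ) * (x - x') = l - l' := by linear_combination a2 - b2
  have h0 : (g 1 0 : ℝ) ≠ 0 := by
    intro h0
    rw [h0, zero_mul] at e2
    exact hl' e2.symm
  refine ⟨by exact_mod_cast h0, ?_⟩
  rw [div_eq_div_iff h0 hl', ← e1, ← e2]
  ring

/-! #### Invariant convex sets contain everything above the gap geodesics -/

/-- Arcs joining far apart translates of `z₀` rise arbitrarily high above `z₀`, so `U` contains the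
vertical ray over `z₀` and its translates. Arcs between neighbouring rays fill everything high
enough. -/
lemma HyperbolicConvex.exists_horoball {U : Set ℍ} (hU : HyperbolicConvex U) {c : ℤ} (hc : 0 < c)
    (hT : ∀ s : ℤ, ∀ z ∈ U, ModularGroup.T ^ (c * s) • z ∈ U) {z₀ : ℍ} (hz₀ : z₀ ∈ U) :
    ∃ Y : ℝ, 0 < Y ∧ ∀ z : ℍ, Y < z.im → z ∈ U := by
  have hy₀ := z₀.im_pos
  have hc' : (1 : ℝ) ≤ c := by exact_mod_cast hc
  have hup : ∀ p : ℍ, p.re = z₀.re → z₀.im ≤ p.im → p ∈ U := by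
    intro p hp1 hp2
    obtain ⟨s, hs⟩ := exists_nat_gt p.im
    have hs0 : 0 < (s : ℝ) := p.im_pos.trans hs
    have hcs : (s : ℝ) ≤ c * s := by nlinarith
    have hpos : 0 < √((c * s) ^ 2 + z₀.im ^ 2) := by positivity
    have hsq := Real.sq_sqrt (by positivity : 0 ≤ (c * s : ℝ) ^ 2 + z₀.im ^ 2)
    let q : ℍ := ⟨⟨z₀.re, √((c * s) ^ 2 + z₀.im ^ 2)⟩, hpos⟩
    have hqi : q.im = √((c * s) ^ 2 + z₀.im ^ 2) := rfl
    have hqr : q.re = z₀.re := rfl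
    have hq : q ∈ U := by
      refine hU.mem_of_sqDistReal_eq z₀.re (hT (-s) z₀ hz₀) (hT s z₀ hz₀) ?_ ?_ ?_ ?_
      · unfold sqDistReal
        rw [ModularGroup.re_T_zpow_smul, ModularGroup.im_T_zpow_smul, hqr, hqi, hsq]
        push_cast
        ring
      · unfold sqDistReal
        rw [ModularGroup.re_T_zpow_smul, ModularGroup.im_T_zpow_smul, hqr, hqi, hsq]
        push_cast
        ring
      · rw [ModularGroup.re_T_zpow_smul, hqr]
        push_cast
        linarith
      · rw [ModularGroup.re_T_zpow_smul, hqr]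
        push_cast
        linarith
    refine hU.mem_of_re_eq hz₀ hq hp1.symm hp1 hp2 ?_
    rw [hqi]
    refine Real.le_sqrt_of_sq_le ?_
    nlinarith [p.im_pos]
  have hup' : ∀ (s : ℤ) (p : ℍ), p.re = z₀.re + c * s → z₀.im ≤ p.im → p ∈ U := by
    intro s p h1 h2
    have := hT s _ (hup (ModularGroup.T ^ (-(c * s)) • p) ?_ ?_)
    · rwa [← mul_smul, ← zpow_add, add_neg_cancel, zpow_zero, one_smul] at this
    · rw [ModularGroup.re_T_zpow_smul, h1]
      push_cast
      ring
    · rwa [ModularGroup.im_T_zpow_smul]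
  refine ⟨z₀.im + c, by positivity, fun p hp => ?_⟩
  set s : ℤ := ⌊(p.re - z₀.re) / c⌋ with hs
  have h1 : (s : ℝ) * c ≤ p.re - z₀.re := (le_div_iff₀ (by positivity)).1 (Int.floor_le _)
  have h2 : p.re - z₀.re < (s + 1) * c := (div_lt_iff₀ (by positivity)).1 (Int.lt_floor_add_one _)
  set m := z₀.re + c * s + c / 2 with hm
  have hpp : (z₀.im + c) ^ 2 < p.im ^ 2 := by
    have := p.im_pos
    gcongr
  have h3 : z₀.im ^ 2 ≤ sqDistReal m p - (c / 2) ^ 2 := by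
    unfold sqDistReal
    nlinarith [sq_nonneg (p.re - m)]
  have hle : z₀.im ≤ √(sqDistReal m p - (c / 2) ^ 2) := Real.le_sqrt_of_sq_le h3
  have hpos := hy₀.trans_le hle
  have hsq := Real.sq_sqrt ((sq_nonneg z₀.im).trans h3)
  set y := √(sqDistReal m p - (c / 2) ^ 2)
  refine hU.mem_of_sqDistReal_eq m
    (hup' s ⟨⟨z₀.re + c * s, y⟩, hpos⟩ rfl hle)
    (hup' (s + 1) ⟨⟨z₀.re + c * s + c, y⟩, hpos⟩ (by push_cast; change _ + _ = _; ring) hle)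
    ?_ ?_ ?_ ?_
  · change (z₀.re + c * s - m) ^ 2 + y ^ 2 = _
    rw [hsq, hm]
    ring
  · change _ = (z₀.re + c * s + c - m) ^ 2 + y ^ 2
    rw [hsq, hm]
    ring
  · change z₀.re + c * s ≤ _
    linarith
  · change _ ≤ z₀.re + c * s + c
    linarith

/-- The image of the horoball under `g` is a horoball at the cusp g(∞), so both ends of the vertical
geodesic over that cusp lie in `U`, and convexity supplies the rest. -/
lemma HyperbolicConvex.mem_of_re_eq_div {U : Set ℍ} (hU : HyperbolicConvex U) {Y : ℝ} (hY : 0 < Y)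
    (hh : ∀ z : ℍ, Y < z.im → z ∈ U) {g : SL(2, ℤ)} (hg : ∀ z ∈ U, g • z ∈ U) (hc : g 1 0 ≠ 0)
    {p : ℍ} (hp : p.re = (g 0 0 : ℝ) / g 1 0) : p ∈ U := by
  have hc' : (g 1 0 : ℝ) ≠ 0 := by exact_mod_cast hc
  have hlow : ∀ q : ℍ, q.re = p.re → q.im * ((g 1 0 : ℝ) ^ 2 * Y) < 1 → q ∈ U := by
    intro q hq hqy
    have hqi := q.im_pos
    have := hg _ (hh (g⁻¹ • q) ?_)
    · rwa [smul_inv_smul] at this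
    · rw [ModularGroup.im_smul_eq_div_normSq, lt_div_iff₀ (UpperHalfPlane.normSq_denom_pos _ q.im_ne_zero)]
      have e : Complex.normSq (UpperHalfPlane.denom (g⁻¹ : SL(2, ℤ)) q) =
          (g 1 0 : ℝ) ^ 2 * q.im ^ 2 := by
        rw [ModularGroup.denom_apply, Matrix.SpecialLinearGroup.SL2_inv_expl, Complex.normSq_apply]
        simp
        rw [hq, hp]
        field_simp
        ring
      rw [e]
      nlinarith
  have hpi := p.im_pos
  have hK : 0 < (g 1 0 : ℝ) ^ 2 * Y := by positivity
  set K := (g 1 0 : ℝ) ^ 2 * Y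
  have h1 : 0 < min p.im (1 / (2 * K)) := by positivity
  have h2 : 0 < max p.im (Y + 1) := by positivity
  refine hU.mem_of_re_eq (hlow ⟨⟨p.re, min p.im (1 / (2 * K))⟩, h1⟩ rfl ?_)
    (hh ⟨⟨p.re, max p.im (Y + 1)⟩, h2⟩ ?_) rfl rfl (min_le_left _ _) (le_max_left _ _)
  · calc min p.im (1 / (2 * K)) * K ≤ 1 / (2 * K) * K :=
          mul_le_mul_of_nonneg_right (min_le_right _ _) hK.le
      _ < 1 := by field_simp; norm_num
  · exact (lt_add_one Y).trans_le (le_max_right _ _)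

/-- The quotient is gʲ(∞) for a matrix with fixed points `x`, `x'` and eigenvalues `l`, `l'`. It
exceeds `x` by l'ʲ(x - x')/(lʲ - l'ʲ), which tends to 0. -/
lemma exists_sub_lt_of_one_lt {x x' l l' e : ℝ} (hx : x' < x) (h0 : 0 < l') (h1 : l' < l)
    (he : 0 < e) : ∃ j : ℕ, l' ^ j < l ^ j ∧
      x < (l ^ j * x - l' ^ j * x') / (l ^ j - l' ^ j) ∧
      (l ^ j * x - l' ^ j * x') / (l ^ j - l' ^ j) < x + e := by
  have hl : 0 < l := h0.trans h1
  have hr : l' / l < 1 := (div_lt_one hl).2 h1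
  have hr0 : 0 < l' / l := div_pos h0 hl
  obtain ⟨j, hj⟩ := exists_pow_lt_of_lt_one (show 0 < e / (x - x' + e) by
    have := sub_pos.2 hx; positivity) hr
  have hj0 : j ≠ 0 := by
    rintro rfl
    rw [pow_zero, lt_div_iff₀ (by linarith)] at hj
    linarith
  have hlt : l' ^ j < l ^ j := pow_lt_pow_left₀ h1 h0.le hj0
  have hd := sub_pos.2 hlt
  have hlj : 0 < l ^ j := by positivity
  have hlj' : 0 < l' ^ j := by positivity
  refine ⟨j, hlt, ?_, ?_⟩
  · rw [lt_div_iff₀ hd]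
    nlinarith
  · rw [div_lt_iff₀ hd]
    rw [div_pow, div_lt_div_iff₀ hlj (by linarith)] at hj
    nlinarith

/-! ### Hyperbolic elements fixing the gap geodesics. -/

namespace ReducedChain

variable (X : ReducedChain)

lemma sendsTo_involution (k : ℤ) {x : ℝ} (hx : x - X.c k ≠ 0) :
    SendsTo (X.involution k) x (X.reflect k x) (x - X.c k) := by
  have h1 := SendsTo.T_zpow (-X.c k) x
  push_cast at h1
  rw [← sub_eq_add_neg] at h1
  have h2 := (SendsTo.T_zpow (X.c k) (-(x - X.c k)⁻¹)).mul ((SendsTo.S hx).mul h1)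
  unfold involution
  rw [← zpow_neg, mul_assoc]
  unfold reflect
  convert h2 using 1 <;> ring

lemma exists_sendsTo (k : ℤ) (m : ℕ) : ∃ g ∈ X.group, ∃ l l' : ℝ,
    SendsTo g (X.c (k + m) + X.W (k + m)) (X.c k + X.W k) l ∧
    SendsTo g (X.c (k + m) + X.W' (k + m)) (X.c k + X.W' k) l' ∧
    0 < l' ∧ l' ≤ 1 ∧ 1 ≤ l ∧ (m ≠ 0 → l' < 1 ∧ 1 < l) := by
  induction m with
  | zero =>
    exact ⟨1, X.group.one_mem, 1, 1, by simpa using SendsTo.one _, by simpa using SendsTo.one _,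
      by simp⟩
  | succ m ih =>
    obtain ⟨g, hg, l, l', h1, h2, h3, h4, h5, -⟩ := ih
    have hW := X.one_lt_W (k + (m + 1 : ℕ))
    have hW1 := X.W'_pos (k + (m + 1 : ℕ))
    have hW2 := X.W'_lt_one (k + (m + 1 : ℕ))
    have e1 := X.reflect_W (k + (m + 1 : ℕ))
    have e2 := X.reflect_W' (k + (m + 1 : ℕ))
    have s1 := X.sendsTo_involution (k + (m + 1 : ℕ))
      (x := X.c (k + (m + 1 : ℕ)) + X.W (k + (m + 1 : ℕ))) (by rw [add_sub_cancel_left]; linarith)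
    have s2 := X.sendsTo_involution (k + (m + 1 : ℕ))
      (x := X.c (k + (m + 1 : ℕ)) + X.W' (k + (m + 1 : ℕ))) (by rw [add_sub_cancel_left]; linarith)
    rw [e1, add_sub_cancel_left, show k + ((m + 1 : ℕ) : ℤ) - 1 = k + m by push_cast; ring] at s1
    rw [e2, add_sub_cancel_left, show k + ((m + 1 : ℕ) : ℤ) - 1 = k + m by push_cast; ring] at s2
    have i1 : l' * X.W' (k + (m + 1 : ℕ)) < 1 := by nlinarith
    have i2 : 1 < l * X.W (k + (m + 1 : ℕ)) := by nlinarith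
    exact ⟨_, X.group.mul_mem hg (X.involution_mem_group _), _, _, h1.mul s1, h2.mul s2,
      mul_pos h3 hW1, i1.le, i2.le, fun _ => ⟨i1, i2⟩⟩

/-- Translate by a full period, then return through ℓ involutions. The eigenvalues are products of
the `W` and of the `W'` over a period, hence distinct. -/
lemma exists_sendsTo_self (k : ℤ) : ∃ g ∈ X.group, ∃ l l' : ℝ,
    SendsTo g (X.c k + X.W k) (X.c k + X.W k) l ∧
    SendsTo g (X.c k + X.W' k) (X.c k + X.W' k) l' ∧ 0 < l' ∧ l' < l := by
  obtain ⟨g, hg, l, l', h1, h2, h3, -, -, h4⟩ := X.exists_sendsTo k X.ℓ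
  obtain ⟨h4, h5⟩ := h4 X.ℓ_pos.ne'
  refine ⟨_, X.group.mul_mem hg X.T_zpow_mem_group, l * 1, l' * 1, h1.mul ?_, h2.mul ?_, ?_, ?_⟩
  · rw [X.W_add, X.c_add]
    convert SendsTo.T_zpow (X.c X.ℓ) _ using 1
    push_cast
    ring
  · rw [X.W'_add, X.c_add]
    convert SendsTo.T_zpow (X.c X.ℓ) _ using 1
    push_cast
    ring
  · linarith
  · linarith

lemma c_ℓ_pos : 0 < X.c X.ℓ := by
  have := X.c_add_W_lt (show (0 : ℤ) < X.ℓ by exact_mod_cast X.ℓ_pos)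
  rw [X.c_zero] at this
  have h2 := X.one_lt_W 0
  have : (0 : ℝ) < X.c X.ℓ := by push_cast at this; linarith
  exact_mod_cast this

/-- `U` contains the verticals over all `c j`, over cusps gʲ(∞) just right of the end α, and over
cusps g⁻ʲ(∞) just left of the end β. Left of β or right of α, a geodesic from the nearer centre `c
k` or `c (k + 1)` to such a cusp stays inside the excluded unit disc; between β and α, cusps close
to the ends suffice. -/
lemma mem_of_above {U : Set ℍ} (hU : U ∈ invariantOpenConvex X.group) (k : ℤ) {p : ℍ}
    (h1 : X.c k < p.re) (h2 : p.re < X.c (k + 1)) (h3 : 1 ≤ sqDistReal (X.c k) p)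
    (h4 : 1 ≤ sqDistReal (X.c (k + 1)) p)
    (h5 : 0 < geodesicForm (X.c k + X.W' k) (X.c k + X.W k) p)
    (h6 : p.re ≠ X.c k + X.W k) (h7 : p.re ≠ X.c k + X.W' k) : p ∈ U := by
  obtain ⟨⟨z₀, hz₀⟩, -, hconv, hinv⟩ := hU
  obtain ⟨Y, hY, hh⟩ := hconv.exists_horoball X.c_ℓ_pos (fun s z hz => by
    refine hinv _ ?_ z hz
    rw [zpow_mul]
    exact X.group.zpow_mem X.T_zpow_mem_group s) hz₀
  have hV : ∀ g ∈ X.group, g 1 0 ≠ 0 → ∀ p : ℍ, p.re = (g 0 0 : ℝ) / g 1 0 → p ∈ U :=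
    fun g hg hc p hp => hconv.mem_of_re_eq_div hY hh (hinv g hg) hc hp
  have hVc : ∀ j (p : ℍ), p.re = X.c j → p ∈ U := by
    intro j p hp
    have e : X.involution j 0 0 = X.c j ∧ X.involution j 1 0 = 1 := by
      unfold involution
      rw [← zpow_neg]
      rw [Matrix.SpecialLinearGroup.coe_mul, Matrix.SpecialLinearGroup.coe_mul,
        ModularGroup.coe_T_zpow, ModularGroup.coe_T_zpow, ModularGroup.coe_S]
      simp
    refine hV _ (X.involution_mem_group j) (by rw [e.2]; exact one_ne_zero) p ?_
    rw [e.1, e.2, hp]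
    simp
  obtain ⟨g, hg, l, l', s1, s2, hl', hl⟩ := X.exists_sendsTo_self k
  set α := X.c k + X.W k with hα
  set β := X.c k + X.W' k with hβ
  have hαβ : β < α := by linarith [X.one_lt_W k, X.W'_lt_one k]
  have hright : ∀ e : ℝ, 0 < e → ∃ a : ℝ, α < a ∧ a < α + e ∧ ∀ p : ℍ, p.re = a → p ∈ U := by
    intro e he
    obtain ⟨j, j1, j2, j3⟩ := exists_sub_lt_of_one_lt hαβ hl' hl he
    obtain ⟨d1, d2⟩ := (s1.pow j).div_eq (s2.pow j) hαβ.ne' j1.ne'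
    refine ⟨_, j2, j3, ?_⟩
    rw [← d2]
    exact hV _ (X.group.pow_mem hg j) d1
  have hleft : ∀ e : ℝ, 0 < e → ∃ a : ℝ, β - e < a ∧ a < β ∧ ∀ p : ℍ, p.re = a → p ∈ U := by
    intro e he
    have hl0 := hl'.trans hl
    obtain ⟨j, j1, j2, j3⟩ := exists_sub_lt_of_one_lt (neg_lt_neg hαβ) (inv_pos.2 hl0)
      ((inv_lt_inv₀ hl0 hl').2 hl) he
    obtain ⟨d1, d2⟩ := ((s2.inv hl'.ne').pow j).div_eq ((s1.inv hl0.ne').pow j) hαβ.ne j1.ne'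
    have e : (l'⁻¹ ^ j * -β - l⁻¹ ^ j * -α) / (l'⁻¹ ^ j - l⁻¹ ^ j) =
        -((l'⁻¹ ^ j * β - l⁻¹ ^ j * α) / (l'⁻¹ ^ j - l⁻¹ ^ j)) := by ring
    rw [e, ← d2] at j2 j3
    exact ⟨_, by linarith, by linarith, hV _ (X.group.pow_mem (X.group.inv_mem hg) j) d1⟩
  have hy := p.im_pos
  rcases lt_or_gt_of_ne h7 with hlt | hgt
  · obtain ⟨a, a1, a2, a3⟩ := hleft (β - p.re) (by linarith)
    refine hconv.mem_of_vertical (hVc k) a3 h1.le (by linarith) ?_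
    have hW' := X.W'_lt_one k
    unfold sqDistReal at h3
    unfold geodesicForm
    nlinarith
  · rcases lt_or_gt_of_ne h6 with hlt' | hgt'
    · set t := geodesicForm β α p with ht
      have hd : 0 < α - β + 1 := by linarith
      -- Moving both ends outwards by less than e ≤ 1 lowers the form at `p` by at most e(α - β) +
      -- e, which this choice keeps below its value t.
      have he0 : 0 < min 1 (t / (2 * (α - β + 1))) := by positivity
      have he1 : min 1 (t / (2 * (α - β + 1))) * (α - β + 1) < t := by
        calc _ ≤ t / (2 * (α - β + 1)) * (α - β + 1) :=
              mul_le_mul_of_nonneg_right (min_le_right _ _) hd.le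
          _ < t := by field_simp; linarith
      have he2 : min 1 (t / (2 * (α - β + 1))) ≤ 1 := min_le_left _ _
      set e := min 1 (t / (2 * (α - β + 1)))
      obtain ⟨a, a1, a2, a3⟩ := hright e he0
      obtain ⟨b, b1, b2, b3⟩ := hleft e he0
      refine hconv.mem_of_vertical b3 a3 (by linarith) (by linarith) ?_
      have i1 : (a - α) * (p.re - β) ≤ e * (p.re - β) := by
        apply mul_le_mul_of_nonneg_right <;> linarith
      have i2 : (β - b) * (α - p.re) ≤ e * (α - p.re) := by
        apply mul_le_mul_of_nonneg_right <;> linarith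
      have i3 : (a - α) * (β - b) ≤ e * 1 := by
        apply mul_le_mul <;> linarith
      have : geodesicForm b a p = t - (a - α) * (p.re - β) - (β - b) * (α - p.re) -
          (a - α) * (β - b) := by
        rw [ht]; unfold geodesicForm; ring
      rw [this]
      linarith
    · obtain ⟨a, a1, a2, a3⟩ := hright (p.re - α) (by linarith)
      refine hconv.mem_of_vertical a3 (hVc (k + 1)) (by linarith) h2.le ?_
      have hW := X.N_sub_one_lt_W k
      have hc := X.c_succ_real k
      unfold sqDistReal at h4
      unfold geodesicForm
      nlinarith

end ReducedChain

/-! ### Cutting the orbifold domain into pieces of Farey triangles -/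

open MeasureTheory in
lemma measure_strips {μ : Measure ℍ} (hμ : μ ≪ volume) (c : ℕ → ℤ) (hc : Monotone c) (s : Set ℍ)
    (m : ℕ) : μ (s ∩ {z | (c 0 : ℝ) < z.re ∧ z.re < c m}) =
      ∑ k ∈ Finset.range m, μ (s ∩ {z | (c k : ℝ) < z.re ∧ z.re < c (k + 1)}) := by
  induction m with
  | zero =>
    rw [Finset.sum_range_zero]
    convert measure_empty (μ := μ) using 2
    ext z
    simp only [Set.mem_inter_iff, Set.mem_ofPred_eq, Set.mem_empty_iff_false, iff_false]
    rintro ⟨-, h1, h2⟩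
    exact lt_asymm h1 h2
  | succ m ih =>
    have h0 : (c 0 : ℝ) ≤ c m := by exact_mod_cast hc (Nat.zero_le m)
    have h1 : (c m : ℝ) ≤ c (m + 1) := by exact_mod_cast hc (Nat.le_succ m)
    rw [Finset.sum_range_succ, ← ih, measure_eq_add_of_null UpperHalfPlane.continuous_re (c m)
      (hμ (volume_re_eq _))]
    congr 2
    · ext z
      simp only [Set.mem_inter_iff, Set.mem_ofPred_eq, and_assoc]
      exact and_congr_right fun _ => ⟨fun h => ⟨h.1, h.2.2⟩, fun h => ⟨h.1, by linarith, h.2⟩⟩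
    · ext z
      simp only [Set.mem_inter_iff, Set.mem_ofPred_eq, and_assoc]
      exact and_congr_right fun _ => ⟨fun h => ⟨h.2.2, h.2.1⟩, fun h => ⟨by linarith, h.2, h.1⟩⟩

/-- The part of the strip `0 < Re z < n` outside the unit discs around `0` and `n` and above the
geodesic from `w'` to `w`. -/
def gapCell (n : ℤ) (w' w : ℝ) : Set ℍ :=
  {z | 0 < z.re ∧ z.re < n ∧ 1 < sqDistReal 0 z ∧ 1 < sqDistReal n z ∧ 0 < geodesicForm w' w z}

/-- Only the first and the last strip meet the two unit discs. In a middle strip the ends of the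
translated geodesic satisfy w' - j < 0 and 1 < w - j, so lying above it already forces lying above
the side from 0 to 1. -/
lemma T_zpow_smul_mem_gapCell {n : ℤ} (hn : 2 ≤ n) {w' w : ℝ} (h0 : 0 < w') (h1 : w' < 1)
    (h2 : n - 1 < w) (j : ℤ) (hj0 : 0 ≤ j) (hjn : j < n) (z : ℍ) :
    (0 < z.re ∧ z.re < 1 ∧ ModularGroup.T ^ j • z ∈ gapCell n w' w) ↔
      z ∈ fareyTriangle ∧ (j = 0 → 1 < sqDistReal 0 z) ∧ (j = n - 1 → 1 < sqDistReal 1 z) ∧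
        0 < geodesicForm (w' - j) (w - j) z := by
  have hy : 0 < z.im ^ 2 := by have := z.im_pos; positivity
  have hn' : (2 : ℝ) ≤ n := by exact_mod_cast hn
  simp only [gapCell, fareyTriangle, Set.mem_ofPred_eq, ModularGroup.re_T_zpow_smul,
    sqDistReal_T_zpow_smul, geodesicForm_T_zpow_smul]
  have hj0' : (0 : ℝ) ≤ j := by exact_mod_cast hj0
  have hjn' : (j : ℝ) ≤ n - 1 := by
    have : j ≤ n - 1 := by omega
    exact_mod_cast this
  constructor
  · rintro ⟨hx0, hx1, -, -, hs0, hsn, hg⟩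
    have c0 : j = 0 → 1 < sqDistReal 0 z := by rintro rfl; simpa using hs0
    have c1 : j = n - 1 → 1 < sqDistReal 1 z := by
      rintro rfl
      push_cast at hsn
      rwa [sub_sub_cancel] at hsn
    refine ⟨⟨hx0, hx1, ?_⟩, c0, c1, hg⟩
    by_cases hj : j = 0
    · have := c0 hj
      unfold sqDistReal at this
      unfold geodesicForm
      nlinarith
    by_cases hj' : j = n - 1
    · have := c1 hj'
      unfold sqDistReal at this
      unfold geodesicForm
      nlinarith
    have hj1 : (1 : ℝ) ≤ j := by
      have : 1 ≤ j := by omega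
      exact_mod_cast this
    have hj2 : (j : ℝ) ≤ n - 2 := by
      have : j ≤ n - 2 := by omega
      exact_mod_cast this
    have a1 : 1 < w - j := by linarith
    have a2 : w' - j < 0 := by linarith
    have k1 : 0 < (1 - z.re) * (-(w' - j) * (w - j)) := by
      apply mul_pos (by linarith); apply mul_pos <;> linarith
    have k2 : 0 < z.re * ((w - j - 1) * (1 - (w' - j))) := by
      apply mul_pos (by linarith); apply mul_pos <;> linarith
    have : geodesicForm 0 1 z = geodesicForm (w' - j) (w - j) z +
        (1 - z.re) * (-(w' - j) * (w - j)) + z.re * ((w - j - 1) * (1 - (w' - j))) := by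
      unfold geodesicForm; ring
    linarith
  · rintro ⟨⟨hx0, hx1, -⟩, c0, c1, hg⟩
    refine ⟨hx0, hx1, by linarith, by linarith, ?_, ?_, hg⟩
    · by_cases hj : j = 0
      · have := c0 hj
        subst hj
        simpa using this
      · have hj1 : (1 : ℝ) ≤ j := by
          have : 1 ≤ j := by omega
          exact_mod_cast this
        unfold sqDistReal
        nlinarith
    · by_cases hj : j = n - 1
      · have := c1 hj
        subst hj
        push_cast
        rwa [sub_sub_cancel]
      · have hj2 : (j : ℝ) ≤ n - 2 := by
          have : j ≤ n - 2 := by omega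
          exact_mod_cast this
        unfold sqDistReal
        nlinarith

open MeasureTheory in
lemma measure_gapCell {μ : Measure ℍ} [SMulInvariantMeasure SL(2, ℤ) ℍ μ] (hμ : μ ≪ volume)
    {n : ℤ} (hn : 2 ≤ n) {w' w : ℝ} (h0 : 0 < w') (h1 : w' < 1) (h2 : n - 1 < w) :
    μ (gapCell n w' w) = μ (fareyTriangle ∩ {z | 1 < sqDistReal 0 z} ∩
        {z | 0 < geodesicForm w' w z}) +
      μ (fareyTriangle ∩ {z | 1 < sqDistReal 1 z} ∩
        {z | 0 < geodesicForm (w' - (n - 1)) (w - (n - 1)) z}) +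
      ∑ j ∈ Finset.Ioo 0 (n - 1), μ (fareyTriangle ∩ {z | 0 < geodesicForm (w' - j) (w - j) z}) := by
  -- As n ≥ 2, the first and the last strip are different and can be split off separately.
  obtain ⟨m, rfl⟩ : ∃ m : ℕ, n = m + 2 := ⟨(n - 2).toNat, by omega⟩
  have hstrip := measure_strips hμ (fun k : ℕ => (k : ℤ)) (fun a b h => Int.ofNat_le.2 h)
    (gapCell (m + 2) w' w) (m + 2)
  have e1 : gapCell (m + 2) w' w ∩ {z | ((0 : ℕ) : ℤ) < z.re ∧ z.re < ((m + 2 : ℕ) : ℤ)} =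
      gapCell (m + 2) w' w := by
    refine Set.inter_eq_left.2 fun z hz => ⟨by simpa using hz.1, ?_⟩
    have := hz.2.1
    push_cast at this ⊢
    exact this
  rw [e1] at hstrip
  have e2 : ∀ k : ℕ, k < m + 2 →
      μ (gapCell (m + 2) w' w ∩ {z | ((k : ℕ) : ℤ) < z.re ∧ z.re < ((k + 1 : ℕ) : ℤ)}) =
      μ {z | z ∈ fareyTriangle ∧ ((k : ℤ) = 0 → 1 < sqDistReal 0 z) ∧
        ((k : ℤ) = m + 2 - 1 → 1 < sqDistReal 1 z) ∧
        0 < geodesicForm (w' - (k : ℤ)) (w - (k : ℤ)) z} := by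
    intro k hk
    refine measure_eq_of_smul_mem_iff (ModularGroup.T ^ (k : ℤ)) fun z => ?_
    refine Iff.trans ?_ (T_zpow_smul_mem_gapCell hn h0 h1 h2 k (by omega) (by omega) z)
    simp only [Set.mem_inter_iff, Set.mem_ofPred_eq, ModularGroup.re_T_zpow_smul]
    push_cast
    constructor
    · rintro ⟨h, a, b⟩
      exact ⟨by linarith, by linarith, h⟩
    · rintro ⟨a, b, h⟩
      exact ⟨h, by linarith, by linarith⟩
  rw [hstrip, Finset.sum_congr rfl fun k hk => e2 k (Finset.mem_range.1 hk),
    Finset.sum_range_succ, Finset.sum_range_succ', add_comm, ← add_assoc, add_comm _ (μ _),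
    ← add_assoc]
  congr 1
  · congr 2
    · ext z
      simp only [Set.mem_inter_iff, Set.mem_ofPred_eq, and_assoc]
      have : ¬ ((0 : ℤ) = m + 2 - 1) := by omega
      simp [this]
    · ext z
      simp only [Set.mem_inter_iff, Set.mem_ofPred_eq, and_assoc]
      have h1 : ¬ ((m : ℤ) + 2 - 1 = 0) := by omega
      have h2 : (((m + 1 : ℕ) : ℤ)) = m + 2 - 1 := by push_cast; ring
      have h3 : (((m + 1 : ℕ) : ℤ) : ℝ) = ((m + 2 : ℤ) : ℝ) - 1 := by push_cast; ring
      rw [h3]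
      simp only [h2, h1]
      simp
  · refine Finset.sum_bij (fun k _ => ((k : ℤ) + 1)) ?_ ?_ ?_ ?_
    · intro k hk
      simp at hk ⊢
      omega
    · intro a _ b _ h
      simpa using h
    · intro b hb
      simp at hb
      exact ⟨(b - 1).toNat, by simp; omega, by omega⟩
    · intro k hk
      rw [Finset.mem_range] at hk
      congr 1
      ext z
      simp only [Set.mem_inter_iff, Set.mem_ofPred_eq]
      have h1 : ¬ (((k + 1 : ℕ) : ℤ) = 0) := by omega
      have h2 : ¬ (((k + 1 : ℕ) : ℤ)) = m + 2 - 1 := by push_cast; omega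
      simp only [h1, h2]
      simp

namespace ReducedChain

variable (X : ReducedChain)

/-- The polygon of a period of the chain. -/
def polygon : Set ℍ :=
  {z | 0 ≤ z.re ∧ z.re ≤ X.c X.ℓ ∧ ∀ k : ℕ, k ≤ X.ℓ → 1 ≤ ‖(z : ℂ) - (X.c k : ℂ)‖}

-- The two inclusions for the Nielsen region meet here. The verticals over the gap ends and the unit
-- circles themselves, where `mem_of_above` or the strict inequalities fail, are discarded as null
-- sets.
open MeasureTheory in
lemma measure_polygon_inter_nielsenRegion {μ : Measure ℍ} [SMulInvariantMeasure SL(2, ℤ) ℍ μ]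
    (hμ : μ ≪ volume) : μ (X.polygon ∩ nielsenRegion X.group) =
      ∑ k ∈ Finset.range X.ℓ, μ (gapCell (X.N k) (X.W' k) (X.W k)) := by
  have hmono : Monotone fun k : ℕ => X.c k := fun a b h => X.c_mono (by exact_mod_cast h)
  have e0 : μ (X.polygon ∩ nielsenRegion X.group) = μ (X.polygon ∩ nielsenRegion X.group ∩
      {z | (X.c (0 : ℕ) : ℝ) < z.re ∧ z.re < X.c (X.ℓ : ℕ)}) := by
    refine measure_congr ?_
    filter_upwards [measure_eq_zero_iff_ae_notMem.1 (hμ (volume_re_eq 0)),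
      measure_eq_zero_iff_ae_notMem.1 (hμ (volume_re_eq (X.c X.ℓ)))] with z h0 h1
    refine propext ⟨fun h => ⟨h, ?_, ?_⟩, fun h => h.1⟩
    · rw [Nat.cast_zero, X.c_zero, Int.cast_zero]
      exact lt_of_le_of_ne h.1.1 (Ne.symm h0)
    · exact lt_of_le_of_ne h.1.2.1 h1
  rw [e0, measure_strips hμ (fun k : ℕ => X.c k) hmono]
  refine Finset.sum_congr rfl fun k hk => ?_
  rw [Finset.mem_range] at hk
  have e1 : μ (gapCell (X.N k) (X.W' k) (X.W k)) =
      μ {z | ModularGroup.T ^ (-X.c k) • z ∈ gapCell (X.N k) (X.W' k) (X.W k)} :=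
    measure_eq_of_smul_mem_iff _ fun z => Iff.rfl
  rw [e1]
  refine measure_congr ?_
  filter_upwards [measure_eq_zero_iff_ae_notMem.1 (hμ (volume_re_eq (X.c k + X.W k))),
    measure_eq_zero_iff_ae_notMem.1 (hμ (volume_re_eq (X.c k + X.W' k))),
    measure_eq_zero_iff_ae_notMem.1 (hμ (volume_sqDistReal_eq (X.c k) 1)),
    measure_eq_zero_iff_ae_notMem.1 (hμ (volume_sqDistReal_eq (X.c (k + 1)) 1))] with z h1 h2 h3 h4
  refine propext ?_
  have hcs := X.c_succ_real k
  change ((z ∈ X.polygon ∧ z ∈ nielsenRegion X.group) ∧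
    ((X.c (k : ℕ) : ℝ) < z.re ∧ z.re < X.c ((k + 1 : ℕ) : ℤ))) ↔
    ModularGroup.T ^ (-X.c k) • z ∈ gapCell (X.N k) (X.W' k) (X.W k)
  simp only [gapCell, Set.mem_ofPred_eq, ModularGroup.re_T_zpow_smul,
    sqDistReal_T_zpow_smul, geodesicForm_T_zpow_smul, polygon, one_le_norm_sub_intCast_iff] at *
  push_cast
  rw [zero_sub, neg_neg, sub_neg_eq_add, sub_neg_eq_add, sub_neg_eq_add, add_comm (X.N k : ℝ),
    ← hcs, add_comm (X.W' k), add_comm (X.W k)]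
  constructor
  · rintro ⟨⟨⟨-, -, hc⟩, hn⟩, a, b⟩
    have c1 := hc k hk.le
    have c2 := hc (k + 1) hk
    push_cast at c2
    exact ⟨by linarith, by linarith, lt_of_le_of_ne c1 (Ne.symm h3), lt_of_le_of_ne c2 (Ne.symm h4),
      X.geodesicForm_pos_of_mem_nielsenRegion hn k⟩
  · rintro ⟨a, b, c1, c2, hg⟩
    have a' : (X.c k : ℝ) < z.re := by linarith
    have b' : z.re < X.c (k + 1) := by linarith
    refine ⟨⟨⟨?_, ?_, ?_⟩, ?_⟩, a', b'⟩
    · have := X.c_mono (show (0 : ℤ) ≤ k by omega)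
      rw [X.c_zero] at this
      have : (0 : ℝ) ≤ X.c k := by exact_mod_cast this
      linarith
    · have := X.c_mono (show (k + 1 : ℤ) ≤ X.ℓ by omega)
      have : (X.c (k + 1) : ℝ) ≤ X.c X.ℓ := by exact_mod_cast this
      linarith
    · intro j hj
      have hy := sq_nonneg z.im
      rcases lt_trichotomy j k with hjk | rfl | hjk
      · have h5 := X.c_add_W_lt (show (j : ℤ) < k by omega)
        have := X.one_lt_W j
        unfold sqDistReal
        nlinarith
      · exact c1.le
      · rcases (Nat.succ_le_of_lt hjk).eq_or_lt with rfl | hjk'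
        · push_cast
          exact c2.le
        · have h5 := X.c_add_W_lt (show (k + 1 : ℤ) < j by omega)
          have := X.one_lt_W (k + 1)
          unfold sqDistReal
          nlinarith
    · exact fun U hU => X.mem_of_above hU k a' b' c1.le c2.le hg h1 h2

end ReducedChain

/-! ### Real quadratic fields -/

/-- A real quadratic field `ℚ(δ)`, `δ = √D`, with a real embedding and its conjugation. -/
structure RealQuadratic (E : Type*) [Field E] [NumberField E] where
  ι : E →+* ℝ
  σ : E →+* E
  δ : E
  D : ℤ
  δ_sq : δ ^ 2 = D
  δ_pos : 0 < ι δ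
  σ_δ : σ δ = -δ
  exists_eq : ∀ x : E, ∃ a b : ℚ, x = a + b * δ
  finrank_eq : Module.finrank ℚ E = 2

lemma IsFundamentalDiscriminant.not_isSquare {D : ℤ} (hD : IsFundamentalDiscriminant D)
    (h1 : 1 < D) : ¬ IsSquare D := by
  rintro ⟨k, rfl⟩
  have aux : ∀ m j : ℤ, Squarefree m → m = j * j → m = 1 := by
    intro m j hm hj
    have := Int.isUnit_iff.1 (hm j ⟨1, by rw [hj, mul_one]⟩)
    rcases this with rfl | rfl <;> simpa using hj
  rcases hD with ⟨-, h⟩ | ⟨m, hm, h4, h⟩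
  · exact h1.ne' (aux _ k h rfl)
  · have h2 : (2 : ℤ) ∣ k := by
      have : (2 : ℤ) ∣ k * k := ⟨2 * m, by rw [hm]; ring⟩
      exact (Int.prime_two.dvd_mul.1 this).elim id id
    obtain ⟨j, rfl⟩ := h2
    have := aux m j h (by linarith)
    omega

/-- Fundamentality of D enters only through D not being a square. Then 1, δ is a basis, and the
nontrivial Galois automorphism must negate δ. -/
lemma exists_realQuadratic {D : ℤ} (hD1 : 1 < D) (hD : IsFundamentalDiscriminant D)
    {E : Type*} [Field E] [NumberField E] (hE : Module.finrank ℚ E = 2)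
    (ι : E →+* ℝ) (δ : E) (hδ : ι δ = Real.sqrt D) :
    ∃ K : RealQuadratic E, K.ι = ι ∧ K.δ = δ := by
  have hD0 : (0 : ℝ) < D := by exact_mod_cast (zero_lt_one.trans hD1)
  have hsq : δ ^ 2 = D := by
    apply ι.injective
    rw [map_pow, hδ, map_intCast, Real.sq_sqrt hD0.le]
  have hirr : Irrational (Real.sqrt D) :=
    irrational_sqrt_intCast_iff.2 ⟨hD.not_isSquare hD1, by omega⟩
  have hli : LinearIndependent ℚ ![1, δ] := by
    rw [LinearIndependent.pair_iff]
    intro a b hab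
    have hb : b = 0 := by
      by_contra hb
      refine hirr ⟨-a / b, ?_⟩
      have := congrArg ι hab
      simp only [Rat.smul_def, mul_one, map_add, map_mul, map_ratCast, hδ, map_zero] at this
      have hb' : (b : ℝ) ≠ 0 := by exact_mod_cast hb
      push_cast
      field_simp
      linarith
    subst hb
    simpa using hab
  let b := basisOfLinearIndependentOfCardEqFinrank hli (by simp [hE])
  have hex : ∀ x : E, ∃ p q : ℚ, x = p + q * δ := by
    intro x
    have := b.sum_repr x
    rw [Fin.sum_univ_two] at this
    refine ⟨b.repr x 0, b.repr x 1, ?_⟩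
    simpa [b, Rat.smul_def] using this.symm
  have : Algebra.IsQuadraticExtension ℚ E := ⟨hE⟩
  have hcard : Nat.card Gal(E/ℚ) = 2 := by rw [IsGalois.card_aut_eq_finrank, hE]
  obtain ⟨σ, hσ⟩ : ∃ σ : Gal(E/ℚ), σ ≠ 1 := by
    by_contra! h
    have : Subsingleton Gal(E/ℚ) := ⟨fun a b => (h a).trans (h b).symm⟩
    have := Nat.card_of_subsingleton (1 : Gal(E/ℚ))
    omega
  have hσδ : σ δ = -δ := by
    have h1 : (σ δ) ^ 2 = δ ^ 2 := by rw [← map_pow, hsq, map_intCast]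
    refine (sq_eq_sq_iff_eq_or_eq_neg.1 h1).resolve_left fun h2 => hσ (AlgEquiv.ext fun x => ?_)
    obtain ⟨p, q, rfl⟩ := hex x
    simp [h2]
  exact ⟨⟨ι, σ, δ, D, hsq, by rw [hδ]; exact Real.sqrt_pos.2 hD0, hσδ, hex, hE⟩, rfl, rfl⟩

/-- The lattice `ℤ x + ℤ` is a fractional ideal in the narrow class `A`. -/
def LatticeClass {E : Type*} [Field E] [NumberField E] (A : NarrowClassGroup E) (x : E) : Prop :=
  ∃ I : (FractionalIdeal (𝓞 E)⁰ E)ˣ,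
    (∀ y : E, y ∈ (I : FractionalIdeal (𝓞 E)⁰ E) ↔ ∃ m n : ℤ, y = m * x + n) ∧ narrowClass I = A

/-! ### Narrow classes of the lattices ℤx + ℤ. -/

section Narrow

variable {E : Type*} [Field E] [NumberField E]

lemma narrowClass_one_mul (A : NarrowClassGroup E) : narrowClass 1 * A = A := one_mul A

lemma narrowClassOfElement_eq_one {x : Eˣ} (hx : ∀ φ : E →+* ℝ, 0 < φ x) :
    narrowClassOfElement x = narrowClass 1 :=
  (QuotientGroup.eq_one_iff _).2 ⟨x, hx, rfl⟩

lemma narrowClassOfElement_mul (x y : Eˣ) :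
    narrowClassOfElement (x * y) = narrowClassOfElement x * narrowClassOfElement y := by
  unfold narrowClassOfElement narrowClass
  rw [map_mul]
  rfl

lemma narrowClassOfElement_neg (x : Eˣ) :
    narrowClassOfElement (-x) = narrowClassOfElement x := by
  unfold narrowClassOfElement
  congr 1
  ext1
  rw [coe_toPrincipalIdeal, coe_toPrincipalIdeal]
  refine le_antisymm ?_ ?_
  · rw [FractionalIdeal.spanSingleton_le_iff_mem, FractionalIdeal.mem_spanSingleton]
    exact ⟨-1, by simp⟩
  · rw [FractionalIdeal.spanSingleton_le_iff_mem, FractionalIdeal.mem_spanSingleton]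
    exact ⟨-1, by simp⟩

lemma narrowClass_mul (I J : (FractionalIdeal (𝓞 E)⁰ E)ˣ) :
    narrowClass (I * J) = narrowClass I * narrowClass J := rfl

lemma LatticeClass.add_intCast {A : NarrowClassGroup E} {x : E} (h : LatticeClass A x) (k : ℤ) :
    LatticeClass A (x + k) := by
  obtain ⟨I, h1, h2⟩ := h
  refine ⟨I, fun y => (h1 y).trans ⟨?_, ?_⟩, h2⟩
  · rintro ⟨m, n, rfl⟩
    exact ⟨m, n - m * k, by push_cast; ring⟩
  · rintro ⟨m, n, rfl⟩
    exact ⟨m, n + m * k, by push_cast; ring⟩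

lemma LatticeClass.neg {A : NarrowClassGroup E} {x : E} (h : LatticeClass A x) :
    LatticeClass A (-x) := by
  obtain ⟨I, h1, h2⟩ := h
  refine ⟨I, fun y => (h1 y).trans ⟨?_, ?_⟩, h2⟩
  · rintro ⟨m, n, rfl⟩
    exact ⟨-m, n, by push_cast; ring⟩
  · rintro ⟨m, n, rfl⟩
    exact ⟨-m, n, by push_cast; ring⟩

lemma mem_toPrincipalIdeal_mul (u : Eˣ) (I : (FractionalIdeal (𝓞 E)⁰ E)ˣ) (y : E) :
    y ∈ ((toPrincipalIdeal (𝓞 E) E u * I : (FractionalIdeal (𝓞 E)⁰ E)ˣ) :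
      FractionalIdeal (𝓞 E)⁰ E) ↔ ∃ z ∈ (I : FractionalIdeal (𝓞 E)⁰ E), y = u * z := by
  rw [Units.val_mul, coe_toPrincipalIdeal, FractionalIdeal.mem_singleton_mul]

lemma LatticeClass.inv {A : NarrowClassGroup E} {x : Eˣ} (h : LatticeClass A (x : E)) :
    LatticeClass (narrowClassOfElement x⁻¹ * A) (x⁻¹ : E) := by
  obtain ⟨I, h1, h2⟩ := h
  refine ⟨toPrincipalIdeal (𝓞 E) E x⁻¹ * I, fun y => ?_, ?_⟩
  · rw [mem_toPrincipalIdeal_mul, Units.val_inv_eq_inv_val]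
    constructor
    · rintro ⟨z, hz, rfl⟩
      obtain ⟨m, n, rfl⟩ := (h1 z).1 hz
      exact ⟨n, m, by field_simp; ring⟩
    · rintro ⟨m, n, rfl⟩
      exact ⟨n * x + m, (h1 _).2 ⟨n, m, rfl⟩, by field_simp; ring⟩
  · rw [narrowClass_mul, h2]
    rfl

lemma mem_unit_of_isIntegral_smul {I : (FractionalIdeal (𝓞 E)⁰ E)ˣ} {r x : E}
    (hr : IsIntegral ℤ r) (hx : x ∈ (I : FractionalIdeal (𝓞 E)⁰ E)) :
    r * x ∈ (I : FractionalIdeal (𝓞 E)⁰ E) :=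
  (I : FractionalIdeal (𝓞 E)⁰ E).1.smul_mem (⟨r, hr⟩ : 𝓞 E) hx

lemma mem_one_iff_isIntegral {E : Type*} [Field E] {x : E} :
    x ∈ (1 : FractionalIdeal (𝓞 E)⁰ E) ↔ IsIntegral ℤ x := by
  rw [FractionalIdeal.mem_one_iff]
  exact ⟨fun ⟨y, hy⟩ => hy ▸ y.2, fun h => ⟨⟨x, h⟩, rfl⟩⟩

lemma isIntegral_of_forall_mul_mem {I : (FractionalIdeal (𝓞 E)⁰ E)ˣ} {r : E}
    (h : ∀ x ∈ (I : FractionalIdeal (𝓞 E)⁰ E), r * x ∈ (I : FractionalIdeal (𝓞 E)⁰ E)) :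
    IsIntegral ℤ r := by
  rw [← mem_one_iff_isIntegral, ← FractionalIdeal.spanSingleton_le_iff_mem]
  have h1 := FractionalIdeal.spanSingleton_mul_le_iff.2 h
  have h2 := mul_le_mul_left h1 ((I⁻¹ : (FractionalIdeal (𝓞 E)⁰ E)ˣ) : FractionalIdeal (𝓞 E)⁰ E)
  rwa [mul_assoc, Units.mul_inv, mul_one] at h2

end Narrow

/-! ### Signs, conjugation and the class of the different. -/

namespace RealQuadratic

variable {E : Type*} [Field E] [NumberField E] (K : RealQuadratic E)

lemma σ_σ (x : E) : K.σ (K.σ x) = x := by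
  obtain ⟨a, b, rfl⟩ := K.exists_eq x
  simp [K.σ_δ]

lemma embedding_eq (φ : E →+* ℝ) : φ = K.ι ∨ φ = K.ι.comp K.σ := by
  have h : (φ K.δ) ^ 2 = (K.ι K.δ) ^ 2 := by rw [← map_pow, ← map_pow, K.δ_sq]; simp
  rcases sq_eq_sq_iff_eq_or_eq_neg.1 h with h | h
  · left
    ext x
    obtain ⟨a, b, rfl⟩ := K.exists_eq x
    simp [h]
  · right
    ext x
    obtain ⟨a, b, rfl⟩ := K.exists_eq x
    simp [h, K.σ_δ]

lemma ι_comp_σ_ne : K.ι.comp K.σ ≠ K.ι := by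
  intro h
  have := congrArg (fun f => f K.δ) h
  simp only [RingHom.comp_apply, K.σ_δ, map_neg] at this
  linarith [K.δ_pos]

/-- The conjugate of `x` in the real embedding. -/
def conj (x : E) : ℝ := K.ι (K.σ x)

lemma forall_embedding_pos {x : E} (h1 : 0 < K.ι x) (h2 : 0 < K.conj x) (φ : E →+* ℝ) :
    0 < φ x := by
  rcases K.embedding_eq φ with rfl | rfl
  · exact h1
  · exact h2

lemma isReducedRepresentative_iff {A : NarrowClassGroup E} {w : E} :
    IsReducedRepresentative K.ι A w ↔
      1 < K.ι w ∧ (0 < K.conj w ∧ K.conj w < 1) ∧ LatticeClass A w := by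
  refine and_congr_right fun _ => and_congr ⟨fun h => h _ K.ι_comp_σ_ne, fun h φ hφ => ?_⟩ Iff.rfl
  obtain rfl := (K.embedding_eq φ).resolve_left hφ
  exact h

lemma ne_zero_of_ι {x : E} (h : K.ι x ≠ 0) : x ≠ 0 := by
  rintro rfl
  simp at h

lemma inv_mem {A : NarrowClassGroup E} {x : E} (h : LatticeClass A x) (h1 : 0 < K.ι x)
    (h2 : 0 < K.conj x) : LatticeClass A x⁻¹ := by
  have := LatticeClass.inv (x := Units.mk0 x (K.ne_zero_of_ι h1.ne')) h
  rwa [narrowClassOfElement_eq_one, narrowClass_one_mul] at this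
  intro φ
  rw [Units.val_inv_eq_inv_val, map_inv₀]
  exact inv_pos.2 (K.forall_embedding_pos h1 h2 φ)

/-- Either x/δ or -x/δ is totally positive, and x and -x generate the same ideal. So J is the class
of every principal ideal with a generator of negative norm. -/
lemma narrowClassOfElement_eq (δ : Eˣ) (hδ : (δ : E) = K.δ) (x : Eˣ)
    (h : K.ι x * K.conj x < 0) : narrowClassOfElement x = narrowClassOfElement δ := by
  have hδ1 := K.δ_pos
  have hδ2 : K.conj K.δ < 0 := by unfold conj; rw [K.σ_δ, map_neg]; linarith
  have key : ∀ y : Eˣ, 0 < K.ι y → K.conj y < 0 →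
      narrowClassOfElement y = narrowClassOfElement δ := by
    intro y h1 h2
    have e : y = (y * δ⁻¹) * δ := by simp
    rw [e, narrowClassOfElement_mul, narrowClassOfElement_eq_one, narrowClass_one_mul]
    refine K.forall_embedding_pos ?_ ?_
    · rw [Units.val_mul, Units.val_inv_eq_inv_val, hδ, map_mul, map_inv₀]
      positivity
    · unfold conj at *
      rw [Units.val_mul, Units.val_inv_eq_inv_val, hδ, map_mul, map_mul, map_inv₀, map_inv₀]
      exact mul_pos_of_neg_of_neg h2 (inv_lt_zero.2 hδ2)
  rcases mul_neg_iff.1 h with ⟨h1, h2⟩ | ⟨h1, h2⟩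
  · exact key x h1 h2
  · rw [← narrowClassOfElement_neg]
    refine key (-x) ?_ ?_
    · rw [Units.val_neg, map_neg]; linarith
    · unfold conj at *
      rw [Units.val_neg, map_neg, map_neg]; linarith

lemma narrowClassOfElement_δ_sq (δ : Eˣ) (hδ : (δ : E) = K.δ) :
    narrowClassOfElement δ * narrowClassOfElement δ = narrowClass 1 := by
  rw [← narrowClassOfElement_mul]
  refine narrowClassOfElement_eq_one (K.forall_embedding_pos ?_ ?_)
  · rw [Units.val_mul, hδ, map_mul]
    exact mul_pos K.δ_pos K.δ_pos
  · unfold conj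
    rw [Units.val_mul, hδ, map_mul, K.σ_δ, neg_mul_neg, map_mul]
    exact mul_pos K.δ_pos K.δ_pos

lemma inv_mem_of_neg (δ : Eˣ) (hδ : (δ : E) = K.δ) {A : NarrowClassGroup E} {x : E}
    (h : LatticeClass A x) (h1 : K.ι x * K.conj x < 0) :
    LatticeClass (narrowClassOfElement δ * A) x⁻¹ := by
  have hx := K.ne_zero_of_ι (left_ne_zero_of_mul h1.ne)
  have := LatticeClass.inv (x := Units.mk0 x hx) h
  rwa [K.narrowClassOfElement_eq δ hδ] at this
  unfold conj at *
  rw [Units.val_inv_eq_inv_val, map_inv₀, map_inv₀, map_inv₀, ← mul_inv]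
  exact inv_lt_zero.2 h1

/-- Conjugation inverts narrow classes. -/
lemma latticeClass_σ {A : NarrowClassGroup E} {x : E} (h : LatticeClass A x) (hx : K.σ x ≠ x) :
    ∃ B, B * A = narrowClass 1 ∧ LatticeClass B (K.σ x) := by
  obtain ⟨I, h1, h2⟩ := h
  have hx' : x - K.σ x ≠ 0 := sub_ne_zero.2 (Ne.symm hx)
  have mem1 : (1 : E) ∈ (I : FractionalIdeal (𝓞 E)⁰ E) := (h1 1).2 ⟨0, 1, by simp⟩
  have memx : x ∈ (I : FractionalIdeal (𝓞 E)⁰ E) := (h1 x).2 ⟨1, 0, by simp⟩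
  have hσi : ∀ r : E, IsIntegral ℤ r → IsIntegral ℤ (K.σ r) := fun r hr =>
    hr.map (K.σ.toIntAlgHom)
  have hex : ∃ u : ℕ, 0 < u ∧ IsIntegral ℤ ((u : E) * x) := by
    obtain ⟨y, hy, hi⟩ := ((IsFractionRing.isAlgebraic_iff ℤ ℚ E).2
      (Algebra.IsAlgebraic.isAlgebraic x)).exists_integral_multiple
    refine ⟨y.natAbs, Int.natAbs_pos.2 hy, ?_⟩
    rw [zsmul_eq_mul] at hi
    rcases Int.natAbs_eq y with h | h
    · have e : ((y.natAbs : ℕ) : E) = y := by rw [← Int.cast_natCast, ← h]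
      rwa [e]
    · have e : ((y.natAbs : ℕ) : E) = -y := by
        rw [← Int.cast_natCast, show ((y.natAbs : ℕ) : ℤ) = -y by omega, Int.cast_neg]
      rw [e, neg_mul]
      exact hi.neg
  classical
  -- With u the least positive integer making ux integral, u x² = s x + t is the primitive equation
  -- of x. Then I · σ(I) = (1/u), so the lattice ℤσ(x) + ℤ is u⁻¹ I⁻¹.
  set u := Nat.find hex with hu
  obtain ⟨u0, ui⟩ := Nat.find_spec hex
  rw [← hu] at u0 ui
  obtain ⟨s, t, hst⟩ := (h1 _).1 (mem_unit_of_isIntegral_smul ui memx)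
  have hst' : (u : E) * K.σ x * K.σ x = s * K.σ x + t := by
    have := congrArg K.σ hst
    simpa using this
  have es : (u : E) * (x + K.σ x) = s := by
    apply mul_right_cancel₀ hx'
    linear_combination hst - hst'
  have et : (u : E) * (x * K.σ x) = -t := by
    linear_combination x * es - hst
  -- A common factor g of u, s, t could be divided out of the equation: (u/g)x would still multiply
  -- I into itself, hence be integral, against the minimality of u.
  obtain ⟨a, b, c, habc⟩ : ∃ a b c : ℤ, (u : ℤ) * a + s * b + t * c = 1 := by
    set g := Int.gcd (Int.gcd u s) t with hg
    have hgu : (g : ℤ) ∣ u := (Int.gcd_dvd_left ..).trans (Int.gcd_dvd_left ..)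
    have hgs : (g : ℤ) ∣ s := (Int.gcd_dvd_left ..).trans (Int.gcd_dvd_right ..)
    have hgt : (g : ℤ) ∣ t := Int.gcd_dvd_right ..
    have hg1 : g = 1 := by
      obtain ⟨u', hu'⟩ := Int.natCast_dvd_natCast.1 hgu
      obtain ⟨s', hs'⟩ := hgs
      obtain ⟨t', ht'⟩ := hgt
      have hg0 : (g : E) ≠ 0 := by
        rintro h0
        have : g = 0 := by exact_mod_cast h0
        rw [this, zero_mul] at hu'
        omega
      have hi : IsIntegral ℤ ((u' : E) * x) := by
        refine isIntegral_of_forall_mul_mem (I := I) fun z hz => ?_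
        obtain ⟨m, n, rfl⟩ := (h1 z).1 hz
        refine (h1 _).2 ⟨m * s' + n * u', m * t', ?_⟩
        have e : (u' : E) * x * x = s' * x + t' := by
          apply mul_left_cancel₀ hg0
          have e1 : (u : E) = g * u' := by rw [hu']; push_cast; rfl
          have e2 : (s : E) = g * s' := by rw [hs']; push_cast; rfl
          have e3 : (t : E) = g * t' := by rw [ht']; push_cast; rfl
          rw [e1, e2, e3] at hst
          linear_combination hst
        push_cast
        linear_combination (m : E) * e
      have hu'0 : 0 < u' := Nat.pos_of_mul_pos_left (hu' ▸ u0)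
      have hle : u ≤ u' := Nat.find_min' hex ⟨hu'0, hi⟩
      have hgpos : 0 < g := Nat.pos_of_mul_pos_right (hu' ▸ u0)
      nlinarith
    have k1 := Int.gcd_eq_gcd_ab u s
    have k2 := Int.gcd_eq_gcd_ab (Int.gcd u s) t
    rw [← hg, hg1] at k2
    generalize Int.gcdA (Int.gcd u s) t = p at *
    generalize Int.gcdB (Int.gcd u s) t = q at *
    rw [k1] at k2
    exact ⟨Int.gcdA u s * p, Int.gcdB u s * p, q, by push_cast at k2; linear_combination -k2⟩
  have hu0 : (u : E) ≠ 0 := by exact_mod_cast u0.ne'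
  have habc' : (u : E) * a + s * b + t * c = 1 := by exact_mod_cast habc
  have hint : ∀ r : E, IsIntegral ℤ r → ∃ m n : ℤ, r = m * K.σ x + n := by
    intro r hr
    obtain ⟨m, n, hmn⟩ := (h1 _).1 (mem_unit_of_isIntegral_smul (hσi r hr) mem1)
    refine ⟨m, n, ?_⟩
    rw [← K.σ_σ r]
    rw [mul_one] at hmn
    rw [hmn]
    simp
  have hint' : ∀ r : E, IsIntegral ℤ r → ∃ m n : ℤ, r * K.σ x = m * K.σ x + n := by
    intro r hr
    obtain ⟨m, n, hmn⟩ := (h1 _).1 (mem_unit_of_isIntegral_smul (hσi r hr) memx)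
    refine ⟨m, n, ?_⟩
    rw [← K.σ_σ r, ← map_mul, hmn]
    simp
  have hiz : ∀ m : ℤ, IsIntegral ℤ (m : E) := fun m => isIntegral_algebraMap (R := ℤ)
  let U : Eˣ := Units.mk0 (u : E) hu0
  have eU : narrowClassOfElement U⁻¹ = narrowClass 1 := by
    refine narrowClassOfElement_eq_one fun φ => ?_
    rw [Units.val_inv_eq_inv_val, map_inv₀]
    change 0 < (φ (u : E))⁻¹
    rw [map_natCast]
    positivity
  refine ⟨narrowClassOfElement U⁻¹ * narrowClass I⁻¹, ?_,
    toPrincipalIdeal (𝓞 E) E U⁻¹ * I⁻¹, fun y => ?_, rfl⟩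
  · rw [eU, narrowClass_one_mul, ← h2, ← narrowClass_mul, inv_mul_cancel]
  · have hinv : ∀ z : E, z ∈ ((I⁻¹ : (FractionalIdeal (𝓞 E)⁰ E)ˣ) : FractionalIdeal (𝓞 E)⁰ E) ↔
        IsIntegral ℤ z ∧ IsIntegral ℤ (z * x) := by
      intro z
      rw [Units.val_inv_eq_inv_val, FractionalIdeal.mem_inv_iff I.ne_zero]
      constructor
      · intro h
        have k1 := h 1 mem1
        have k2 := h x memx
        rw [mem_one_iff_isIntegral] at k1 k2
        rw [mul_one] at k1
        exact ⟨k1, k2⟩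
      · rintro ⟨k1, k2⟩ y hy
        obtain ⟨m, n, rfl⟩ := (h1 y).1 hy
        rw [mem_one_iff_isIntegral]
        rw [show z * (m * x + n) = m * (z * x) + n * z by ring]
        exact ((hiz m).mul k2).add ((hiz n).mul k1)
    rw [mem_toPrincipalIdeal_mul]
    have hU : ((U⁻¹ : Eˣ) : E) = (u : E)⁻¹ := rfl
    rw [hU]
    constructor
    · rintro ⟨z, hz, rfl⟩
      obtain ⟨k1, k2⟩ := (hinv z).1 hz
      obtain ⟨m1, n1, e1⟩ := hint (a * z + b * (z * x)) (((hiz a).mul k1).add ((hiz b).mul k2))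
      obtain ⟨m2, n2, e2⟩ := hint' (b * z - c * (z * x)) (((hiz b).mul k1).sub ((hiz c).mul k2))
      refine ⟨m1 + m2, n1 + n2, ?_⟩
      push_cast
      -- The Bézout relation is used here: trace and norm of x are s/u and -t/u, so multiplying by u
      -- gives z(ua + sb + tc).
      have : (u : E)⁻¹ * z = (a * z + b * (z * x)) + (b * z - c * (z * x)) * K.σ x := by
        rw [inv_mul_eq_iff_eq_mul₀ hu0]
        linear_combination (-z) * habc' - z * b * es + z * c * et
      rw [this, e1, e2]
      ring
    · rintro ⟨m, n, rfl⟩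
      refine ⟨u * (m * K.σ x + n), (hinv _).2 ⟨?_, ?_⟩, by field_simp⟩
      · have k := hσi _ ui
        simp only [map_mul, map_natCast] at k
        rw [show (u : E) * (m * K.σ x + n) = m * (u * K.σ x) + n * (u : ℤ) by push_cast; ring]
        exact ((hiz m).mul k).add ((hiz n).mul (hiz u))
      · have e : (u : E) * (m * K.σ x + n) * x = m * (-t : ℤ) + n * (u * x) := by
          push_cast
          linear_combination (m : E) * et
        rw [e]
        exact ((hiz m).mul (hiz (-t))).add ((hiz n).mul ui)

end RealQuadratic

namespace RealQuadratic

variable {E : Type*} [Field E] [NumberField E] (K : RealQuadratic E)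

/-! ### Reduced numbers -/

/-- `w` is reduced: `0 < σ w < 1 < w`. -/
def Reduced (w : E) : Prop := 1 < K.ι w ∧ 0 < K.conj w ∧ K.conj w < 1

/-- One step of the minus continued fraction algorithm. -/
noncomputable def step (w : E) : E := ((⌈K.ι w⌉ : ℤ) - w)⁻¹

variable {K}

lemma Reduced.conj_lt {w : E} (h : K.Reduced w) : K.conj w < K.ι w := h.2.2.trans h.1

lemma σ_ne_of_conj_lt {w : E} (h : K.conj w < K.ι w) : K.σ w ≠ w := by
  intro e
  unfold conj at h
  rw [e] at h
  exact lt_irrefl _ h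

lemma Reduced.two_le {w : E} (h : K.Reduced w) : 2 ≤ ⌈K.ι w⌉ := by
  have : 1 < ⌈K.ι w⌉ := Int.lt_ceil.2 (by exact_mod_cast h.1)
  omega

lemma Reduced.lt_ceil {w : E} (h : K.Reduced w) : K.ι w < ⌈K.ι w⌉ := by
  refine lt_of_le_of_ne (Int.le_ceil _) fun e => ?_
  have : w = ((⌈K.ι w⌉ : ℤ) : E) := K.ι.injective (by rw [map_intCast]; exact e)
  refine σ_ne_of_conj_lt h.conj_lt ?_
  rw [this]
  simp

lemma ι_step (w : E) : K.ι (K.step w) = (⌈K.ι w⌉ - K.ι w)⁻¹ := by simp [step]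

lemma ι_step_eq_minusStep (w : E) : K.ι (K.step w) = minusStep (K.ι w) := K.ι_step w

lemma conj_step (w : E) : K.conj (K.step w) = (⌈K.ι w⌉ - K.conj w)⁻¹ := by simp [step, conj]

lemma Reduced.ceil_sub_pos {w : E} (h : K.Reduced w) :
    0 < K.ι ((⌈K.ι w⌉ : ℤ) - w) ∧ 0 < K.conj ((⌈K.ι w⌉ : ℤ) - w) := by
  have h1 := h.lt_ceil
  have h2 : (2 : ℝ) ≤ ⌈K.ι w⌉ := by exact_mod_cast h.two_le
  have h3 := h.2.2
  unfold conj at *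
  simp only [map_sub, map_intCast]
  constructor <;> linarith

lemma Reduced.step {w : E} (h : K.Reduced w) : K.Reduced (K.step w) := by
  have h1 := h.lt_ceil
  have h2 : (2 : ℝ) ≤ ⌈K.ι w⌉ := by exact_mod_cast h.two_le
  have h3 := h.2.2
  have h4 := h.2.1
  refine ⟨?_, ?_, ?_⟩
  · rw [ι_step]
    exact (one_lt_inv₀ (by linarith)).2 (by linarith [Int.ceil_lt_add_one (K.ι w)])
  · rw [conj_step]
    exact inv_pos.2 (by linarith)
  · rw [conj_step]
    exact inv_lt_one_of_one_lt₀ (by linarith)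

lemma Reduced.latticeClass_step {A : NarrowClassGroup E} {w : E} (h : K.Reduced w)
    (hw : LatticeClass A w) : LatticeClass A (K.step w) := by
  have := hw.neg.add_intCast ⌈K.ι w⌉
  rw [neg_add_eq_sub] at this
  exact K.inv_mem this h.ceil_sub_pos.1 h.ceil_sub_pos.2

lemma eq_of_sub_intCast {w v : E} (hw : K.Reduced w) (hv : K.Reduced v) (n : ℤ)
    (h : v = w + n) : v = w := by
  have h1 : K.conj v = K.conj w + n := by rw [h]; simp [conj]
  have h2 : (n : ℝ) < 1 := by linarith [hw.2.1, hv.2.2]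
  have h3 : (-1 : ℝ) < n := by linarith [hw.2.2, hv.2.1]
  have h4 : n < 1 := by exact_mod_cast h2
  have h5 : -1 < n := by exact_mod_cast h3
  obtain rfl : n = 0 := by omega
  simpa using h

lemma step_injective {w v : E} (hw : K.Reduced w) (hv : K.Reduced v) (h : K.step w = K.step v) :
    w = v := by
  have h1 := inv_injective h
  refine eq_of_sub_intCast hv hw (⌈K.ι w⌉ - ⌈K.ι v⌉) ?_
  push_cast
  linear_combination -h1

lemma Reduced.eq_sub_inv {w : E} (_h : K.Reduced w) : w = (⌈K.ι w⌉ : ℤ) - (K.step w)⁻¹ := by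
  unfold RealQuadratic.step
  rw [inv_inv]
  ring

/-! ### Equivalent reduced numbers lie in the same cycle -/

/-- Induction on -c. For c = 0 the matrix is a translation, and both conjugates lie in (0, 1).
Otherwise w = n - 1/w₁ gives a matrix from w₁ to v with lower left entry cn + d, and c < cn + d ≤ 0.
-/
lemma exists_iterate_step_of_nonpos (m : ℕ) : ∀ (w v : E) (a b c d : ℤ), K.Reduced w →
    K.Reduced v → a * d - b * c = 1 → v * (c * w + d) = a * w + b → 0 < K.ι (c * w + d) →
    0 < K.conj (c * w + d) → c ≤ 0 → -c ≤ m → ∃ k : ℕ, K.step^[k] w = v := by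
  induction m with
  | zero =>
    intro w v a b c d hw hv hdet he h1 h2 hc hcm
    obtain rfl : c = 0 := by simp at hcm; omega
    have hd : 0 < d := by
      have : (0 : ℝ) < d := by simpa using h1
      exact_mod_cast this
    rw [mul_zero, sub_zero] at hdet
    obtain rfl : d = 1 := by
      rcases Int.eq_one_or_neg_one_of_mul_eq_one (by rwa [mul_comm] at hdet : d * a = 1) with h | h
      · exact h
      · omega
    obtain rfl : a = 1 := by simpa using hdet
    exact ⟨0, (eq_of_sub_intCast hw hv b (by simpa using he)).symm⟩
  | succ m ih =>
    intro w v a b c d hw hv hdet he h1 h2 hc hcm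
    rcases hc.eq_or_lt with rfl | hc
    · exact ih w v a b 0 d hw hv hdet he h1 h2 le_rfl (by simp)
    have hw1 := hw.step
    have hn1 : K.ι w < ⌈K.ι w⌉ := hw.lt_ceil
    have hn2 : (⌈K.ι w⌉ : ℝ) < K.ι w + 1 := Int.ceil_lt_add_one _
    have hwn := hw.eq_sub_inv
    set n := ⌈K.ι w⌉ with hn
    set w1 := K.step w with hw1'
    have hw10 : w1 ≠ 0 := K.ne_zero_of_ι (by linarith [hw1.1])
    have hden : ((c * n + d : ℤ) : E) * w1 + ((-c : ℤ) : E) = w1 * (c * w + d) := by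
      rw [hwn]
      push_cast
      field_simp
      ring
    have hce : c < c * n + d := by
      have : (c : ℝ) * K.ι w + d > 0 := by simpa using h1
      have hc' : (c : ℝ) ≤ -1 := by
        have : c ≤ -1 := by omega
        exact_mod_cast this
      have : (c : ℝ) < c * n + d := by nlinarith
      exact_mod_cast this
    have hc1 : c * n + d ≤ 0 := by
      -- Put q = a - c and p = d - b. Reducedness of v gives q > 0 and p < qn, and the determinant
      -- reads qd + cp = 1. If cn + d ≥ 1, the left side is at least q - c ≥ 2.
      by_contra! hpos
      have e1 := congrArg K.ι he
      have e2 := congrArg K.conj he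
      unfold conj at e2 h2
      simp only [map_mul, map_add, map_intCast] at e1 e2 h1 h2
      have hv1 := hv.1
      have hv2 := hv.2.2
      have hwlt := hw.conj_lt
      unfold conj at hv2 hwlt
      have k1 : (c : ℝ) * K.ι w + d < a * K.ι w + b := by rw [← e1]; nlinarith
      have k2 : (a : ℝ) * K.ι (K.σ w) + b < c * K.ι (K.σ w) + d := by rw [← e2]; nlinarith
      have hq : (0 : ℝ) < a - c := by
        by_contra! hle
        nlinarith
      have hq' : 0 < a - c := by
        have : (0 : ℝ) < ((a - c : ℤ) : ℝ) := by push_cast; exact hq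
        exact_mod_cast this
      have hp : d - b < (a - c) * n := by
        have : (d - b : ℝ) < (a - c) * n := by nlinarith
        exact_mod_cast this
      have key : (a - c) * d - (-c) * (d - b) = 1 := by linear_combination hdet
      have k3 : (a - c) * ((-c) * n + 1) ≤ (a - c) * d :=
        mul_le_mul_of_nonneg_left (by linarith) hq'.le
      have k4 : (-c) * (d - b) ≤ (-c) * ((a - c) * n - 1) :=
        mul_le_mul_of_nonneg_left (by omega) (by omega)
      nlinarith
    obtain ⟨k, hk⟩ := ih w1 v (a * n + b) (-a) (c * n + d) (-c) hw1 hv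
      (by linear_combination hdet) (by
        rw [hden]
        have : v * (w1 * (c * w + d)) = w1 * (a * w + b) := by rw [← he]; ring
        rw [this, hwn]
        push_cast
        field_simp
        ring) (by
        rw [hden, map_mul]
        exact mul_pos (by linarith [hw1.1]) h1) (by
        rw [hden]
        unfold conj at *
        rw [map_mul, map_mul]
        exact mul_pos hw1.2.1 h2) hc1 (by push_cast at hcm; omega)
    exact ⟨k + 1, hk⟩

lemma exists_iterate_step {w v : E} {a b c d : ℤ} (hw : K.Reduced w) (hv : K.Reduced v)
    (hdet : a * d - b * c = 1) (he : v * (c * w + d) = a * w + b) (h1 : 0 < K.ι (c * w + d))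
    (h2 : 0 < K.conj (c * w + d)) : (∃ k : ℕ, K.step^[k] w = v) ∨ ∃ k : ℕ, K.step^[k] v = w := by
  rcases le_or_gt c 0 with hc | hc
  · exact Or.inl (exists_iterate_step_of_nonpos (-c).toNat w v a b c d hw hv hdet he h1 h2 hc
      (by omega))
  · have hdet' : (a : E) * d - b * c = 1 := by exact_mod_cast hdet
    have hm : (((-c : ℤ) : E) * v + a) * (c * w + d) = 1 := by
      push_cast
      linear_combination (-(c : E)) * he + hdet'
    refine Or.inr (exists_iterate_step_of_nonpos c.toNat v w d (-b) (-c) a hv hw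
      (by linear_combination hdet) ?_ ?_ ?_ (by omega) (by omega))
    · have h0 : (c : E) * w + d ≠ 0 := right_ne_zero_of_mul_eq_one hm
      apply mul_right_cancel₀ h0
      push_cast
      push_cast at hm
      linear_combination w * hm - (d : E) * he - w * hdet'
    · have := congrArg K.ι hm
      rw [map_mul, map_one] at this
      exact pos_of_mul_pos_left (this ▸ one_pos) h1.le
    · have := congrArg K.conj hm
      unfold conj at *
      rw [map_mul, map_mul, map_one, map_one] at this
      exact pos_of_mul_pos_left (this ▸ one_pos) h2.le

lemma intCast_eq_zero_of_mul_add {w : E} (h : K.σ w ≠ w) {m n : ℤ} (e : (m : E) * w + n = 0) :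
    m = 0 ∧ n = 0 := by
  have e' := congrArg K.σ e
  simp only [map_add, map_mul, map_intCast, map_zero] at e'
  have h1 : (m : E) * (K.σ w - w) = 0 := by linear_combination e' - e
  have h2 : (m : E) = 0 := (mul_eq_zero.1 h1).resolve_right (sub_ne_zero.2 h)
  rw [h2, zero_mul, zero_add] at e
  exact ⟨by exact_mod_cast h2, by exact_mod_cast e⟩

/-- The lattices differ by a totally positive factor x = cw + d, which gives a base change of
determinant ±1. Since both bases are oriented alike and x has positive norm, the determinant is 1.
-/
lemma exists_matrix {A : NarrowClassGroup E} {w v : E} (hw : LatticeClass A w)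
    (hv : LatticeClass A v) (hw' : K.conj w < K.ι w) (hv' : K.conj v < K.ι v) :
    ∃ a b c d : ℤ, a * d - b * c = 1 ∧ v * (c * w + d) = a * w + b ∧ 0 < K.ι (c * w + d) ∧
      0 < K.conj (c * w + d) := by
  obtain ⟨I, hI, rfl⟩ := hw
  obtain ⟨J, hJ, hJI⟩ := hv
  obtain ⟨x, hx, hxI⟩ := QuotientGroup.eq.1 hJI
  have hxI : I = toPrincipalIdeal (𝓞 E) E x * J := by
    rw [hxI, mul_assoc, mul_comm I, inv_mul_cancel_left]
  have hmem : ∀ y : E, (∃ m n : ℤ, y = m * w + n) ↔ ∃ m n : ℤ, y = x * (m * v + n) := by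
    intro y
    rw [← hI, hxI, mem_toPrincipalIdeal_mul]
    constructor
    · rintro ⟨z, hz, rfl⟩
      obtain ⟨m, n, rfl⟩ := (hJ z).1 hz
      exact ⟨m, n, rfl⟩
    · rintro ⟨m, n, rfl⟩
      exact ⟨_, (hJ _).2 ⟨m, n, rfl⟩, rfl⟩
  obtain ⟨c, d, hcd⟩ := (hmem x).2 ⟨0, 1, by simp⟩
  obtain ⟨a, b, hab⟩ := (hmem (x * v)).2 ⟨1, 0, by simp⟩
  obtain ⟨p, q, hpq⟩ := (hmem 1).1 ⟨0, 1, by simp⟩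
  obtain ⟨r, s, hrs⟩ := (hmem w).1 ⟨1, 0, by simp⟩
  have hσ := σ_ne_of_conj_lt hw'
  have e1 := intCast_eq_zero_of_mul_add hσ (m := p * a + q * c) (n := p * b + q * d - 1) (by
    push_cast
    linear_combination -hpq - p * hab - q * hcd)
  have e2 := intCast_eq_zero_of_mul_add hσ (m := r * a + s * c - 1) (n := r * b + s * d) (by
    push_cast
    linear_combination -hrs - r * hab - s * hcd)
  have hunit : (a * d - b * c) * (r * q - s * p) = 1 := by
    linear_combination (p * b + q * d) * e2.1 + e1.2 - (r * b + s * d) * e1.1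
  have he : v * (c * w + d) = a * w + b := by rw [← hcd, ← hab, mul_comm]
  have h1 : 0 < K.ι (c * w + d) := by rw [← hcd]; exact hx _
  have h2 : 0 < K.conj (c * w + d) := by rw [← hcd]; exact hx (K.ι.comp K.σ)
  refine ⟨a, b, c, d, ?_, he, h1, h2⟩
  rcases Int.eq_one_or_neg_one_of_mul_eq_one hunit with h | h
  · exact h
  · exfalso
    have f1 := congrArg K.ι he
    have f2 := congrArg K.conj he
    unfold conj at *
    simp only [map_mul, map_add, map_intCast] at f1 f2 h1 h2
    have h' : (a * d - b * c : ℝ) = -1 := by exact_mod_cast h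
    have f3 : (K.ι v - K.ι (K.σ v)) * ((c * K.ι w + d) * (c * K.ι (K.σ w) + d)) =
        (a * d - b * c) * (K.ι w - K.ι (K.σ w)) := by
      linear_combination (c * K.ι (K.σ w) + d) * f1 - (c * K.ι w + d) * f2
    rw [h'] at f3
    have := mul_pos (sub_pos.2 hv') (mul_pos h1 h2)
    linarith

lemma exists_iterate_step_of_latticeClass {A : NarrowClassGroup E} {w v : E} (hw : K.Reduced w)
    (hv : K.Reduced v) (hwA : LatticeClass A w) (hvA : LatticeClass A v) :
    (∃ k : ℕ, K.step^[k] w = v) ∨ ∃ k : ℕ, K.step^[k] v = w := by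
  obtain ⟨a, b, c, d, h1, h2, h3, h4⟩ := exists_matrix hwA hvA hw.conj_lt hv.conj_lt
  exact exists_iterate_step hw hv h1 h2 h3 h4

/-! ### Integral forms and finiteness -/

lemma isIntegral_δ : IsIntegral ℤ K.δ := by
  refine IsIntegral.of_pow (n := 2) two_pos ?_
  rw [K.δ_sq]
  exact isIntegral_algebraMap (R := ℤ)

/-- The form comes from multiplication by δ on the lattice, a matrix of trace 0 and determinant -D.
It may be imprimitive, but its discriminant is 4D for every lattice, as local finiteness requires.
-/
lemma LatticeClass.exists_form {A : NarrowClassGroup E} {x : E} (h : LatticeClass A x)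
    (hx : K.conj x < K.ι x) : ∃ P Q R : ℤ, 0 < P ∧ Q ^ 2 - 4 * P * R = 4 * K.D ∧
      P * (K.ι x + K.conj x) = -Q ∧ P * (K.ι x * K.conj x) = R ∧ 2 * P * x = 2 * K.δ - Q := by
  obtain ⟨I, h1, -⟩ := h
  have mem1 : (1 : E) ∈ (I : FractionalIdeal (𝓞 E)⁰ E) := (h1 1).2 ⟨0, 1, by simp⟩
  have memx : x ∈ (I : FractionalIdeal (𝓞 E)⁰ E) := (h1 x).2 ⟨1, 0, by simp⟩
  obtain ⟨P, n, hP⟩ := (h1 _).1 (mem_unit_of_isIntegral_smul K.isIntegral_δ mem1)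
  obtain ⟨k, l, hk⟩ := (h1 _).1 (mem_unit_of_isIntegral_smul K.isIntegral_δ memx)
  rw [mul_one] at hP
  have hP' := congrArg K.σ hP
  have hk' := congrArg K.σ hk
  simp only [map_add, map_mul, map_intCast, K.σ_δ] at hP' hk'
  have hne : x - K.σ x ≠ 0 := sub_ne_zero.2 (Ne.symm (σ_ne_of_conj_lt hx))
  have hkn : (k : E) = -n := by
    apply mul_right_cancel₀ hne
    linear_combination -hk + hk' + K.σ x * hP - x * hP'
  have e1 : (P : E) * (x + K.σ x) = -(2 * n : ℤ) := by
    push_cast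
    linear_combination -hP - hP'
  have e2 : (P : E) * (x * K.σ x) = (-l : ℤ) := by
    push_cast
    linear_combination -K.σ x * hP - hk' - K.σ x * hkn
  have e3 : (2 * n) ^ 2 - 4 * P * (-l) = 4 * K.D := by
    have : ((2 * n) ^ 2 - 4 * P * (-l) : E) = 4 * K.D := by
      rw [← K.δ_sq]
      push_cast at e2
      linear_combination (4 * P : E) * e2 + 4 * (-K.δ - n) * hP + 4 * P * x * hP'
    exact_mod_cast this
  have r0 := congrArg K.ι hP
  have r0' := congrArg K.ι hP'
  have r1 := congrArg K.ι e1
  have r2 := congrArg K.ι e2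
  unfold conj at *
  simp only [map_mul, map_add, map_neg, map_intCast] at r0 r0' r1 r2
  have hPpos : 0 < P := by
    have hδ := K.δ_pos
    have : (0 : ℝ) < P := by
      by_contra! hle
      nlinarith
    exact_mod_cast this
  exact ⟨P, 2 * n, -l, hPpos, e3, r1, r2, by push_cast; linear_combination -2 * hP⟩

/-- The form is negative at 1, which lies between its roots, so -Q ≥ P + R + 1. With Q² = 4D + 4PR
this gives (P - R)² + 2(P + R) + 1 ≤ 4D, which bounds P and R and then Q. -/
lemma finite_reduced : {w : E | K.Reduced w ∧ ∃ A, LatticeClass A w}.Finite := by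
  set B : ℤ := 4 * K.D + 16 * K.D ^ 2 with hB
  refine (((Set.finite_Icc (1 : ℤ) B).prod (Set.finite_Icc (-B) B)).image
    (fun x : ℤ × ℤ => (2 * K.δ - x.2) / (2 * x.1 : E))).subset ?_
  rintro w ⟨hw, A, hA⟩
  obtain ⟨P, Q, R, hP, hD, h1, h2, h3⟩ := LatticeClass.exists_form hA hw.conj_lt
  have hP' : (0 : ℝ) < P := by exact_mod_cast hP
  have hwpos : 0 < K.ι w := zero_lt_one.trans hw.1
  have hR : 0 < R := by
    have : (0 : ℝ) < R := by rw [← h2]; have := hw.2.1; positivity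
    exact_mod_cast this
  have hQ : P + Q + R < 0 := by
    have e : (P + Q + R : ℝ) = -(P * ((K.ι w - 1) * (1 - K.conj w))) := by
      linear_combination h1 - h2
    have : 0 < P * ((K.ι w - 1) * (1 - K.conj w)) :=
      mul_pos hP' (mul_pos (sub_pos.2 hw.1) (sub_pos.2 hw.2.2))
    have : (P + Q + R : ℝ) < 0 := by linarith
    exact_mod_cast this
  have k1 : P + R + 1 ≤ -Q := by omega
  have k2 : (P + R + 1) ^ 2 ≤ Q ^ 2 := by nlinarith
  have k3 : P + R ≤ 2 * K.D := by nlinarith [sq_nonneg (P - R)]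
  have k4 : 4 * P * R ≤ 16 * K.D ^ 2 := by nlinarith
  have k5 : -Q ≤ B := by nlinarith
  have hDpos : 0 < K.D := by omega
  refine ⟨(P, Q), ⟨⟨by simp only; omega, by simp only; nlinarith⟩, by simp only; omega,
    by simp only; omega⟩, ?_⟩
  have hP0 : (P : E) ≠ 0 := by exact_mod_cast hP.ne'
  simp only
  rw [← h3]
  field_simp

end RealQuadratic

namespace RealQuadratic

variable {E : Type*} [Field E] [NumberField E] {K : RealQuadratic E}

/-! ### Every narrow class contains a reduced number -/

lemma exists_basis_fractionalIdeal (K : RealQuadratic E) (I : (FractionalIdeal (𝓞 E)⁰ E)ˣ) :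
    ∃ a b : E, a ≠ 0 ∧
      ∀ x : E, x ∈ (I : FractionalIdeal (𝓞 E)⁰ E) ↔ ∃ m n : ℤ, x = m * a + n * b := by
  classical
  let b := NumberField.basisOfFractionalIdeal E I
  have hcard : Fintype.card (Module.Free.ChooseBasisIndex ℤ I) = 2 := by
    rw [← Module.finrank_eq_card_basis b, K.finrank_eq]
  let e := (Fintype.equivFinOfCardEq hcard)
  refine ⟨b (e.symm 0), b (e.symm 1), b.ne_zero _, fun x => ?_⟩
  have h : x ∈ (I : FractionalIdeal (𝓞 E)⁰ E) ↔ x ∈ Submodule.span ℤ (Set.range b) :=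
    (NumberField.mem_span_basisOfFractionalIdeal E).symm
  rw [h, Submodule.mem_span_range_iff_exists_fun]
  constructor
  · rintro ⟨c, rfl⟩
    refine ⟨c (e.symm 0), c (e.symm 1), ?_⟩
    rw [← Equiv.sum_comp e.symm, Fin.sum_univ_two, zsmul_eq_mul, zsmul_eq_mul]
  · rintro ⟨m, n, rfl⟩
    refine ⟨fun i => ![m, n] (e i), ?_⟩
    rw [← Equiv.sum_comp e.symm, Fin.sum_univ_two]
    simp

lemma LatticeClass.σ_ne {A : NarrowClassGroup E} {x : E} (h : LatticeClass A x) :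
    K.σ x ≠ x := by
  intro e
  obtain ⟨I, h1, -⟩ := h
  have mem1 : (1 : E) ∈ (I : FractionalIdeal (𝓞 E)⁰ E) := (h1 1).2 ⟨0, 1, by simp⟩
  obtain ⟨m, n, hmn⟩ := (h1 _).1 (mem_unit_of_isIntegral_smul K.isIntegral_δ mem1)
  rw [mul_one] at hmn
  have := congrArg K.σ hmn
  simp only [map_add, map_mul, map_intCast, K.σ_δ, e] at this
  have h2 : K.ι K.δ + K.ι K.δ = 0 := by
    rw [← map_add]
    have : K.δ + K.δ = 0 := by linear_combination hmn - this
    rw [this, map_zero]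
  linarith [K.δ_pos]

/-- For nonzero z in I and a nonzero integer y with yz integral, the square (yz)² = y · (yz) · z
lies in I. -/
lemma exists_totallyPositive_mem (K : RealQuadratic E) (I : (FractionalIdeal (𝓞 E)⁰ E)ˣ) :
    ∃ β ∈ (I : FractionalIdeal (𝓞 E)⁰ E), 0 < K.ι β ∧ 0 < K.conj β := by
  obtain ⟨z, z', hz, hI⟩ := K.exists_basis_fractionalIdeal I
  obtain ⟨y, hy, hi⟩ := ((IsFractionRing.isAlgebraic_iff ℤ ℚ E).2
    (Algebra.IsAlgebraic.isAlgebraic z)).exists_integral_multiple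
  rw [zsmul_eq_mul] at hi
  have hmem := mem_unit_of_isIntegral_smul (isIntegral_algebraMap (R := ℤ) (A := E) (x := y))
    (mem_unit_of_isIntegral_smul hi ((hI z).2 ⟨1, 0, by simp⟩))
  have h0 : (y : E) * z ≠ 0 := mul_ne_zero (by exact_mod_cast hy) hz
  have e : algebraMap ℤ E y * (y * z * z) = (y * z) ^ 2 := by
    rw [algebraMap_int_eq, eq_intCast]
    ring
  rw [e] at hmem
  refine ⟨_, hmem, ?_, ?_⟩
  · rw [map_pow]
    exact sq_pos_of_ne_zero (map_ne_zero K.ι |>.2 h0)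
  · unfold conj
    rw [map_pow, map_pow]
    exact sq_pos_of_ne_zero ((map_ne_zero K.ι).2 ((map_ne_zero K.σ).2 h0))

lemma exists_minimal_totallyPositive (K : RealQuadratic E)
    (I : (FractionalIdeal (𝓞 E)⁰ E)ˣ) :
    ∃ β ∈ (I : FractionalIdeal (𝓞 E)⁰ E), (0 < K.ι β ∧ 0 < K.conj β) ∧
      ∀ γ ∈ (I : FractionalIdeal (𝓞 E)⁰ E), 0 < K.ι γ → 0 < K.conj γ →
        K.ι β + K.conj β ≤ K.ι γ + K.conj γ := by
  obtain ⟨a, b, -, hI⟩ := K.exists_basis_fractionalIdeal I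
  have hrat : ∀ x : E, ∃ q : ℚ, K.ι x + K.conj x = q := by
    intro x
    obtain ⟨p, q, rfl⟩ := K.exists_eq x
    refine ⟨2 * p, ?_⟩
    simp [conj, K.σ_δ]
    ring
  obtain ⟨q, hq⟩ := hrat a
  obtain ⟨r, hr⟩ := hrat b
  have hden : ∀ s : ℚ, (s.den : ℝ) * s = s.num := fun s => by
    exact_mod_cast s.den_mul_eq_num
  have hint : ∀ x ∈ (I : FractionalIdeal (𝓞 E)⁰ E),
      ∃ t : ℤ, (q.den * r.den : ℝ) * (K.ι x + K.conj x) = t := by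
    intro x hx
    obtain ⟨m, n, rfl⟩ := (hI x).1 hx
    refine ⟨m * (q.num * r.den) + n * (q.den * r.num), ?_⟩
    unfold conj at *
    push_cast
    simp only [map_add, map_mul, map_intCast]
    rw [← hden q, ← hden r, ← hq, ← hr]
    ring
  have hpos : (0 : ℝ) < q.den * r.den := by
    have := q.den_pos
    have := r.den_pos
    positivity
  have hex : ∃ t : ℕ, ∃ x ∈ (I : FractionalIdeal (𝓞 E)⁰ E), (0 < K.ι x ∧ 0 < K.conj x) ∧
      (q.den * r.den : ℝ) * (K.ι x + K.conj x) = t := by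
    obtain ⟨x, hx, h1, h2⟩ := K.exists_totallyPositive_mem I
    obtain ⟨t, ht⟩ := hint x hx
    refine ⟨t.toNat, x, hx, ⟨h1, h2⟩, ?_⟩
    have : (0 : ℝ) < t := by rw [← ht]; positivity
    have h0 : 0 < t := by exact_mod_cast this
    rw [ht]
    exact_mod_cast (Int.toNat_of_nonneg h0.le).symm
  classical
  obtain ⟨β, hβ, hβ', ht⟩ := Nat.find_spec hex
  refine ⟨β, hβ, hβ', fun γ hγ h1 h2 => ?_⟩
  obtain ⟨t, ht'⟩ := hint γ hγ
  have h0 : 0 < t := by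
    have : (0 : ℝ) < t := by rw [← ht']; positivity
    exact_mod_cast this
  have e : ((t.toNat : ℕ) : ℝ) = t := by exact_mod_cast Int.toNat_of_nonneg h0.le
  have hle : Nat.find hex ≤ t.toNat := Nat.find_min' hex ⟨γ, hγ, ⟨h1, h2⟩, by rw [ht', e]⟩
  have : (Nat.find hex : ℝ) ≤ t := by rw [← e]; exact_mod_cast hle
  rw [← ht, ← ht'] at this
  exact le_of_mul_le_mul_left this hpos

/-- Let β in I be totally positive of least trace. It is primitive, so I has a basis α, β, and I/β =
ℤ(α/β) + ℤ has the same narrow class. Change the sign and translate α/β to get w with 0 < σ(w) < 1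
and σ(w) < w. If w < 1, then wβ would be totally positive in I with smaller trace. -/
lemma exists_reduced (K : RealQuadratic E) (A : NarrowClassGroup E) :
    ∃ w : E, K.Reduced w ∧ LatticeClass A w := by
  obtain ⟨I, rfl⟩ := QuotientGroup.mk_surjective A
  obtain ⟨a, b, -, hI⟩ := K.exists_basis_fractionalIdeal I
  obtain ⟨β, hβ, ⟨hβ1, hβ2⟩, hmin⟩ := K.exists_minimal_totallyPositive I
  obtain ⟨m, n, hmn⟩ := (hI β).1 hβ
  have hβ0 : β ≠ 0 := K.ne_zero_of_ι hβ1.ne'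
  have hgcd : IsCoprime m n := by
    rw [Int.isCoprime_iff_gcd_eq_one]
    obtain ⟨m', hm⟩ := Int.gcd_dvd_left m n
    obtain ⟨n', hn⟩ := Int.gcd_dvd_right m n
    set g := Int.gcd m n
    have hβg : β = g * (m' * a + n' * b) := by
      rw [hmn, hm, hn]
      push_cast
      ring
    have hg0 : g ≠ 0 := by
      intro h
      rw [h] at hβg
      simp at hβg
      exact hβ0 hβg
    have hgpos : (0 : ℝ) < g := by positivity
    set γ : E := m' * a + n' * b
    have k1 : K.ι β = g * K.ι γ := by rw [hβg]; simp
    have k2 : K.conj β = g * K.conj γ := by rw [hβg]; simp [conj]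
    have k3 : 0 < K.ι γ := pos_of_mul_pos_right (k1 ▸ hβ1) hgpos.le
    have k4 : 0 < K.conj γ := pos_of_mul_pos_right (k2 ▸ hβ2) hgpos.le
    have := hmin γ ((hI γ).2 ⟨m', n', rfl⟩) k3 k4
    rw [k1, k2, ← mul_add] at this
    have hg1 : (g : ℝ) ≤ 1 := by
      by_contra! hlt
      nlinarith
    have : g ≤ 1 := by exact_mod_cast hg1
    omega
  obtain ⟨u, v, huv⟩ := hgcd
  have huv' : (u : E) * m + v * n = 1 := by exact_mod_cast huv
  set α : E := -v * a + u * b with hα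
  have hIαβ : ∀ x : E, x ∈ (I : FractionalIdeal (𝓞 E)⁰ E) ↔ ∃ p q : ℤ, x = p * α + q * β := by
    intro x
    rw [hI]
    constructor
    · rintro ⟨p, q, rfl⟩
      refine ⟨-p * n + q * m, p * u + q * v, ?_⟩
      rw [hα, hmn]
      push_cast
      linear_combination (-(p : E) * a - q * b) * huv'
    · rintro ⟨p, q, rfl⟩
      refine ⟨-p * v + q * m, p * u + q * n, ?_⟩
      rw [hα, hmn]
      push_cast
      ring
  let β' : Eˣ := Units.mk0 β hβ0
  have hcl : LatticeClass (narrowClass I) (α / β) := by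
    refine ⟨toPrincipalIdeal (𝓞 E) E β'⁻¹ * I, fun y => ?_, ?_⟩
    · rw [mem_toPrincipalIdeal_mul, Units.val_inv_eq_inv_val]
      change (∃ z ∈ _, y = β⁻¹ * z) ↔ _
      constructor
      · rintro ⟨z, hz, rfl⟩
        obtain ⟨p, q, rfl⟩ := (hIαβ z).1 hz
        exact ⟨p, q, by field_simp⟩
      · rintro ⟨p, q, rfl⟩
        exact ⟨p * α + q * β, (hIαβ _).2 ⟨p, q, rfl⟩, by field_simp⟩
    · rw [narrowClass_mul]
      change narrowClassOfElement β'⁻¹ * narrowClass I = _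
      rw [narrowClassOfElement_eq_one, narrowClass_one_mul]
      intro φ
      rw [Units.val_inv_eq_inv_val, map_inv₀]
      exact inv_pos.2 (K.forall_embedding_pos hβ1 hβ2 φ)
  obtain ⟨w0, p0, q0, hw0, hw0', hlt⟩ : ∃ (w0 : E) (p0 q0 : ℤ), LatticeClass (narrowClass I) w0 ∧
      w0 * β = p0 * α + q0 * β ∧ K.conj w0 < K.ι w0 := by
    rcases lt_trichotomy (K.conj (α / β)) (K.ι (α / β)) with h | h | h
    · exact ⟨α / β, 1, 0, hcl, by field_simp; simp, h⟩
    · exact absurd (K.ι.injective h) (LatticeClass.σ_ne hcl)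
    · refine ⟨-(α / β), -1, 0, hcl.neg, by field_simp; simp, ?_⟩
      unfold conj at *
      simp only [map_neg] at *
      linarith
  set w : E := w0 + (-⌊K.conj w0⌋ : ℤ) with hw
  have hwcl : LatticeClass (narrowClass I) w := hw0.add_intCast _
  have hwσ : K.σ w ≠ w := LatticeClass.σ_ne hwcl
  have c1 : K.conj w = K.conj w0 - ⌊K.conj w0⌋ := by
    rw [hw]
    unfold conj
    rw [map_add, map_add, map_intCast, map_intCast]
    push_cast
    ring
  have c2 : K.ι w = K.ι w0 - ⌊K.conj w0⌋ := by
    rw [hw]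
    simp
    ring
  have hlt' : K.conj w < K.ι w := by rw [c1, c2]; linarith
  have hc0 : 0 < K.conj w := by
    refine lt_of_le_of_ne (by rw [c1]; linarith [Int.floor_le (K.conj w0)]) fun h => hwσ ?_
    have h1 : K.σ w = 0 := K.ι.injective (by rw [map_zero]; exact h.symm)
    have h2 : w = 0 := K.σ.injective (by rw [map_zero]; exact h1)
    rw [h1, h2]
  refine ⟨w, ⟨?_, hc0, by rw [c1]; linarith [Int.lt_floor_add_one (K.conj w0)]⟩, hwcl⟩
  by_contra! hle
  have hlt1 : K.ι w < 1 := by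
    refine lt_of_le_of_ne hle fun h => hwσ ?_
    have : w = 1 := K.ι.injective (by rw [map_one]; exact h)
    rw [this, map_one]
  have hmem : w * β ∈ (I : FractionalIdeal (𝓞 E)⁰ E) := by
    refine (hIαβ _).2 ⟨p0, q0 + -⌊K.conj w0⌋, ?_⟩
    rw [hw, add_mul, hw0']
    push_cast
    ring
  have k1 : K.ι (w * β) = K.ι w * K.ι β := map_mul _ _ _
  have k2 : K.conj (w * β) = K.conj w * K.conj β := by unfold conj; rw [map_mul, map_mul]
  have := hmin _ hmem (by rw [k1]; exact mul_pos (by linarith) hβ1)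
    (by rw [k2]; exact mul_pos hc0 hβ2)
  rw [k1, k2] at this
  nlinarith

end RealQuadratic

/-! ### The cycle of a class as a periodic chain. -/

lemma exists_partialSum (N : ℤ → ℤ) :
    ∃ c : ℤ → ℤ, c 0 = 0 ∧ (∀ k, c (k + 1) = c k + N k) ∧
      ∀ k : ℕ, c k = ∑ i ∈ Finset.range k, N i := by
  refine ⟨fun k => k.casesOn (fun n => ∑ i ∈ Finset.range n, N i)
    (fun n => -∑ i ∈ Finset.range (n + 1), N (Int.negSucc i)), rfl, fun k => ?_, fun k => rfl⟩
  rcases k with n | n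
  · exact Finset.sum_range_succ (fun i : ℕ => N i) n
  · rcases n with _ | n
    · change (0 : ℤ) = -∑ i ∈ Finset.range 1, N (Int.negSucc i) + N (Int.negSucc 0)
      simp
    · change -∑ i ∈ Finset.range (n + 1), N (Int.negSucc i) =
        -∑ i ∈ Finset.range (n + 1 + 1), N (Int.negSucc i) + N (Int.negSucc (n + 1))
      rw [Finset.sum_range_succ _ (n + 1)]
      ring

namespace RealQuadratic

variable {E : Type*} [Field E] [NumberField E] {K : RealQuadratic E}

/-- The reduced numbers with class in `S`. -/
def reducedSet (K : RealQuadratic E) (S : Set (NarrowClassGroup E)) : Set E :=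
  {w | K.Reduced w ∧ ∃ A ∈ S, LatticeClass A w}

lemma finite_reducedSet (S : Set (NarrowClassGroup E)) : (K.reducedSet S).Finite :=
  K.finite_reduced.subset fun _ hw => ⟨hw.1, hw.2.imp fun _ h => h.2⟩

lemma step_mem_reducedSet {S : Set (NarrowClassGroup E)} {w : E} (hw : w ∈ K.reducedSet S) :
    K.step w ∈ K.reducedSet S := by
  obtain ⟨hw, A, hA, hwA⟩ := hw
  exact ⟨hw.step, A, hA, hw.latticeClass_step hwA⟩

lemma iterate_step_mem_reducedSet {S : Set (NarrowClassGroup E)} {w : E}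
    (hw : w ∈ K.reducedSet S) (k : ℕ) : K.step^[k] w ∈ K.reducedSet S := by
  induction k with
  | zero => exact hw
  | succ k ih =>
    rw [Function.iterate_succ_apply']
    exact step_mem_reducedSet ih

/-- An injective map of the finite set of reduced numbers has only periodic orbits. The positive
period matters because the minimal period of a nonperiodic point is 0 by convention. -/
lemma minimalPeriod_step_pos {S : Set (NarrowClassGroup E)} {w : E} (hw : w ∈ K.reducedSet S) :
    0 < Function.minimalPeriod K.step w := by
  have hni : ¬ Function.Injective fun k : ℕ => K.step^[k] w := fun hinj =>
    Set.infinite_of_injective_forall_mem hinj (iterate_step_mem_reducedSet hw)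
      (finite_reducedSet S)
  have key : ∀ i j : ℕ, i < j → K.step^[i] w = K.step^[j] w →
      0 < Function.minimalPeriod K.step w := by
    intro i
    induction i with
    | zero => exact fun j hj h => Function.IsPeriodicPt.minimalPeriod_pos hj h.symm
    | succ i ih =>
      intro j hj h
      obtain ⟨j, rfl⟩ : ∃ j', j = j' + 1 := ⟨j - 1, by omega⟩
      rw [Function.iterate_succ_apply', Function.iterate_succ_apply'] at h
      exact ih j (by omega) (step_injective (iterate_step_mem_reducedSet hw i).1
        (iterate_step_mem_reducedSet hw j).1 h)
  unfold Function.Injective at hni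
  push Not at hni
  obtain ⟨i, j, h, hij⟩ := hni
  rcases lt_or_gt_of_ne hij with hlt | hlt
  · exact key i j hlt h
  · exact key j i hlt h.symm

lemma ι_iterate_step (k : ℕ) (w : E) : K.ι (K.step^[k] w) = minusStep^[k] (K.ι w) :=
  (Function.Semiconj.iterate_right (f := K.ι) (fun x => K.ι_step_eq_minusStep x) k) w

lemma minusPeriod_ι (w : E) : minusPeriod (K.ι w) = Function.minimalPeriod K.step w := by
  refine Function.minimalPeriod_eq_minimalPeriod_iff.2 fun n => ?_
  unfold Function.IsPeriodicPt Function.IsFixedPt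
  rw [← ι_iterate_step]
  exact K.ι.injective.eq_iff

lemma exists_chain {A : NarrowClassGroup E} {w : E} (hw : w ∈ K.reducedSet {A}) :
    ∃ X : ReducedChain, X.ℓ = Function.minimalPeriod K.step w ∧
      (∀ k : ℕ, X.c k = minusDigitSum (K.ι w) k) ∧
      ∀ k : ℕ, X.N k = ⌈K.ι (K.step^[k] w)⌉ ∧ X.W k = K.ι (K.step^[k] w) ∧
        X.W' k = K.conj (K.step^[k] w) := by
  set ℓ := Function.minimalPeriod K.step w with hℓ
  have hpos : 0 < ℓ := minimalPeriod_step_pos hw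
  have hℓ0 : (ℓ : ℤ) ≠ 0 := by omega
  -- Periodicity extends the orbit to negative indices, as the two-sided chain needs.
  set v : ℤ → E := fun k => K.step^[(k % ℓ).toNat] w with hv
  have hvnat : ∀ k : ℕ, v k = K.step^[k] w := fun k => by
    have : ((k : ℤ) % ℓ).toNat = k % ℓ := by rw [← Int.natCast_mod, Int.toNat_natCast]
    simp only [hv, this]
    exact Function.iterate_mod_minimalPeriod_eq
  have hvadd : ∀ k, v (k + ℓ) = v k := fun k => by simp [hv]
  have hvsucc : ∀ k, v (k + 1) = K.step (v k) := fun k => by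
    have e : (k + 1) % (ℓ : ℤ) = (((k % ℓ).toNat + 1 : ℕ) : ℤ) % ℓ := by
      push_cast
      rw [Int.toNat_of_nonneg (Int.emod_nonneg k hℓ0), Int.emod_add_emod]
    have e2 : v (k + 1) = v (((k % ℓ).toNat + 1 : ℕ) : ℤ) := by simp only [hv, e]
    rw [e2, hvnat, Function.iterate_succ_apply']
  have hmem : ∀ k, v k ∈ K.reducedSet {A} := fun k => iterate_step_mem_reducedSet hw _
  obtain ⟨c, c0, csucc, csum⟩ := exists_partialSum fun k => ⌈K.ι (v k)⌉
  refine ⟨{ N := fun k => ⌈K.ι (v k)⌉, c := c, W := fun k => K.ι (v k),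
            W' := fun k => K.conj (v k), ℓ := ℓ, Δ := 4 * K.D, ℓ_pos := hpos, c_zero := c0,
            c_succ := csucc
            W_eq := fun k => ?_
            W'_eq := fun k => ?_
            one_lt_W := fun k => (hmem k).1.1
            W'_pos := fun k => (hmem k).1.2.1
            W'_lt_one := fun k => (hmem k).1.2.2
            W_add := fun k => by rw [hvadd]
            W'_add := fun k => by rw [hvadd]
            N_add := fun k => by rw [hvadd]
            form := fun k => ?_ }, rfl, fun k => ?_, fun k => ⟨?_, ?_, ?_⟩⟩
  · rw [hvsucc, ι_step, inv_inv, sub_sub_cancel]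
  · rw [hvsucc, conj_step, inv_inv, sub_sub_cancel]
  · obtain ⟨h1, B, -, h2⟩ := hmem k
    obtain ⟨P, Q, R, p1, p2, p3, p4, -⟩ := LatticeClass.exists_form h2 h1.conj_lt
    exact ⟨P, Q, R, p1, p2, p3, p4⟩
  · refine (csum k).trans (Finset.sum_congr rfl fun i _ => ?_)
    rw [hvnat, ι_iterate_step]
  · simp only [hvnat]
  · simp only [hvnat]
  · simp only [hvnat]

lemma bijective_iterate_step {A : NarrowClassGroup E} {w : E} (hw : w ∈ K.reducedSet {A}) :
    Function.Bijective fun k : Fin (Function.minimalPeriod K.step w) =>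
      (⟨K.step^[k] w, iterate_step_mem_reducedSet hw k⟩ : K.reducedSet {A}) := by
  constructor
  · intro i j hij
    exact Fin.ext (Function.iterate_injOn_Iio_minimalPeriod i.2 j.2 (congrArg Subtype.val hij))
  · rintro ⟨v, hv⟩
    have hpos := minimalPeriod_step_pos hw
    obtain ⟨k, hk⟩ : ∃ k : ℕ, K.step^[k] w = v := by
      obtain ⟨h1, A', rfl, h2⟩ := hw
      obtain ⟨h3, A'', rfl, h4⟩ := id hv
      rcases exists_iterate_step_of_latticeClass h1 h3 h2 h4 with h | ⟨k, hk⟩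
      · exact h
      · have hp := minimalPeriod_step_pos hv
        -- If v reaches w in k steps, then w returns to v after completing k full periods of v.
        refine ⟨Function.minimalPeriod K.step v * k - k, ?_⟩
        rw [← hk, ← Function.iterate_add_apply, Nat.sub_add_cancel (Nat.le_mul_of_pos_left k hp)]
        exact (Function.isPeriodicPt_minimalPeriod K.step v).mul_const k
    refine ⟨⟨k % _, Nat.mod_lt _ hpos⟩, Subtype.ext ?_⟩
    exact Function.iterate_mod_minimalPeriod_eq.trans hk

open MeasureTheory in
lemma measure_orbifoldDomain (K : RealQuadratic E) {μ : Measure ℍ}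
    [SMulInvariantMeasure SL(2, ℤ) ℍ μ] (hμ : μ ≪ volume) (A : NarrowClassGroup E) :
    μ (orbifoldDomain K.ι A) =
      ∑' w : K.reducedSet {A}, μ (gapCell ⌈K.ι (w : E)⌉ (K.conj (w : E)) (K.ι (w : E))) := by
  have hex : ∃ w, IsReducedRepresentative K.ι A w := by
    obtain ⟨w, h1, h2⟩ := K.exists_reduced A
    exact ⟨w, K.isReducedRepresentative_iff.2 ⟨h1.1, h1.2, h2⟩⟩
  have hrep : IsReducedRepresentative K.ι A (reducedRepresentative K.ι A) :=
    Classical.epsilon_spec hex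
  obtain ⟨h1, h2, h3⟩ := K.isReducedRepresentative_iff.1 hrep
  unfold orbifoldDomain
  generalize reducedRepresentative K.ι A = w at *
  have hw : w ∈ K.reducedSet {A} := ⟨⟨h1, h2⟩, A, rfl, h3⟩
  obtain ⟨X, hℓ, hc, hX⟩ := exists_chain hw
  have hper : minusPeriod (K.ι w) = X.ℓ := by rw [minusPeriod_ι, hℓ]
  have e1 : orbifoldPolygon (K.ι w) = X.polygon := by
    simp only [orbifoldPolygon, ReducedChain.polygon, hper, hc]
  have e2 : orbifoldGroup (K.ι w) = X.group := by
    simp only [orbifoldGroup, ReducedChain.group, ReducedChain.involution, hper, hc]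
  rw [e1, e2, X.measure_polygon_inter_nielsenRegion hμ,
    ← (Equiv.ofBijective _ (bijective_iterate_step hw)).tsum_eq, tsum_fintype, hℓ,
    Finset.sum_range]
  refine Finset.sum_congr rfl fun k _ => ?_
  obtain ⟨a, b, c⟩ := hX k
  rw [a, b, c]
  rfl

end RealQuadratic

lemma LatticeClass.unique {E : Type*} [Field E] [NumberField E] {A B : NarrowClassGroup E} {x : E}
    (hA : LatticeClass A x) (hB : LatticeClass B x) : A = B := by
  obtain ⟨I, hI, rfl⟩ := hA
  obtain ⟨J, hJ, rfl⟩ := hB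
  congr 1
  exact Units.ext (FractionalIdeal.ext fun y => (hI y).trans (hJ y).symm)

namespace RealQuadratic

open MeasureTheory

variable {E : Type*} [Field E] [NumberField E] {K : RealQuadratic E}
  {S : Set (NarrowClassGroup E)}

/-! ### Summing over the reduced numbers of a set of classes -/

instance : Finite (K.reducedSet S) := (finite_reducedSet S).to_subtype

lemma bijective_step : Function.Bijective fun w : K.reducedSet S =>
    (⟨K.step w, step_mem_reducedSet w.2⟩ : K.reducedSet S) :=
  Function.Injective.bijective_of_finite fun v w h =>
    Subtype.ext (step_injective v.2.1 w.2.1 (congrArg Subtype.val h))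

lemma bijective_sigma_reducedSet : Function.Bijective
    fun p : (A : S) × K.reducedSet {(A : NarrowClassGroup E)} =>
      (⟨p.2, p.2.2.1, p.1, p.1.2, by
        obtain ⟨-, A, rfl, h⟩ := p.2.2
        exact h⟩ : K.reducedSet S) := by
  constructor
  · rintro ⟨A, v, hv⟩ ⟨B, w, hw⟩ h
    obtain rfl : v = w := congrArg Subtype.val h
    obtain ⟨-, A', hA, hA'⟩ := id hv
    obtain ⟨-, B', hB, hB'⟩ := id hw
    obtain rfl : A = B := Subtype.ext (hA.symm.trans ((hA'.unique hB').trans hB))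
    rfl
  · rintro ⟨w, hw, A, hA, hwA⟩
    exact ⟨⟨⟨A, hA⟩, ⟨w, hw, A, rfl, hwA⟩⟩, rfl⟩

/-- The map `(w, j) ↦ 1 - 1 / σ (w - j)`. -/
noncomputable def flip (K : RealQuadratic E) (w : E) (j : ℤ) : E := 1 - (K.σ (w - j))⁻¹

lemma ι_flip (w : E) (j : ℤ) : K.ι (K.flip w j) = 1 - (K.conj w - j)⁻¹ := by
  simp [flip, conj]

lemma conj_flip (w : E) (j : ℤ) : K.conj (K.flip w j) = 1 - (K.ι w - j)⁻¹ := by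
  simp [flip, conj, K.σ_σ]

lemma one_lt_ι_sub {w : E} {j : ℤ} (hj : j ∈ Finset.Ioo 0 (⌈K.ι w⌉ - 1)) : 1 < K.ι w - j := by
  have h1 : (j + 1 : ℤ) < ⌈K.ι w⌉ := by have := (Finset.mem_Ioo.1 hj).2; omega
  have h2 := Int.lt_ceil.1 h1
  push_cast at h2
  linarith

lemma conj_sub_neg {w : E} (hw : K.Reduced w) {j : ℤ} (hj : j ∈ Finset.Ioo 0 (⌈K.ι w⌉ - 1)) :
    K.conj w - j < 0 := by
  have h1 : (1 : ℤ) ≤ j := (Finset.mem_Ioo.1 hj).1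
  have h2 : (1 : ℝ) ≤ j := by exact_mod_cast h1
  linarith [hw.2.2]

lemma latticeClass_inv_σ {δ : Eˣ} (hδ : (δ : E) = K.δ) {A : NarrowClassGroup E} {x : E}
    (hx : LatticeClass A x) (h : K.ι x * K.conj x < 0) :
    ∃ B, B * A = narrowClass 1 ∧ LatticeClass (narrowClassOfElement δ * B) (K.σ x)⁻¹ := by
  obtain ⟨B, hBA, hB⟩ := K.latticeClass_σ hx (LatticeClass.σ_ne hx)
  refine ⟨B, hBA, K.inv_mem_of_neg δ hδ hB ?_⟩
  unfold conj at *
  rwa [K.σ_σ, mul_comm]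

lemma flip_mem_reducedSet {δ : Eˣ} (hδ : (δ : E) = K.δ)
    (hS : ∀ A ∈ S, ∀ B, B * A = narrowClass 1 → narrowClassOfElement δ * B ∈ S) {w : E}
    (hw : w ∈ K.reducedSet S) {j : ℤ} (hj : j ∈ Finset.Ioo 0 (⌈K.ι w⌉ - 1)) :
    K.flip w j ∈ K.reducedSet S := by
  obtain ⟨hw, A, hA, hwA⟩ := hw
  have h1 := one_lt_ι_sub hj
  have h2 := conj_sub_neg hw hj
  have hcl : LatticeClass A (w - j) := by
    have := hwA.add_intCast (-j)
    rwa [Int.cast_neg, ← sub_eq_add_neg] at this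
  obtain ⟨B, hBA, hB⟩ := latticeClass_inv_σ hδ hcl (by
    have := mul_neg_of_pos_of_neg (zero_lt_one.trans h1) h2
    unfold conj at *
    simpa using this)
  have hB' := hB.neg.add_intCast 1
  rw [Int.cast_one, neg_add_eq_sub] at hB'
  refine ⟨⟨?_, ?_, ?_⟩, _, hS A hA B hBA, hB'⟩
  · rw [ι_flip]
    linarith [inv_lt_zero.2 h2]
  · rw [conj_flip]
    linarith [inv_lt_one_of_one_lt₀ h1]
  · rw [conj_flip]
    linarith [inv_pos.2 (zero_lt_one.trans h1)]

/-- To recover (w, j) from v, put x = 1/σ(1 - v), so that x > 1 and σ(x) < 0. Exactly one integer j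
moves σ(x) into (0, 1), namely j = -⌊σ(x)⌋, and then w = x + j. -/
lemma bijective_flip {δ : Eˣ} (hδ : (δ : E) = K.δ)
    (hS : ∀ A ∈ S, ∀ B, B * A = narrowClass 1 → narrowClassOfElement δ * B ∈ S) :
    Function.Bijective fun p : (w : K.reducedSet S) × Finset.Ioo 0 (⌈K.ι (w : E)⌉ - 1) =>
      (⟨K.flip p.1 p.2, flip_mem_reducedSet hδ hS p.1.2 p.2.2⟩ : K.reducedSet S) := by
  constructor
  · rintro ⟨⟨v, hv⟩, ⟨i, hi⟩⟩ ⟨⟨w, hw⟩, ⟨j, hj⟩⟩ h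
    have h1 : K.flip v i = K.flip w j := congrArg Subtype.val h
    unfold flip at h1
    have h2 : v - i = w - j := K.σ.injective (inv_injective (sub_right_injective h1))
    obtain rfl : v = w := eq_of_sub_intCast hw.1 hv.1 (i - j) (by
      push_cast
      linear_combination h2)
    obtain rfl : i = j := by exact_mod_cast sub_right_injective h2
    rfl
  · rintro ⟨v, hv, A, hA, hvA⟩
    obtain ⟨hv1, hv2, hv3⟩ := id hv
    have hcl : LatticeClass A (1 - v) := by
      have := hvA.neg.add_intCast 1
      rwa [Int.cast_one, neg_add_eq_sub] at this
    have e1 : K.ι (1 - v) = 1 - K.ι v := by simp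
    have e2 : K.conj (1 - v) = 1 - K.conj v := by simp [conj]
    obtain ⟨B, hBA, hB⟩ := latticeClass_inv_σ hδ hcl (by
      rw [e1, e2]
      exact mul_neg_of_neg_of_pos (by linarith) (by linarith))
    set x := (K.σ (1 - v))⁻¹ with hx
    have hσx : K.σ x = (1 - v)⁻¹ := by rw [hx, map_inv₀, K.σ_σ]
    have hιx : K.ι x = (1 - K.conj v)⁻¹ := by rw [hx, map_inv₀, ← e2, conj]
    have hcx : K.conj x = (1 - K.ι v)⁻¹ := by rw [conj, hσx, map_inv₀, e1]
    have h1 : 1 < K.ι x := by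
      rw [hιx]
      exact (one_lt_inv₀ (by linarith)).2 (by linarith)
    have h2 : K.conj x < 0 := by
      rw [hcx]
      exact inv_lt_zero.2 (by linarith)
    set j : ℤ := -⌊K.conj x⌋ with hj
    have hj0 : 0 < j := by
      have : ⌊K.conj x⌋ < 0 := Int.floor_lt.2 (by exact_mod_cast h2)
      omega
    have hj0' : (0 : ℝ) < j := by exact_mod_cast hj0
    have c1 : K.ι (x + j) = K.ι x + j := by simp
    have c2 : K.conj (x + j) = K.conj x + j := by simp [conj]
    have hjr : (j : ℝ) = -⌊K.conj x⌋ := by rw [hj]; push_cast; rfl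
    have hred : K.Reduced (x + j) := by
      refine ⟨by rw [c1]; linarith, lt_of_le_of_ne ?_ fun h => ?_, ?_⟩
      · rw [c2, hjr]
        linarith [Int.floor_le (K.conj x)]
      · have h3 : x + j = 0 := K.σ.injective (K.ι.injective (by simpa [conj] using h.symm))
        rw [h3, map_zero] at c1
        linarith
      · rw [c2, hjr]
        linarith [Int.lt_floor_add_one (K.conj x)]
    have hjmem : j ∈ Finset.Ioo 0 (⌈K.ι (x + j)⌉ - 1) := by
      have : j + 1 < ⌈K.ι (x + j)⌉ := Int.lt_ceil.2 (by rw [c1]; push_cast; linarith)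
      exact Finset.mem_Ioo.2 ⟨hj0, by omega⟩
    refine ⟨⟨⟨x + j, hred, _, hS A hA B hBA, hB.add_intCast j⟩, ⟨j, hjmem⟩⟩, Subtype.ext ?_⟩
    simp only [flip, add_sub_cancel_right, hσx, inv_inv, sub_sub_cancel]

/-- The total measure of the orbifolds of a set of classes that is stable under `A ↦ J A⁻¹`. -/
lemma tsum_measure_orbifoldDomain {δ : Eˣ} (hδ : (δ : E) = K.δ)
    (hS : ∀ A ∈ S, ∀ B, B * A = narrowClass 1 → narrowClassOfElement δ * B ∈ S)
    {μ : Measure ℍ} [SMulInvariantMeasure SL(2, ℤ) ℍ μ] (hμ : μ ≪ volume) :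
    ∑' A : S, μ (orbifoldDomain K.ι A) = ENat.card (K.reducedSet S) * μ fareyTriangle := by
  set t₁ : E → ℝ≥0∞ := fun w => μ (fareyTriangle ∩ {z | 1 < sqDistReal 0 z} ∩
    {z | 0 < geodesicForm (K.conj w) (K.ι w) z}) with ht₁
  set t₂ : E → ℝ≥0∞ := fun w => μ (fareyTriangle ∩ {z | 1 < sqDistReal 1 z} ∩
    {z | 0 < geodesicForm (1 - (K.conj w)⁻¹) (1 - (K.ι w)⁻¹) z}) with ht₂
  set below : E → ℝ≥0∞ := fun w => μ (fareyTriangle ∩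
    {z | geodesicForm (K.conj w) (K.ι w) z < 0}) with hbelow
  have hcell : ∀ w : K.reducedSet S,
      μ (gapCell ⌈K.ι (w : E)⌉ (K.conj (w : E)) (K.ι (w : E))) = t₁ w + t₂ (K.step w) +
        ∑' j : Finset.Ioo 0 (⌈K.ι (w : E)⌉ - 1), below (K.flip w j) := by
    intro w
    have hw := w.2.1
    generalize (w : E) = w at *
    have h1 := Int.ceil_lt_add_one (K.ι w)
    rw [measure_gapCell hμ hw.two_le hw.2.1 hw.2.2 (by linarith),
      Finset.tsum_subtype (Finset.Ioo 0 (⌈K.ι w⌉ - 1)) fun j => below (K.flip w j)]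
    congr 1
    · congr 1
      simp only [ht₂, ι_step, conj_step, inv_inv]
      -- The last strip belongs to the next reduced number: w - (n - 1) = 1 - (n - w), and n - w is
      -- the inverse of `step w`.
      rw [show K.conj w - (⌈K.ι w⌉ - 1 : ℝ) = 1 - (⌈K.ι w⌉ - K.conj w) by ring,
        show K.ι w - (⌈K.ι w⌉ - 1 : ℝ) = 1 - (⌈K.ι w⌉ - K.ι w) by ring]
    · refine Finset.sum_congr rfl fun j hj => ?_
      simp only [hbelow, ι_flip, conj_flip]
      simp only [geodesicForm_comm (K.conj w - j)]
      rw [measure_fareyTriangle_above_eq_below (zero_lt_one.trans (one_lt_ι_sub hj))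
        (conj_sub_neg hw hj)]
      simp only [geodesicForm_comm (1 - (K.conj w - j)⁻¹)]
  -- All terms attached to one reduced number, although they come from different cells, fill the
  -- whole triangle.
  have hsum : ∀ w : K.reducedSet S, t₁ w + t₂ w + below w = μ fareyTriangle := by
    intro w
    have hw := w.2.1
    simp only [ht₁, ht₂]
    rw [measure_fareyTriangle_above_add hμ hw.2.1 (zero_lt_one.trans hw.1),
      measure_fareyTriangle_above_add_below hμ]
  calc ∑' A : S, μ (orbifoldDomain K.ι A)
      = ∑' (A : S) (w : K.reducedSet {(A : NarrowClassGroup E)}),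
          μ (gapCell ⌈K.ι (w : E)⌉ (K.conj (w : E)) (K.ι (w : E))) :=
        tsum_congr fun A => K.measure_orbifoldDomain hμ A
    _ = ∑' w : K.reducedSet S, μ (gapCell ⌈K.ι (w : E)⌉ (K.conj (w : E)) (K.ι (w : E))) := by
        rw [← ENNReal.tsum_sigma, ← (Equiv.ofBijective _ bijective_sigma_reducedSet).tsum_eq]
        rfl
    _ = ∑' w : K.reducedSet S, t₁ w + ∑' w : K.reducedSet S, t₂ (K.step w) +
          ∑' w : K.reducedSet S, ∑' j : Finset.Ioo 0 (⌈K.ι (w : E)⌉ - 1), below (K.flip w j) := by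
        rw [← ENNReal.tsum_add, ← ENNReal.tsum_add]
        exact tsum_congr hcell
    -- Reindex the last pieces along the permutation `step` and the middle pieces along the
    -- bijection `flip`; the latter needs the stability of S.
    _ = ∑' w : K.reducedSet S, t₁ w + ∑' w : K.reducedSet S, t₂ w +
          ∑' w : K.reducedSet S, below w := by
        rw [← ENNReal.tsum_sigma,
          ← (Equiv.ofBijective _ bijective_step).tsum_eq fun w : K.reducedSet S => t₂ w,
          ← (Equiv.ofBijective _ (bijective_flip hδ hS)).tsum_eq fun w : K.reducedSet S => below w]
        rfl
    _ = ENat.card (K.reducedSet S) * μ fareyTriangle := by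
        rw [← ENNReal.tsum_add, ← ENNReal.tsum_add, tsum_congr hsum, ENNReal.tsum_const]

end RealQuadratic

/-! ### Measures on the modular surface -/

lemma smul_mem_modularPreimage (B : Set ModularSurface) (g : SL(2, ℤ)) (z : ℍ) :
    g • z ∈ modularPreimage B ↔ z ∈ modularPreimage B := by
  have : (Quotient.mk _ (g • z) : ModularSurface) = Quotient.mk _ z :=
    Quotient.sound (MulAction.orbitRel_apply.2 ⟨g, rfl⟩)
  change (Quotient.mk _ (g • z) : ModularSurface) ∈ B ↔ _
  rw [this]
  rfl

open MeasureTheory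

lemma volume_modularPreimage_eq_zero {B : Set ModularSurface} (hB : modularVolume B = 0) :
    volume (modularPreimage B) = 0 := by
  have : Countable (Matrix (Fin 2) (Fin 2) ℤ) := inferInstanceAs (Countable (Fin 2 → Fin 2 → ℤ))
  have : Countable SL(2, ℤ) := Subtype.countable
  refine measure_mono_null (t := ⋃ g : SL(2, ℤ), (g • ·) ⁻¹' (modularPreimage B ∩ 𝒟))
    (fun z hz => ?_) (measure_iUnion_null fun g => ?_)
  · obtain ⟨g, hg⟩ := ModularGroup.exists_smul_mem_fd z
    exact Set.mem_iUnion.2 ⟨g, (smul_mem_modularPreimage B g z).2 hz, hg⟩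
  · rw [measure_preimage_smul]
    exact hB

/-- Continuity of the projection puts the frontier of the preimage inside the preimage of the
frontier, which is null. -/
lemma nullMeasurableSet_modularPreimage {B : Set ModularSurface} (hB : IsContinuitySet B) :
    NullMeasurableSet (modularPreimage B) volume := by
  refine nullMeasurableSet_of_null_frontier (measure_mono_null ?_
    (volume_modularPreimage_eq_zero hB))
  exact (continuous_quotient_mk' (X := ℍ)
    (s := MulAction.orbitRel SL(2, ℤ) ℍ)).frontier_preimage_subset B

lemma smulInvariantMeasure_restrict_modularPreimage {B : Set ModularSurface}
    (hB : NullMeasurableSet (modularPreimage B) volume) :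
    SMulInvariantMeasure SL(2, ℤ) ℍ (volume.restrict (modularPreimage B)) where
  measure_preimage_smul g s _ := by
    rw [Measure.restrict_apply₀' hB, Measure.restrict_apply₀' hB,
      ← measure_preimage_smul volume g (s ∩ _)]
    congr 1
    ext z
    exact and_congr_right fun _ => (smul_mem_modularPreimage B g z).symm

/-! ### Stability of the coset CH and the equidistribution theorem. -/

lemma mul_inv_mem_coset {G : Type*} [Group G] (hcomm : ∀ a b : G, a * b = b * a)
    (H : Subgroup G) {e A B C J : G} (he : ∀ a, e * a = a) (hBA : B * A = e) (hJ : J * J = e)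
    (h : C ^ 2 * J ∈ H) (hA : A ∈ C • (H : Set G)) : J * B ∈ C • (H : Set G) := by
  obtain ⟨k, hk, rfl⟩ := hA
  obtain rfl : e = 1 := by simpa using he 1
  have hB : B = (C * k)⁻¹ := eq_inv_of_mul_eq_one_left hBA
  have hJ' : J⁻¹ = J := inv_eq_of_mul_eq_one_left hJ
  refine ⟨(C ^ 2 * J)⁻¹ * k⁻¹, H.mul_mem (H.inv_mem h) (H.inv_mem hk), ?_⟩
  calc C * ((C ^ 2 * J)⁻¹ * k⁻¹) = C * ((C⁻¹ * C⁻¹ * J) * k⁻¹) := by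
        rw [mul_inv_rev, hJ', pow_two, mul_inv_rev, hcomm J]
    _ = C⁻¹ * J * k⁻¹ := by group
    _ = J * (k⁻¹ * C⁻¹) := by rw [hcomm C⁻¹ J, mul_assoc, hcomm C⁻¹ k⁻¹]
    _ = J * B := by rw [hB, mul_inv_rev]

theorem mainTheorem9 (D : ℤ) (hD1 : 1 < D) (hD : IsFundamentalDiscriminant D)
    {E : Type*} [Field E] [NumberField E] (hE : Module.finrank ℚ E = 2)
    (ι : E →+* ℝ) (δ : Eˣ) (hδ : ι δ = Real.sqrt D)
    (H : Subgroup (NarrowClassGroup E)) (C : NarrowClassGroup E)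
    (hCH : C ^ 2 * narrowClassOfElement δ ∈ H)
    (B : Set ModularSurface) (hB : IsContinuitySet B) :
    (∑' A : (C • (H : Set (NarrowClassGroup E)) : Set (NarrowClassGroup E)),
        MeasureTheory.volume (orbifoldDomain ι A ∩ modularPreimage B)) /
      (∑' A : (C • (H : Set (NarrowClassGroup E)) : Set (NarrowClassGroup E)),
        MeasureTheory.volume (orbifoldDomain ι A)) =
      modularVolume B / modularVolume Set.univ := by
  obtain ⟨K, rfl, hK⟩ := exists_realQuadratic hD1 hD hE ι δ hδ
  set S : Set (NarrowClassGroup E) := C • (H : Set (NarrowClassGroup E)) with hS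
  have hstable : ∀ A ∈ S, ∀ B, B * A = narrowClass 1 → narrowClassOfElement δ * B ∈ S :=
    fun A hA B hBA => mul_inv_mem_coset (G := NarrowClassGroup E) (by
      rintro ⟨a⟩ ⟨b⟩
      exact congrArg QuotientGroup.mk (mul_comm a b)) H narrowClass_one_mul hBA (K.narrowClassOfElement_δ_sq δ hK.symm) hCH hA
  have hnull := nullMeasurableSet_modularPreimage hB
  have := smulInvariantMeasure_restrict_modularPreimage hnull
  -- The same count for the area restricted to ΓB and for the full area; both totals carry the same
  -- factor, three times the number of reduced numbers.
  have h1 := K.tsum_measure_orbifoldDomain hK.symm hstable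
    (Measure.restrict_le_self (s := modularPreimage B)).absolutelyContinuous
  have h2 := K.tsum_measure_orbifoldDomain hK.symm hstable (Measure.AbsolutelyContinuous.refl volume)
  rw [measure_fareyTriangle_eq
    (Measure.restrict_le_self (s := modularPreimage B)).absolutelyContinuous,
    ← measure_fd_eq (Measure.restrict_le_self (s := modularPreimage B)).absolutelyContinuous,
    ← mul_assoc] at h1
  rw [measure_fareyTriangle_eq Measure.AbsolutelyContinuous.rfl,
    ← measure_fd_eq Measure.AbsolutelyContinuous.rfl, ← mul_assoc] at h2
  simp only [Measure.restrict_apply₀' hnull] at h1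
  rw [h1, h2]
  -- Cancelling the common factor requires it to be nonzero and finite; the class C itself supplies
  -- a reduced number.
  have hne : Nonempty (K.reducedSet S) := by
    obtain ⟨w, hw, hwC⟩ := K.exists_reduced C
    exact ⟨w, hw, C, ⟨1, H.one_mem, mul_one C⟩, hwC⟩
  unfold modularVolume
  rw [ENNReal.mul_div_mul_left _ _ ?_ ?_, Set.inter_comm]
  · congr 1
    congr 1
    exact (Set.univ_inter _).symm
  · rw [ENat.card_eq_coe_natCard, ENat.toENNReal_coe]
    exact mul_ne_zero (Nat.cast_ne_zero.2 Nat.card_pos.ne') three_ne_zero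
  · rw [ENat.card_eq_coe_natCard, ENat.toENNReal_coe]
    exact ENNReal.mul_ne_top (ENNReal.natCast_ne_top _) ENNReal.ofNat_ne_top
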